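/- **Setting.** Consider formulas built from $0,1,+,\cdot,<,=$ with $\neg,\wedge,\vee,\rightarrow,\exists,\forall$ (over $\mathbb N$) and an operator $\Box$. A *witness* is an infinite binary sequence $W$ that lists, in any order and with arbitrary whitespace, input-output pairs $(i:o)$; inputs are finite lists of numbers and of finite binary strings, outputs are finite lists of numbers, both given in the order of decreasing scope. $W$ *witnesses* $A$ (under an assignment of the free variables) iff every listed pair has the syntactic form prescribed by $A$ (output may be incomplete, but there is no output in the scope of a connective or quantifier whose input is missing), no two listed pairs contradict each other (they agree on output as long as their inputs agree, where two binary strings count as agreeing when one extends the other), and: for atomic or negated $A$, $A$ is true; for $A\wedge B$ ($A\vee B$), $W$ yields witnesses for both $A$ and $B$ on inputs $0$ and $1$ (outputs $0$ or $1$ and a witness for the chosen disjunct); for $\exists x A$, $W$ outputs some $n$ and a witness for $A(n)$; for $\forall x A$, on each input $n$ it yields a witness for $A(n)$; for $A\rightarrow B$, for every $X\in 2^{\mathbb N}$ witnessing $A$, the pairs of $W$ whose first input is an initial segment of $X$, with that input removed, form a witness for $B$; for $\Box A$, $W$ outputs a code of a recursive witness for $A$. Truth is classical truth in $\mathbb N$,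 where $\Box A$ is true iff $A$ has a recursive witness. Let $A_0$ be $\forall x\exists y\; 0=0$ and let $A_{n+1}$ be $A_n\rightarrow(0=0\vee 0=0)$. **Proposition 6.** The relation "$W$ is a witness to $\phi$" is complete for second-order arithmetic, in the following sense. (i) For every formula $\phi(\vec x)$ as above there is a formula $\psi(\vec x,W)$ of second-order arithmetic, whose Gödel number is computable from that of $\phi$, such that for all $\vec x\in\mathbb N$ and all $W\in 2^{\mathbb N}$: $W$ witnesses $\phi(\vec x)$ iff $\psi(\vec x,W)$ holds in the full standard model. (ii) There is a single total recursive functional $f:\mathbb N\times 2^{\mathbb N}\to 2^{\mathbb N}$ such that for every formula $\phi(X)$ of second-order arithmetic with $X$ as its only free variable, given in prenex form (a block of set quantifiers followed by an arithmetical formula), and for every $X\in 2^{\mathbb N}$: $\phi(X)$ holds iff $f(\ulcorner\phi\urcorner,X)$ is a witness to $A_n$, where $n$ is the least positive integer such that $\phi$ is given as a $\Pi^1_n$ formula. -/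

import Mathlib

/-! ### Languages -/

/-- Terms of arithmetic over `0, 1, +, *`, with number variables `x_0, …, x_{k-1}`. Variables are
de Bruijn indices: a number quantifier binds `x_0` and shifts the other variables up by one. -/
inductive ArTerm (k : ℕ) : Type
  | var (i : Fin k) : ArTerm k
  | zero : ArTerm k
  | one : ArTerm k
  | add (s t : ArTerm k) : ArTerm k
  | mul (s t : ArTerm k) : ArTerm k

/-- The value of a term in the standard model. -/
def ArTerm.val {k : ℕ} (v : Fin k → ℕ) : ArTerm k → ℕ
  | .var i => v i
  | .zero => 0
  | .one => 1
  | .add s t => s.val v + t.val v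
  | .mul s t => s.val v * t.val v

/-- Gödel number of a term. -/
def ArTerm.code {k : ℕ} : ArTerm k → ℕ
  | .var i => Nat.pair 0 i
  | .zero => Nat.pair 1 0
  | .one => Nat.pair 2 0
  | .add s t => Nat.pair 3 (Nat.pair s.code t.code)
  | .mul s t => Nat.pair 4 (Nat.pair s.code t.code)

/-- Formulas of the language of arithmetic with the additional operator `□` (constructive truth),
with `k` free number variables. -/
inductive BoxFormula : ℕ → Type
  | eq {k : ℕ} (s t : ArTerm k) : BoxFormula k
  | lt {k : ℕ} (s t : ArTerm k) : BoxFormula k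
  | neg {k : ℕ} (A : BoxFormula k) : BoxFormula k
  | and {k : ℕ} (A B : BoxFormula k) : BoxFormula k
  | or {k : ℕ} (A B : BoxFormula k) : BoxFormula k
  | imp {k : ℕ} (A B : BoxFormula k) : BoxFormula k
  | ex {k : ℕ} (A : BoxFormula (k + 1)) : BoxFormula k
  | all {k : ℕ} (A : BoxFormula (k + 1)) : BoxFormula k
  | box {k : ℕ} (A : BoxFormula k) : BoxFormula k

/-- Gödel number of a formula with `□`. -/
def BoxFormula.code : {k : ℕ} → BoxFormula k → ℕ
  | _, .eq s t => Nat.pair 0 (Nat.pair s.code t.code)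
  | _, .lt s t => Nat.pair 1 (Nat.pair s.code t.code)
  | _, .neg A => Nat.pair 2 A.code
  | _, .and A B => Nat.pair 3 (Nat.pair A.code B.code)
  | _, .or A B => Nat.pair 4 (Nat.pair A.code B.code)
  | _, .imp A B => Nat.pair 5 (Nat.pair A.code B.code)
  | _, .ex A => Nat.pair 6 A.code
  | _, .all A => Nat.pair 7 A.code
  | _, .box A => Nat.pair 8 A.code

/-- Formulas of second order arithmetic with `k` free number variables and `m` free set variables
(de Bruijn indices in both sorts). -/
inductive SOFormula : ℕ → ℕ → Type
  | eq {k m : ℕ} (s t : ArTerm k) : SOFormula k m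
  | lt {k m : ℕ} (s t : ArTerm k) : SOFormula k m
  | mem {k m : ℕ} (t : ArTerm k) (j : Fin m) : SOFormula k m
  | neg {k m : ℕ} (φ : SOFormula k m) : SOFormula k m
  | and {k m : ℕ} (φ ψ : SOFormula k m) : SOFormula k m
  | or {k m : ℕ} (φ ψ : SOFormula k m) : SOFormula k m
  | imp {k m : ℕ} (φ ψ : SOFormula k m) : SOFormula k m
  | ex {k m : ℕ} (φ : SOFormula (k + 1) m) : SOFormula k m
  | all {k m : ℕ} (φ : SOFormula (k + 1) m) : SOFormula k m
  | exSet {k m : ℕ} (φ : SOFormula k (m + 1)) : SOFormula k m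
  | allSet {k m : ℕ} (φ : SOFormula k (m + 1)) : SOFormula k m

namespace SOFormula

/-- Gödel number of a formula of second order arithmetic. -/
def code : {k m : ℕ} → SOFormula k m → ℕ
  | _, _, .eq s t => Nat.pair 0 (Nat.pair s.code t.code)
  | _, _, .lt s t => Nat.pair 1 (Nat.pair s.code t.code)
  | _, _, .mem t j => Nat.pair 2 (Nat.pair t.code j)
  | _, _, .neg φ => Nat.pair 3 φ.code
  | _, _, .and φ ψ => Nat.pair 4 (Nat.pair φ.code ψ.code)
  | _, _, .or φ ψ => Nat.pair 5 (Nat.pair φ.code ψ.code)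
  | _, _, .imp φ ψ => Nat.pair 6 (Nat.pair φ.code ψ.code)
  | _, _, .ex φ => Nat.pair 7 φ.code
  | _, _, .all φ => Nat.pair 8 φ.code
  | _, _, .exSet φ => Nat.pair 9 φ.code
  | _, _, .allSet φ => Nat.pair 10 φ.code

/-- Truth in the full standard model; a set of natural numbers is given as an infinite binary
sequence. -/
def Holds : {k m : ℕ} → SOFormula k m → (Fin k → ℕ) → (Fin m → ℕ → Bool) → Prop
  | _, _, .eq s t, v, _ => s.val v = t.val v
  | _, _, .lt s t, v, _ => s.val v < t.val v
  | _, _, .mem t j, v, V => V j (t.val v) = true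
  | _, _, .neg φ, v, V => ¬ φ.Holds v V
  | _, _, .and φ ψ, v, V => φ.Holds v V ∧ ψ.Holds v V
  | _, _, .or φ ψ, v, V => φ.Holds v V ∨ ψ.Holds v V
  | _, _, .imp φ ψ, v, V => φ.Holds v V → ψ.Holds v V
  | _, _, .ex φ, v, V => ∃ n : ℕ, φ.Holds (Fin.cons n v) V
  | _, _, .all φ, v, V => ∀ n : ℕ, φ.Holds (Fin.cons n v) V
  | _, _, .exSet φ, v, V => ∃ Y : ℕ → Bool, φ.Holds v (Fin.cons Y V)
  | _, _, .allSet φ, v, V => ∀ Y : ℕ → Bool, φ.Holds v (Fin.cons Y V)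

/-- Arithmetical formulas: no set quantifiers (free set variables are allowed). -/
def Arithmetical : {k m : ℕ} → SOFormula k m → Prop
  | _, _, .eq _ _ => True
  | _, _, .lt _ _ => True
  | _, _, .mem _ _ => True
  | _, _, .neg φ => φ.Arithmetical
  | _, _, .and φ ψ => φ.Arithmetical ∧ ψ.Arithmetical
  | _, _, .or φ ψ => φ.Arithmetical ∧ ψ.Arithmetical
  | _, _, .imp φ ψ => φ.Arithmetical ∧ ψ.Arithmetical
  | _, _, .ex φ => φ.Arithmetical
  | _, _, .all φ => φ.Arithmetical
  | _, _, .exSet _ => False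
  | _, _, .allSet _ => False

mutual
/-- `IsPi n φ`: the formula `φ` is given as a `Π¹ₙ` formula, that is, at most `n` alternating blocks
of set quantifiers, the first one universal if there are `n` of them, followed by an arithmetical
formula. -/
inductive IsPi : {k m : ℕ} → ℕ → SOFormula k m → Prop
  | arith {k m n : ℕ} {φ : SOFormula k m} : φ.Arithmetical → IsPi n φ
  | ofSigma {k m n : ℕ} {φ : SOFormula k m} : IsSigma n φ → IsPi (n + 1) φ
  | allSet {k m n : ℕ} {φ : SOFormula k (m + 1)} : IsPi (n + 1) φ → IsPi (n + 1) (.allSet φ)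
/-- `IsSigma n φ`: the formula `φ` is given as a `Σ¹ₙ` formula. -/
inductive IsSigma : {k m : ℕ} → ℕ → SOFormula k m → Prop
  | arith {k m n : ℕ} {φ : SOFormula k m} : φ.Arithmetical → IsSigma n φ
  | ofPi {k m n : ℕ} {φ : SOFormula k m} : IsPi n φ → IsSigma (n + 1) φ
  | exSet {k m n : ℕ} {φ : SOFormula k (m + 1)} : IsSigma (n + 1) φ → IsSigma (n + 1) (.exSet φ)
end

end SOFormula

/-! ### Recursive sequences and recursive functionals -/

/-- The initial segment of length `t` of an infinite binary sequence. -/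
def initSeg (X : ℕ → Bool) (t : ℕ) : List Bool := (List.range t).map X

/-- `e` is a (standard) code of the recursive binary sequence `X`. -/
def IsCodeOf (e : ℕ) (X : ℕ → Bool) : Prop :=
  ∀ n, (Denumerable.ofNat Nat.Partrec.Code e).eval n = Part.some (X n).toNat

/-- `f`, taking a number and an infinite binary sequence to an infinite binary sequence, is a total
recursive functional: a digit of the output is computed from the digit's position, the number and a
sufficiently long initial segment of the input sequence (`none` means: the segment is too short). -/
def IsRecursiveFunctional (f : ℕ → (ℕ → Bool) → ℕ → Bool) : Prop :=
  ∃ g : ℕ × ℕ × List Bool → Option Bool, Computable g ∧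
    ∀ (c : ℕ) (X : ℕ → Bool) (i : ℕ),
      (∃ t, g (c, i, initSeg X t) = some (f c X i)) ∧
      ∀ t b, g (c, i, initSeg X t) = some b → b = f c X i

/-! ### Witnesses -/

/-- An item of input: a number, or a finite initial segment of a candidate witness. -/
abbrev WInput : Type := ℕ ⊕ List Bool

/-- An input-output pair: a list of input items and a list of numbers as output, both in the order
of decreasing scope. -/
abbrev IOPair : Type := List WInput × List ℕ

/-- The set of input-output pairs listed by an infinite binary sequence: a pair with code `c` is
listed as a maximal block of `c + 1` consecutive digits `1` that is followed by a digit `0`. All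
other digits are whitespace. -/
def pairsOf (W : ℕ → Bool) : Set IOPair :=
  {p | ∃ a, (a = 0 ∨ W (a - 1) = false) ∧
    (∀ j ≤ Encodable.encode p, W (a + j) = true) ∧ W (a + (Encodable.encode p + 1)) = false}

/-- The pairs of `P` whose input starts with the number `n`, with `n` removed. -/
def afterNum (P : Set IOPair) (n : ℕ) : Set IOPair := {p | (.inl n :: p.1, p.2) ∈ P}

/-- The pairs of `P` whose input starts with an initial segment of `X`, with it removed. -/
def afterSeq (P : Set IOPair) (X : ℕ → Bool) : Set IOPair :=
  {p | ∃ t, (.inr (initSeg X t) :: p.1, p.2) ∈ P}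

/-- The pairs of `P` whose output starts with the number `n`, with `n` removed. -/
def afterOut (P : Set IOPair) (n : ℕ) : Set IOPair := {p | (p.1, n :: p.2) ∈ P}

namespace BoxFormula

/-- The pair (input, output) has the right syntactic form for a formula. Conjunction and disjunction
are treated like quantifiers over `{0, 1}`. Input or output may be incomplete, but there is never
output in the scope of a quantifier, conjunction or implication for which the input is missing. -/
def Shape : {k : ℕ} → BoxFormula k → List WInput → List ℕ → Prop
  | _, .eq _ _, i, o => i = [] ∧ o = []
  | _, .lt _ _, i, o => i = [] ∧ o = []
  | _, .neg _, i, o => i = [] ∧ o = []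
  | _, .and A B, i, o =>
      match i with
      | [] => o = []
      | .inl 0 :: i' => A.Shape i' o
      | .inl 1 :: i' => B.Shape i' o
      | _ => False
  | _, .or A B, i, o =>
      match o with
      | [] => A.Shape i [] ∨ B.Shape i []
      | 0 :: o' => A.Shape i o'
      | 1 :: o' => B.Shape i o'
      | _ => False
  | _, .imp _ B, i, o =>
      match i with
      | [] => o = []
      | .inr _ :: i' => B.Shape i' o
      | _ => False
  | _, .ex A, i, o =>
      match o with
      | [] => A.Shape i []
      | _ :: o' => A.Shape i o'
  | _, .all A, i, o =>
      match i with
      | [] => o = []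
      | .inl _ :: i' => A.Shape i' o
      | _ => False
  | _, .box _, i, o => i = [] ∧ o.length ≤ 1

/-- Two pairs do not contradict each other: as long as their inputs agree, where two initial
segments count as agreeing if one of them extends the other, they give the same output. Output does
not depend on input that occurs later in the order of scopes. -/
def Compatible : {k : ℕ} → BoxFormula k → List WInput → List ℕ → List WInput → List ℕ → Prop
  | _, .eq _ _, _, _, _, _ => True
  | _, .lt _ _, _, _, _, _ => True
  | _, .neg _, _, _, _, _ => True
  | _, .and A B, i₁, o₁, i₂, o₂ =>
      match i₁, i₂ with
      | .inl 0 :: j₁, .inl 0 :: j₂ => A.Compatible j₁ o₁ j₂ o₂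
      | .inl 1 :: j₁, .inl 1 :: j₂ => B.Compatible j₁ o₁ j₂ o₂
      | _, _ => True
  | _, .or A B, i₁, o₁, i₂, o₂ =>
      match o₁, o₂ with
      | n₁ :: r₁, n₂ :: r₂ => n₁ = n₂ ∧ (n₁ = 0 → A.Compatible i₁ r₁ i₂ r₂) ∧
          (n₁ = 1 → B.Compatible i₁ r₁ i₂ r₂)
      | _, _ => True
  | _, .imp _ B, i₁, o₁, i₂, o₂ =>
      match i₁, i₂ with
      | .inr s₁ :: j₁, .inr s₂ :: j₂ => s₁ <+: s₂ ∨ s₂ <+: s₁ → B.Compatible j₁ o₁ j₂ o₂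
      | _, _ => True
  | _, .ex A, i₁, o₁, i₂, o₂ =>
      match o₁, o₂ with
      | n₁ :: r₁, n₂ :: r₂ => n₁ = n₂ ∧ A.Compatible i₁ r₁ i₂ r₂
      | _, _ => True
  | _, .all A, i₁, o₁, i₂, o₂ =>
      match i₁, i₂ with
      | .inl n₁ :: j₁, .inl n₂ :: j₂ => n₁ = n₂ → A.Compatible j₁ o₁ j₂ o₂
      | _, _ => True
  | _, .box _, _, o₁, _, o₂ =>
      match o₁, o₂ with
      | n₁ :: _, n₂ :: _ => n₁ = n₂
      | _, _ => True

/-- The syntactic requirements on a witness: every pair has the right form, and no two pairs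
contradict each other (also on false candidate witnesses for antecedents). -/
def WellFormed {k : ℕ} (A : BoxFormula k) (P : Set IOPair) : Prop :=
  (∀ p ∈ P, A.Shape p.1 p.2) ∧ ∀ p ∈ P, ∀ q ∈ P, A.Compatible p.1 p.2 q.1 q.2

mutual
/-- Classical truth in the standard model; `□A` is true if `A` has a recursive witness. -/
def Holds : {k : ℕ} → BoxFormula k → (Fin k → ℕ) → Prop
  | _, .eq s t, v => s.val v = t.val v
  | _, .lt s t, v => s.val v < t.val v
  | _, .neg A, v => ¬ A.Holds v
  | _, .and A B, v => A.Holds v ∧ B.Holds v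
  | _, .or A B, v => A.Holds v ∨ B.Holds v
  | _, .imp A B, v => A.Holds v → B.Holds v
  | _, .ex A, v => ∃ n : ℕ, A.Holds (Fin.cons n v)
  | _, .all A, v => ∀ n : ℕ, A.Holds (Fin.cons n v)
  | _, .box A, v =>
      ∃ e X, IsCodeOf e X ∧ A.WellFormed (pairsOf X) ∧ A.Meets v (pairsOf X)
/-- The semantic requirements on (the set of pairs of) a witness for a formula. For the components,
the syntactic requirements are inherited from those for the whole formula. -/
def Meets : {k : ℕ} → BoxFormula k → (Fin k → ℕ) → Set IOPair → Prop
  | _, .eq s t, v, _ => s.val v = t.val v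
  | _, .lt s t, v, _ => s.val v < t.val v
  | _, .neg A, v, _ => ¬ A.Holds v
  | _, .and A B, v, P => A.Meets v (afterNum P 0) ∧ B.Meets v (afterNum P 1)
  | _, .or A B, v, P =>
      ((afterOut P 0).Nonempty ∧ A.Meets v (afterOut P 0)) ∨
      ((afterOut P 1).Nonempty ∧ B.Meets v (afterOut P 1))
  | _, .imp A B, v, P =>
      ∀ X : ℕ → Bool, A.WellFormed (pairsOf X) → A.Meets v (pairsOf X) → B.Meets v (afterSeq P X)
  | _, .ex A, v, P =>
      ∃ n : ℕ, (afterOut P n).Nonempty ∧ A.Meets (Fin.cons n v) (afterOut P n)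
  | _, .all A, v, P => ∀ n : ℕ, A.Meets (Fin.cons n v) (afterNum P n)
  | _, .box A, v, P =>
      ∃ e, (afterOut P e).Nonempty ∧
        ∃ X, IsCodeOf e X ∧ A.WellFormed (pairsOf X) ∧ A.Meets v (pairsOf X)
end

/-- The infinite binary sequence `W` is a witness for the formula `A` under the assignment `v`. -/
def IsWitness {k : ℕ} (W : ℕ → Bool) (A : BoxFormula k) (v : Fin k → ℕ) : Prop :=
  A.WellFormed (pairsOf W) ∧ A.Meets v (pairsOf W)

/-- The sentence `0 = 0`. -/
def zeroEqZero {k : ℕ} : BoxFormula k := .eq .zero .zero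

/-- The iterated implications: `∀ x ∃ y 0 = 0` at `0`, and `A_n → (0 = 0 ∨ 0 = 0)` at `n + 1`. -/
def iterImp : ℕ → BoxFormula 0
  | 0 => .all (.ex zeroEqZero)
  | n + 1 => .imp (iterImp n) (.or zeroEqZero zeroEqZero)

end BoxFormula

-- The first assertion is a translation by recursion on the formula. Sets of pairs are represented
-- by sets of codes. Truth and the semantic requirements are translated together, since the truth of
-- a boxed formula refers to witnesses and the requirement for a negation refers to truth
-- (`holds_truthFormulas`). Each clause is a fixed template filled with the translations of the
-- components. So the map on Gödel numbers is primitive recursive, even though the templates are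
-- obtained by mere existence (`codeTranslations_code`, `primrec_codeTranslations`).
--
-- For the second assertion, a prenex formula is first brought to the form `∀ Y, ¬ ∀ Y', ¬ …` over a
-- `Π⁰₂` property of the join of all the sets (`Tower`). Adjacent quantifiers of the same kind merge
-- by pairing, and each change of kind costs one level. The matrix is arithmetical of unbounded
-- complexity; it is absorbed by letting the innermost set also carry a guess of the truth set for
-- arithmetical formulas. Correctness of the guess is `Π⁰₂`, uniformly in the code
-- (`Reading.exists_check_iff`). The number of levels is one more than the number of switches in the
-- prefix, which is the required `n` (`Reading.Fits.holds_iff`,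
-- `SOFormula.prenex_and_eq_of_isLeast`).
--
-- Towers are then matched with the formulas `A_n` (`isWitness_weave_listed`). To each `X` and `n`
-- belongs a candidate that lists pairs and spells out `X` in its whitespace. At level `0` it lists,
-- for each `x`, the least `y` with `R X x y`, so it is a witness iff `∀ x, ∃ y, R X x y`. At level
-- `n + 1` it answers a string as soon as the string is seen not to begin the level `n` candidate of
-- any `join X Y`. Since the parameter can be read off the whitespace and the candidate is
-- determined by it digit by digit, every other sequence is refuted by a finite segment
-- (`exists_refuted_iff`). Hence exactly the level `n` candidates of the sequences `join X Y`
-- receive no answer, and the implication is witnessed iff none of them is a witness for `A_n`. All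
-- answers are `0`, so they never contradict each other, even on false candidates.

/-! ### Automation for primitive recursive functions -/

namespace Primrec

variable {α β γ σ : Type*} [Primcodable α] [Primcodable β] [Primcodable γ] [Primcodable σ]

attribute [fun_prop] Primrec
attribute [fun_prop] Primrec.const
attribute [fun_prop] Primrec.comp
attribute [fun_prop] Primrec.pair

@[fun_prop] theorem id_fun : Primrec fun a : α => a := Primrec.id

@[fun_prop] theorem fst_fun {f : α → β × γ} (hf : Primrec f) : Primrec fun a => (f a).1 :=
  Primrec.fst.comp hf

@[fun_prop] theorem snd_fun {f : α → β × γ} (hf : Primrec f) : Primrec fun a => (f a).2 :=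
  Primrec.snd.comp hf

@[fun_prop] theorem add_fun {f g : α → ℕ} (hf : Primrec f) (hg : Primrec g) :
    Primrec fun a => f a + g a := Primrec.nat_add.comp hf hg

@[fun_prop] theorem sub_fun {f g : α → ℕ} (hf : Primrec f) (hg : Primrec g) :
    Primrec fun a => f a - g a := Primrec.nat_sub.comp hf hg

@[fun_prop] theorem mul_fun {f g : α → ℕ} (hf : Primrec f) (hg : Primrec g) :
    Primrec fun a => f a * g a := Primrec.nat_mul.comp hf hg

@[fun_prop] theorem div_fun {f g : α → ℕ} (hf : Primrec f) (hg : Primrec g) :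
    Primrec fun a => f a / g a := Primrec.nat_div.comp hf hg

@[fun_prop] theorem sqrt_fun {f : α → ℕ} (hf : Primrec f) :
    Primrec fun a => Nat.sqrt (f a) := Primrec.nat_sqrt.comp hf

@[fun_prop] theorem natPair_fun {f g : α → ℕ} (hf : Primrec f) (hg : Primrec g) :
    Primrec fun a => Nat.pair (f a) (g a) := Primrec₂.natPair.comp hf hg

@[fun_prop] theorem unpair_fun {f : α → ℕ} (hf : Primrec f) :
    Primrec fun a => Nat.unpair (f a) := Primrec.unpair.comp hf

@[fun_prop] theorem cons_fun {f : α → β} {g : α → List β} (hf : Primrec f) (hg : Primrec g) :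
    Primrec fun a => f a :: g a := Primrec.list_cons.comp hf hg

@[fun_prop] theorem getD_fun {f : α → List β} {g : α → ℕ} {d : β} (hf : Primrec f)
    (hg : Primrec g) : Primrec fun a => (f a).getD (g a) d := (Primrec.list_getD d).comp hf hg

@[fun_prop] theorem length_fun {f : α → List β} (hf : Primrec f) :
    Primrec fun a => (f a).length := Primrec.list_length.comp hf

@[fun_prop] theorem range_fun {f : α → ℕ} (hf : Primrec f) :
    Primrec fun a => List.range (f a) := Primrec.list_range.comp hf

@[fun_prop] theorem map_fun {f : α → List β} {g : α → β → γ} (hf : Primrec f)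
    (hg : Primrec fun p : α × β => g p.1 p.2) : Primrec fun a => (f a).map (g a) :=
  Primrec.list_map hf hg.to₂

@[fun_prop] theorem encode_fun {f : α → β} (hf : Primrec f) :
    Primrec fun a => Encodable.encode (f a) := Primrec.encode.comp hf

@[fun_prop] theorem decode_getD_fun {f : α → ℕ} {d : β} (hf : Primrec f) :
    Primrec fun a => ((Encodable.decode (f a) : Option β)).getD d :=
  Primrec.option_getD.comp (Primrec.decode.comp hf) (Primrec.const d)

@[fun_prop] theorem inl_fun {f : α → β} (hf : Primrec f) :
    Primrec fun a => (Sum.inl (f a) : β ⊕ γ) := Primrec.sumInl.comp hf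

@[fun_prop] theorem inr_fun {f : α → γ} (hf : Primrec f) :
    Primrec fun a => (Sum.inr (f a) : β ⊕ γ) := Primrec.sumInr.comp hf

@[fun_prop] theorem beq_fun [DecidableEq β] {f g : α → β} (hf : Primrec f) (hg : Primrec g) :
    Primrec fun a => f a == g a := Primrec.beq.comp hf hg

@[fun_prop] theorem not_fun {f : α → Bool} (hf : Primrec f) :
    Primrec fun a => !f a := Primrec.not.comp hf

@[fun_prop] theorem and_fun {f g : α → Bool} (hf : Primrec f) (hg : Primrec g) :
    Primrec fun a => f a && g a := Primrec.and.comp hf hg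

@[fun_prop] theorem or_fun {f g : α → Bool} (hf : Primrec f) (hg : Primrec g) :
    Primrec fun a => f a || g a := Primrec.or.comp hf hg

@[fun_prop] theorem bne_fun [DecidableEq β] {f g : α → β} (hf : Primrec f) (hg : Primrec g) :
    Primrec fun a => f a != g a := Primrec.not.comp (Primrec.beq.comp hf hg)

@[fun_prop] theorem decide_lt_fun {f g : α → ℕ} (hf : Primrec f) (hg : Primrec g) :
    Primrec fun a => decide (f a < g a) := (Primrec.nat_lt.comp hf hg).decide

@[fun_prop] theorem decide_le_fun {f g : α → ℕ} (hf : Primrec f) (hg : Primrec g) :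
    Primrec fun a => decide (f a ≤ g a) := (Primrec.nat_le.comp hf hg).decide

@[fun_prop] theorem bif_fun {c : α → Bool} {f g : α → β} (hc : Primrec c) (hf : Primrec f)
    (hg : Primrec g) : Primrec fun a => bif c a then f a else g a := Primrec.cond hc hf hg

@[fun_prop] theorem ite_eq_fun [DecidableEq γ] {c d : α → γ} {f g : α → β} (hc : Primrec c)
    (hd : Primrec d) (hf : Primrec f) (hg : Primrec g) :
    Primrec fun a => if c a = d a then f a else g a := Primrec.ite (Primrec.eq.comp hc hd) hf hg

@[fun_prop] theorem any_fun {f : α → List β} {g : α → β → Bool} (hf : Primrec f)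
    (hg : Primrec fun p : α × β => g p.1 p.2) : Primrec fun a => (f a).any (g a) := by
  have h : Primrec fun a => (f a).foldr (fun b s => g a b || s) false :=
    Primrec.list_foldr hf (Primrec.const false) (by
      have : Primrec fun p : α × β × Bool => g p.1 p.2.1 || p.2.2 :=
        Primrec.or_fun (hg.comp (f := fun p : α × β => g p.1 p.2)
          (g := fun p : α × β × Bool => (p.1, p.2.1)) (by fun_prop)) (by fun_prop)
      exact this.to₂)
  refine h.of_eq fun a => ?_
  induction f a <;> simp_all

@[fun_prop] theorem all_fun {f : α → List β} {g : α → β → Bool} (hf : Primrec f)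
    (hg : Primrec fun p : α × β => g p.1 p.2) : Primrec fun a => (f a).all (g a) := by
  have h : Primrec fun a => !(f a).any fun b => !(g a b) := by fun_prop
  refine h.of_eq fun a => ?_
  induction f a <;> simp_all

end Primrec

-- Completeness: reduction of second order truth to witnesses.

/-! ### Infinite binary sequences that list pairs and can be decoded -/

/-- The infinite binary sequence that extends a finite one by `false`. -/
def pad (l : List Bool) (i : ℕ) : Bool := l.getD i false

theorem pad_initSeg {X : ℕ → Bool} {t i : ℕ} (h : i < t) : pad (initSeg X t) i = X i := by
  simp [pad, initSeg, h]

theorem length_initSeg (X : ℕ → Bool) (t : ℕ) : (initSeg X t).length = t := by simp [initSeg]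

/-- The sequence that lists the pairs with codes in `d`, and whose whitespace encodes `X`. The
positions from `t * t` to `t * t + 2 * t` hold the digit `X (t - 1)` and, if `d (t - 3)`, a block
of `t - 2` digits `1`. -/
def weave (X d : ℕ → Bool) (i : ℕ) : Bool :=
  bif i - Nat.sqrt i * Nat.sqrt i == 0 then decide (0 < Nat.sqrt i) && X (Nat.sqrt i - 1)
  else decide (2 ≤ i - Nat.sqrt i * Nat.sqrt i) &&
    (decide (i - Nat.sqrt i * Nat.sqrt i < Nat.sqrt i) && d (Nat.sqrt i - 3))

/-- The sequence encoded in the whitespace. -/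
def unweave (U : ℕ → Bool) (j : ℕ) : Bool := U ((j + 1) * (j + 1))

/-- The cells of the layout lie between consecutive squares. Offset `1` separates the encoded digit
from the run of ones at offsets `2, …, t - 1`, and the zeros from offset `t` on keep this run from
reaching the next cell. -/
theorem weave_apply (X d : ℕ → Bool) {t r : ℕ} (h : r ≤ 2 * t) :
    weave X d (t * t + r) =
      bif r == 0 then decide (0 < t) && X (t - 1)
      else decide (2 ≤ r) && (decide (r < t) && d (t - 3)) := by
  have h1 : Nat.sqrt (t * t + r) = t := Nat.sqrt_add_eq t (by omega)
  simp [weave, h1]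

theorem exists_eq_sq_add (i : ℕ) : ∃ t r, r ≤ 2 * t ∧ i = t * t + r := by
  refine ⟨Nat.sqrt i, i - Nat.sqrt i * Nat.sqrt i, ?_, ?_⟩
  · have := Nat.sqrt_le_add i; omega
  · have := Nat.sqrt_le i; omega

theorem unweave_weave (X d : ℕ → Bool) : unweave (weave X d) = X := by
  funext j
  have := weave_apply X d (t := j + 1) (r := 0) (by omega)
  simpa [unweave] using this

/-- The dependence is on digits below the square root of the position, not merely below the
position. Digit `j` of `X` is encoded at `(j + 1) * (j + 1)`, so everything a position depends on in
`X` has been spelled out by then. -/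
theorem weave_congr {X X' d d' : ℕ → Bool} {i : ℕ} (hX : ∀ j < Nat.sqrt i, X j = X' j)
    (hd : ∀ j < Nat.sqrt i, d j = d' j) : weave X d i = weave X' d' i := by
  unfold weave
  by_cases h0 : 0 < Nat.sqrt i
  · rw [hX _ (by omega)]
    by_cases h3 : 3 ≤ Nat.sqrt i
    · rw [hd _ (by omega)]
    · have : ¬ (2 ≤ i - Nat.sqrt i * Nat.sqrt i ∧ i - Nat.sqrt i * Nat.sqrt i < Nat.sqrt i) := by
        omega
      by_cases h2 : 2 ≤ i - Nat.sqrt i * Nat.sqrt i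
      · have h4 : ¬ (i - Nat.sqrt i * Nat.sqrt i < Nat.sqrt i) := by omega
        simp [h4]
      · simp [h2]
  · have : ¬ (i - Nat.sqrt i * Nat.sqrt i < Nat.sqrt i) := by omega
    simp [h0, this]

theorem mem_pairsOf_weave {X d : ℕ → Bool} {p : IOPair} (h : d (Encodable.encode p) = true) :
    p ∈ pairsOf (weave X d) := by
  set c := Encodable.encode p with hc
  refine ⟨(c + 3) * (c + 3) + 2, Or.inr ?_, fun j hj => ?_, ?_⟩
  · have := weave_apply X d (t := c + 3) (r := 1) (by omega)
    simpa using this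
  · rw [add_assoc, weave_apply X d (by omega)]
    simp [h]; omega
  · rw [add_assoc, weave_apply X d (by omega)]
    simp; omega

/-- A digit `1` that encodes part of `X` is isolated, so the only pair that the whitespace can list
by accident is the one with code `0`. That is the empty pair, which is harmless for the formulas
`A_n`. -/
theorem of_mem_pairsOf_weave {X d : ℕ → Bool} {p : IOPair} (h : p ∈ pairsOf (weave X d)) :
    d (Encodable.encode p) = true ∨ p = ([], []) := by
  obtain ⟨a, ha, h1, h2⟩ := h
  have hp : Encodable.encode p = 0 → p = ([], []) := fun h0 => by
    apply Encodable.encode_injective; rw [h0]; rfl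
  set c := Encodable.encode p
  obtain ⟨t, r, hr, rfl⟩ := exists_eq_sq_add a
  have h10 := h1 0 (Nat.zero_le _)
  rw [add_zero, weave_apply X d hr] at h10
  rcases Nat.eq_zero_or_pos r with rfl | hr0
  · right
    apply hp
    by_contra hc
    -- A longer run starting at offset `0` would have to cover offset `1`, which is always zero.
    have h11 := h1 1 (by omega)
    have ht : 0 < t := by
      simp at h10; exact h10.1
    rw [add_zero, weave_apply X d (by omega)] at h11
    simp at h11
  · left
    have hr0' : (r == 0) = false := by simp; omega
    simp only [hr0', cond_false, Bool.and_eq_true, decide_eq_true_eq] at h10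
    obtain ⟨h2r, hrt, hd⟩ := h10
    -- A start beyond offset `2` would be preceded by a `1` of the same run.
    have hr2 : r = 2 := by
      by_contra hne
      rcases ha with ha | ha
      · omega
      · have : t * t + r - 1 = t * t + (r - 1) := by omega
        rw [this, weave_apply X d (by omega)] at ha
        have h4 : (r - 1 == 0) = false := by simp; omega
        have h5 : 2 ≤ r - 1 := by omega
        have h6 : r - 1 < t := by omega
        simp [h4, h5, h6, hd] at ha
    subst hr2
    -- The run ends exactly at offset `t - 1`; comparing from both sides gives `c = t - 3`.
    have hlt : c < t - 2 := by
      by_contra hge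
      have := h1 (t - 2) (by omega)
      rw [add_assoc, weave_apply X d (by omega)] at this
      have h7 : 2 + (t - 2) = t := by omega
      simp [h7] at this
      omega
    have hge : t ≤ c + 3 := by
      by_contra hgt
      rw [add_assoc, weave_apply X d (by omega)] at h2
      have h8 : 2 + (c + 1) < t := by omega
      have h9 : (2 + (c + 1) == 0) = false := by simp
      simp [h8, hd, h9] at h2
    have : t - 3 = c := by omega
    rwa [← this]

/-- The sequence with `X` at the even and `Y` at the odd places. -/
def join (X Y : ℕ → Bool) (i : ℕ) : Bool := bif i % 2 == 0 then X (i / 2) else Y (i / 2)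

theorem join_even (X Y : ℕ → Bool) (i : ℕ) : join X Y (2 * i) = X i := by simp [join]

theorem join_odd (X Y : ℕ → Bool) (i : ℕ) : join X Y (2 * i + 1) = Y i := by
  have h1 : (2 * i + 1) % 2 = 1 := by omega
  have h2 : (2 * i + 1) / 2 = i := by omega
  simp [join, h1, h2]

theorem eq_join {Z X Y : ℕ → Bool} (h0 : ∀ i, Z (2 * i) = X i) (h1 : ∀ i, Z (2 * i + 1) = Y i) :
    Z = join X Y := by
  funext i
  rcases Nat.even_or_odd' i with ⟨j, rfl | rfl⟩
  · rw [join_even, h0]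
  · rw [join_odd, h1]

/-! ### The witnesses -/

/-- The number `x` if `c` is the code of the pair `([x], [y])` of numbers. -/
def argOf (c : ℕ) : ℕ := ((c.unpair.1 - 1).unpair.1) / 2

/-- The number `y` if `c` is the code of the pair `([x], [y])` of numbers. -/
def valueOf (c : ℕ) : ℕ := (c.unpair.2 - 1).unpair.1

/-- The string `s` if `c` is the code of the pair `([s], [y])`. -/
def strOf (c : ℕ) : List Bool :=
  ((Encodable.decode (((c.unpair.1 - 1).unpair.1 - 1) / 2) : Option (List Bool))).getD []

/-- The predecessor undoes the successor in the code of a nonempty list, and halving undoes the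
coding of the left summand by even numbers. -/
theorem argOf_encode (x y : ℕ) : argOf (Encodable.encode (([.inl x], [y]) : IOPair)) = x := by
  simp [argOf]

theorem valueOf_encode (i : List WInput) (y : ℕ) :
    valueOf (Encodable.encode ((i, [y]) : IOPair)) = y := by
  simp [valueOf]

theorem strOf_encode (s : List Bool) (o : List ℕ) :
    strOf (Encodable.encode (([.inr s], o) : IOPair)) = s := by
  simp [strOf]

/-- This bound and the next one are what makes the lists of pairs local: the code of a pair
dominates everything that has to be inspected to decide whether it is listed. -/
theorem value_le_encode (i : List WInput) (y : ℕ) :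
    y ≤ Encodable.encode ((i, [y]) : IOPair) := by
  have h1 := Nat.left_le_pair y 0
  have h2 := Nat.right_le_pair (Encodable.encode i) (Nat.succ (Nat.pair y 0))
  simp only [Encodable.encode_prod_val, Encodable.encode_list_cons, Encodable.encode_nat,
    Encodable.encode_list_nil]
  omega

theorem length_le_encode_pair (s : List Bool) (o : List ℕ) :
    s.length ≤ Encodable.encode (([.inr s], o) : IOPair) := by
  have h1 := Nat.left_le_pair (2 * Encodable.encode s + 1) 0
  have h2 := Nat.left_le_pair (Nat.succ (Nat.pair (2 * Encodable.encode s + 1) 0))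
    (Encodable.encode o)
  have h3 := Encodable.length_le_encode s
  simp only [Encodable.encode_prod_val, Encodable.encode_list_cons, Encodable.encode_inr,
    Encodable.encode_list_nil]
  omega

/-- The initial segment `s` is seen not to be one of a sequence that weaves together some
`join X Y` and the pairs listed by `D (join X Y)`. -/
def refuted (D : (ℕ → Bool) → ℕ → Bool) (X : ℕ → Bool) (s : List Bool) : Bool :=
  (List.range s.length).any fun i =>
    (pad s i != weave (unweave (pad s)) (D (unweave (pad s))) i) ||
      (decide ((2 * i + 1) * (2 * i + 1) < s.length) && (unweave (pad s) (2 * i) != X i))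

/-- The codes of the pairs listed by the candidate witness for `A_n` that belongs to `X`. -/
def listed (R : (ℕ → Bool) → ℕ → ℕ → Bool) : ℕ → (ℕ → Bool) → ℕ → Bool
  | 0, X, c => (Encodable.encode (([.inl (argOf c)], [valueOf c]) : IOPair) == c) &&
      (R X (argOf c) (valueOf c) && (List.range (valueOf c)).all fun y => !R X (argOf c) y)
  | n + 1, X, c => (Encodable.encode (([.inr (strOf c)], [0]) : IOPair) == c) &&
      refuted (listed R n) X (strOf c)

/-- The value `D X c` depends on the digits of `X` before position `c` only. -/
def IsLocal (D : (ℕ → Bool) → ℕ → Bool) : Prop :=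
  ∀ X X' c, (∀ j < c, X j = X' j) → D X c = D X' c

theorem IsLocal.weave {D : (ℕ → Bool) → ℕ → Bool} (hD : IsLocal D) {X X' : ℕ → Bool} {i : ℕ}
    (h : ∀ j < Nat.sqrt i, X j = X' j) : weave X (D X) i = weave X' (D X') i :=
  weave_congr h fun j hj => hD _ _ _ fun k hk => h k (by omega)

/-- The parameter `X` is consulted only at indices below the length of the string; everything else
is decoded from the string itself. -/
theorem refuted_congr {D : (ℕ → Bool) → ℕ → Bool} {X X' : ℕ → Bool} {s : List Bool}
    (h : ∀ j < s.length, X j = X' j) : refuted D X s = refuted D X' s := by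
  unfold refuted
  rw [Bool.eq_iff_iff]
  simp only [List.any_eq_true, List.mem_range]
  refine exists_congr fun i => and_congr_right fun hi => ?_
  rw [h i hi]

theorem isLocal_listed {R : (ℕ → Bool) → ℕ → ℕ → Bool} (hR : ∀ x, IsLocal fun X y => R X x y)
    (n : ℕ) : IsLocal (listed R n) := by
  cases n with
  | zero =>
    intro X X' c h
    simp only [listed]
    by_cases hc : Encodable.encode (([.inl (argOf c)], [valueOf c]) : IOPair) = c
    · have hle : valueOf c ≤ c := by
        conv_rhs => rw [← hc]
        exact value_le_encode _ _
      have h1 : ∀ y ≤ valueOf c, R X (argOf c) y = R X' (argOf c) y := fun y hy =>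
        hR (argOf c) X X' y fun j hj => h j (by omega)
      rw [h1 _ le_rfl]
      congr 2
      rw [Bool.eq_iff_iff]
      simp only [List.all_eq_true, List.mem_range]
      refine forall_congr' fun y => forall_congr' fun hy => ?_
      rw [h1 y hy.le]
    · rw [beq_false_of_ne hc, Bool.false_and, Bool.false_and]
  | succ n =>
    intro X X' c h
    simp only [listed]
    by_cases hc : Encodable.encode (([.inr (strOf c)], [0]) : IOPair) = c
    · have hle : (strOf c).length ≤ c := by
        conv_rhs => rw [← hc]
        exact length_le_encode_pair _ _
      rw [refuted_congr fun j hj => h j (by omega)]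
    · rw [beq_false_of_ne hc, Bool.false_and, Bool.false_and]

/-- The sequence encoded in the whitespace of `U` is the only possible value of `join X Y`. So `U`
fails to be a candidate iff it differs somewhere from the weaving of its own whitespace, or an even
encoded digit differs from `X`. Locality makes either discrepancy visible on a finite segment. -/
theorem exists_refuted_iff {D : (ℕ → Bool) → ℕ → Bool} (hD : IsLocal D) (X U : ℕ → Bool) :
    (∃ l, refuted D X (initSeg U l) = true) ↔
      ∀ Y, U ≠ weave (join X Y) (D (join X Y)) := by
  -- Padding by zeros does no harm: position `i` involves only encoded digits `j` with `(j + 1) * (j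
  -- + 1) ≤ i`, and these lie inside the segment.
  have key : ∀ l i, i < l → weave (unweave (pad (initSeg U l))) (D (unweave (pad (initSeg U l)))) i
      = weave (unweave U) (D (unweave U)) i := fun l i hi => by
    refine hD.weave fun j hj => pad_initSeg ?_
    have h1 := Nat.sqrt_le i
    have h2 : (j + 1) * (j + 1) ≤ Nat.sqrt i * Nat.sqrt i := Nat.mul_le_mul hj hj
    omega
  constructor
  · rintro ⟨l, hl⟩ Y rfl
    set U := weave (join X Y) (D (join X Y))
    have hU : unweave U = join X Y := unweave_weave _ _
    simp only [refuted, List.any_eq_true, List.mem_range, length_initSeg, Bool.or_eq_true,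
      bne_iff_ne, Bool.and_eq_true, decide_eq_true_eq] at hl
    obtain ⟨i, hi, h | ⟨hi', h⟩⟩ := hl
    · apply h
      rw [key l i hi, hU, pad_initSeg hi]
    · apply h
      rw [unweave, pad_initSeg (by omega)]
      change unweave U (2 * i) = _
      rw [hU, join_even]
  · intro h
    by_contra hno
    have hno' : ∀ l i, i < l → (U i = weave (unweave U) (D (unweave U)) i ∧
        ((2 * i + 1) * (2 * i + 1) < l → unweave U (2 * i) = X i)) := fun l i hi => by
      have hl : ¬ (refuted D X (initSeg U l) = true) := fun hc => hno ⟨l, hc⟩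
      simp only [refuted, List.any_eq_true, List.mem_range, length_initSeg, Bool.or_eq_true,
        bne_iff_ne, Bool.and_eq_true, decide_eq_true_eq, not_exists, not_and, not_or,
        not_not] at hl
      obtain ⟨h1, h2⟩ := hl i hi
      rw [key l i hi, pad_initSeg hi] at h1
      refine ⟨h1, fun hlt => ?_⟩
      have := h2 hlt
      rwa [unweave, pad_initSeg (by omega)] at this
    have hZ : unweave U = join X fun i => unweave U (2 * i + 1) := by
      refine eq_join (fun i => ?_) fun _ => rfl
      -- The length exceeds both `i` and the position `(2 * i + 1) * (2 * i + 1)` at which the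
      -- encoded digit `2 * i` sits.
      refine (hno' ((2 * i + 1) * (2 * i + 1) + i + 1) i ?_).2 ?_ <;> omega
    refine h (fun i => unweave U (2 * i + 1)) ?_
    rw [← hZ]
    funext i
    exact (hno' (i + 1) i (by omega)).1

/-- The relation that is `Q` at level `0` and `∀ Y ¬` of the previous level at each further one. -/
def Tower (Q : (ℕ → Bool) → Prop) : ℕ → (ℕ → Bool) → Prop
  | 0, X => Q X
  | n + 1, X => ∀ Y, ¬ Tower Q n (join X Y)

-- At level `0` the minimality of the listed output excludes contradictions; at later levels the
-- constant output does. At a successor, what remains is that every witness for `A_n` has a refuted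
-- initial segment, that is, that it is not the candidate of any `join X Y`.
open BoxFormula in
theorem isWitness_weave_listed {R : (ℕ → Bool) → ℕ → ℕ → Bool}
    (hR : ∀ x, IsLocal fun X y => R X x y) (n : ℕ) (X : ℕ → Bool) :
    IsWitness (weave X (listed R n X)) (iterImp n) Fin.elim0 ↔
      Tower (fun Z => ∀ x, ∃ y, R Z x y = true) n X := by
  induction n generalizing X with
  | zero =>
    have hmem : ∀ p ∈ pairsOf (weave X (listed R 0 X)), p = ([], []) ∨ ∃ x y, p = ([.inl x], [y]) ∧
        R X x y = true ∧ ∀ y' < y, R X x y' = false := by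
      intro p hp
      rcases of_mem_pairsOf_weave hp with h | h
      · right
        simp only [listed, Bool.and_eq_true, beq_iff_eq, List.all_eq_true, List.mem_range,
          Bool.not_eq_true'] at h
        exact ⟨_, _, (Encodable.encode_injective h.1).symm, h.2.1, h.2.2⟩
      · exact Or.inl h
    constructor
    · rintro ⟨-, h⟩ x
      simp only [iterImp, Meets] at h
      obtain ⟨y, ⟨p, hp⟩, -⟩ := h x
      simp only [afterOut, afterNum, Set.mem_ofPred_eq] at hp
      rcases hmem _ hp with h | ⟨x', y', h, hR, -⟩
      · simp at h
      · simp only [Prod.mk.injEq, List.cons.injEq, Sum.inl.injEq] at h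
        obtain ⟨⟨rfl, -⟩, rfl, -⟩ := h
        exact ⟨_, hR⟩
    · intro h
      refine ⟨⟨fun p hp => ?_, fun p hp q hq => ?_⟩, ?_⟩
      · rcases hmem p hp with rfl | ⟨x, y, rfl, -⟩ <;> simp [iterImp, Shape, zeroEqZero]
      · rcases hmem p hp with rfl | ⟨x, y, rfl, h1, h2⟩
        · simp [iterImp, Compatible]
        rcases hmem q hq with rfl | ⟨x', y', rfl, h1', h2'⟩
        · simp [iterImp, Compatible]
        simp only [iterImp, Compatible, zeroEqZero, and_true]
        rintro rfl
        rcases lt_trichotomy y y' with hlt | rfl | hlt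
        · rw [h2' y hlt] at h1; cases h1
        · rfl
        · rw [h2 y' hlt] at h1'; cases h1'
      · simp only [iterImp, Meets, zeroEqZero]
        intro x
        classical
        refine ⟨Nat.find (h x), ⟨([], []), ?_⟩, trivial⟩
        simp only [afterOut, afterNum, Set.mem_ofPred_eq]
        apply mem_pairsOf_weave
        simp only [listed, argOf_encode, valueOf_encode, beq_self_eq_true, Bool.true_and,
          Bool.and_eq_true, List.all_eq_true, List.mem_range, Bool.not_eq_true']
        refine ⟨Nat.find_spec (h x), fun y hy => ?_⟩
        simpa using Nat.find_min (h x) hy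
  | succ n ih =>
    have hmem : ∀ p ∈ pairsOf (weave X (listed R (n + 1) X)), p = ([], []) ∨
        ∃ s, p = ([.inr s], [0]) ∧ refuted (listed R n) X s = true := by
      intro p hp
      rcases of_mem_pairsOf_weave hp with h | h
      · right
        simp only [listed, Bool.and_eq_true, beq_iff_eq] at h
        exact ⟨_, (Encodable.encode_injective h.1).symm, h.2⟩
      · exact Or.inl h
    -- Both disjuncts are true, so only the presence of some output after an initial segment of `U`
    -- matters.
    have hmeets : ∀ U, (BoxFormula.or zeroEqZero zeroEqZero : BoxFormula 0).Meets Fin.elim0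
        (afterSeq (pairsOf (weave X (listed R (n + 1) X))) U) ↔
        ∃ l, refuted (listed R n) X (initSeg U l) = true := by
      intro U
      have hval : (zeroEqZero : BoxFormula 0) = .eq .zero .zero := rfl
      simp only [hval, Meets, and_true]
      constructor
      · intro h
        have : ∃ o p, p ∈ afterOut (afterSeq (pairsOf (weave X (listed R (n + 1) X))) U) o := by
          rcases h with ⟨p, hp⟩ | ⟨p, hp⟩
          exacts [⟨_, p, hp⟩, ⟨_, p, hp⟩]
        obtain ⟨o, p, hp⟩ := this
        obtain ⟨t, ht⟩ := hp
        rcases hmem _ ht with h | ⟨s, h, hs⟩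
        · simp at h
        · simp only [Prod.mk.injEq, List.cons.injEq, Sum.inr.injEq] at h
          exact ⟨t, by rw [h.1.1]; exact hs⟩
      · rintro ⟨l, hl⟩
        left
        refine ⟨([], []), l, ?_⟩
        apply mem_pairsOf_weave
        simp only [listed, strOf_encode, beq_self_eq_true, Bool.true_and, hl]
    have hwf : (iterImp (n + 1)).WellFormed (pairsOf (weave X (listed R (n + 1) X))) := by
      refine ⟨fun p hp => ?_, fun p hp q hq => ?_⟩
      · rcases hmem p hp with rfl | ⟨s, rfl, -⟩ <;> simp [iterImp, Shape, zeroEqZero]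
      · rcases hmem p hp with rfl | ⟨s, rfl, -⟩
        · simp [iterImp, Compatible]
        rcases hmem q hq with rfl | ⟨s', rfl, -⟩
        · simp [iterImp, Compatible]
        simp [iterImp, Compatible, zeroEqZero]
    have hM : (iterImp (n + 1)).Meets Fin.elim0 (pairsOf (weave X (listed R (n + 1) X))) ↔
        ∀ U, IsWitness U (iterImp n) Fin.elim0 →
          ∃ l, refuted (listed R n) X (initSeg U l) = true := by
      rw [iterImp, Meets]
      simp only [hmeets, IsWitness, and_imp]
    rw [IsWitness, and_iff_right hwf, hM]
    simp only [exists_refuted_iff (isLocal_listed hR n), Tower, ← ih]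
    constructor
    · intro h Y hY
      exact h _ hY Y rfl
    · rintro h U hU Y rfl
      exact h Y hU

/-! ### Computability of the witnesses -/

section
variable {α E : Type*} [Primcodable α] [Primcodable E]

@[fun_prop] theorem Primrec.pad_fun {f : α → List Bool} {g : α → ℕ} (hf : Primrec f)
    (hg : Primrec g) : Primrec fun a => pad (f a) (g a) := Primrec.getD_fun hf hg

theorem Primrec.weave_fun {X d : α → ℕ → Bool} {g : α → ℕ}
    (hX : Primrec fun p : α × ℕ => X p.1 p.2) (hd : Primrec fun p : α × ℕ => d p.1 p.2)
    (hg : Primrec g) : Primrec fun a => weave (X a) (d a) (g a) := by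
  have h1 : Primrec fun a => X a (Nat.sqrt (g a) - 1) :=
    hX.comp (g := fun a => (a, Nat.sqrt (g a) - 1)) (by fun_prop)
  have h2 : Primrec fun a => d a (Nat.sqrt (g a) - 3) :=
    hd.comp (g := fun a => (a, Nat.sqrt (g a) - 3)) (by fun_prop)
  unfold weave
  fun_prop

@[fun_prop] theorem Primrec.argOf_fun {f : α → ℕ} (hf : Primrec f) :
    Primrec fun a => argOf (f a) := by unfold argOf; fun_prop

@[fun_prop] theorem Primrec.valueOf_fun {f : α → ℕ} (hf : Primrec f) :
    Primrec fun a => valueOf (f a) := by unfold valueOf; fun_prop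

@[fun_prop] theorem Primrec.strOf_fun {f : α → ℕ} (hf : Primrec f) :
    Primrec fun a => strOf (f a) := by unfold strOf; fun_prop

/-- The finite part of the sequence encoded in the whitespace of a finite sequence. -/
def unweaveList (s : List Bool) : List Bool :=
  (List.range s.length).map (unweave (pad s))

theorem pad_unweaveList (s : List Bool) : pad (unweaveList s) = unweave (pad s) := by
  funext j
  by_cases h : j < s.length
  · simp [unweaveList, pad, h]
  · have h1 : s.length ≤ (j + 1) * (j + 1) := by nlinarith
    simp [unweaveList, unweave, pad, h, h1]

@[fun_prop] theorem Primrec.unweaveList_fun {f : α → List Bool} (hf : Primrec f) :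
    Primrec fun a => unweaveList (f a) := by
  unfold unweaveList unweave; fun_prop

/-- A successor level asks the level below about the sequence decoded from a string, not about the
original argument. The recursion therefore runs over finite lists, each standing for its padding by
zeros, and only the level has to decrease. -/
theorem primrec_listed {R : E → (ℕ → Bool) → ℕ → ℕ → Bool}
    (hp : Primrec fun p : E × List Bool × ℕ × ℕ => R p.1 (pad p.2.1) p.2.2.1 p.2.2.2) :
    Primrec fun p : (ℕ × E) × List Bool × ℕ => listed (R p.1.2) p.1.1 (pad p.2.1) p.2.2 := by
  have hp' : ∀ {β : Type _} [Primcodable β] {e : β → E} {l : β → List Bool} {x y : β → ℕ},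
      Primrec e → Primrec l → Primrec x → Primrec y →
      Primrec fun b => R (e b) (pad (l b)) (x b) (y b) := fun he hl hx hy =>
    hp.comp (he.pair (hl.pair (hx.pair hy)))
  let deps : (ℕ × E) × List Bool × ℕ → List ((ℕ × E) × List Bool × ℕ) := fun b =>
    if b.1.1 = 0 then [] else (List.range (strOf b.2.2).length).map fun i =>
      ((b.1.1 - 1, b.1.2), unweaveList (strOf b.2.2), i)
  let step : (ℕ × E) × List Bool × ℕ → List Bool → Bool := fun b v =>
    if b.1.1 = 0 then
      (Encodable.encode (([.inl (argOf b.2.2)], [valueOf b.2.2]) : IOPair) == b.2.2) &&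
      (R b.1.2 (pad b.2.1) (argOf b.2.2) (valueOf b.2.2) &&
        (List.range (valueOf b.2.2)).all fun y => !R b.1.2 (pad b.2.1) (argOf b.2.2) y)
    else (Encodable.encode (([.inr (strOf b.2.2)], [0]) : IOPair) == b.2.2) &&
      (List.range (strOf b.2.2).length).any fun i =>
        (pad (strOf b.2.2) i != weave (pad (unweaveList (strOf b.2.2))) (pad v) i) ||
        (decide ((2 * i + 1) * (2 * i + 1) < (strOf b.2.2).length) &&
          (pad (unweaveList (strOf b.2.2)) (2 * i) != pad b.2.1 i))
  have hstep : Primrec fun q : ((ℕ × E) × List Bool × ℕ) × List Bool => step q.1 q.2 := by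
    refine Primrec.ite_eq_fun (by fun_prop) (by fun_prop) (.and_fun (by fun_prop) (.and_fun
      (hp' (by fun_prop) (by fun_prop) (by fun_prop) (by fun_prop)) (.all_fun (by fun_prop)
      (.not_fun (hp' (by fun_prop) (by fun_prop) (by fun_prop) (by fun_prop))))))
      (.and_fun (by fun_prop) (.any_fun (by fun_prop) (.or_fun (.bne_fun (by fun_prop)
      (.weave_fun (by fun_prop) (by fun_prop) (by fun_prop))) (by fun_prop))))
  refine Primrec.nat_omega_rec' _ (m := fun b => b.1.1) (l := deps)
    (g := fun b v => some (step b v)) (by fun_prop) (by fun_prop)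
    (Primrec.option_some.comp hstep).to₂ ?_ ?_
  · rintro ⟨⟨n, e⟩, l, c⟩ b' hb'
    rcases n with _ | n
    · simp [deps] at hb'
    · simp only [deps, Nat.add_one_ne_zero, if_false, List.mem_map] at hb'
      obtain ⟨i, -, rfl⟩ := hb'
      simp
  · rintro ⟨⟨n, e⟩, l, c⟩
    rcases n with _ | n
    · simp [step, listed]
    · simp only [step, deps, listed, Nat.add_one_ne_zero, if_false, Option.some_inj,
        List.map_map, refuted, pad_unweaveList, Nat.add_sub_cancel]
      congr 1
      rw [Bool.eq_iff_iff]
      simp only [List.any_eq_true, List.mem_range]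
      refine exists_congr fun i => and_congr_right fun hi => ?_
      -- The list of recursive values is correct only below the length of the string, but the
      -- weaving at `i` asks only for codes below the square root of `i`.
      rw [weave_congr (d' := listed (R e) n (unweave (pad (strOf c)))) (fun _ _ => rfl)
        fun j hj => ?_]
      have hj' : j < (strOf c).length := by
        have := Nat.sqrt_le_self i; omega
      simp [pad, hj', ← pad_unweaveList]

end

/-! ### Truth of arithmetical formulas in terms of their codes -/

/-- A nonzero tag makes the components strictly smaller even for numbers that code nothing, so
recursion on codes can be run on all of `ℕ`. -/
theorem unpair_snd_lt {c t : ℕ} (h : c.unpair.1 = t + 1) : c.unpair.2 < c := by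
  have h1 := Nat.add_le_pair c.unpair.1 c.unpair.2
  rw [Nat.pair_unpair] at h1
  omega

theorem unpair_snd_fst_lt {c t : ℕ} (h : c.unpair.1 = t + 1) : c.unpair.2.unpair.1 < c :=
  (Nat.unpair_left_le _).trans_lt (unpair_snd_lt h)

theorem unpair_snd_snd_lt {c t : ℕ} (h : c.unpair.1 = t + 1) : c.unpair.2.unpair.2 < c :=
  (Nat.unpair_right_le _).trans_lt (unpair_snd_lt h)

/-- The value of the term with code `c`. -/
def codeVal (l : List ℕ) (c : ℕ) : ℕ :=
  if c.unpair.1 = 0 then l.getD c.unpair.2 0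
  else if c.unpair.1 = 2 then 1
  else if _h : c.unpair.1 = 3 then codeVal l c.unpair.2.unpair.1 + codeVal l c.unpair.2.unpair.2
  else if _h : c.unpair.1 = 4 then codeVal l c.unpair.2.unpair.1 * codeVal l c.unpair.2.unpair.2
  else 0
termination_by c
decreasing_by
  all_goals first | exact unpair_snd_fst_lt _h | exact unpair_snd_snd_lt _h

theorem codeVal_code {k : ℕ} (v : Fin k → ℕ) (t : ArTerm k) :
    codeVal (List.ofFn v) t.code = t.val v := by
  induction t with
  | var i => rw [codeVal]; simp [ArTerm.code, ArTerm.val]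
  | zero => rw [codeVal]; simp [ArTerm.code, ArTerm.val]
  | one => rw [codeVal]; simp [ArTerm.code, ArTerm.val]
  | add s t hs ht => rw [codeVal]; simp [ArTerm.code, ArTerm.val, hs, ht]
  | mul s t hs ht => rw [codeVal]; simp [ArTerm.code, ArTerm.val, hs, ht]

theorem primrec_codeVal : Primrec fun p : List ℕ × ℕ => codeVal p.1 p.2 := by
  let deps : List ℕ × ℕ → List (List ℕ × ℕ) := fun p =>
    bif (p.2.unpair.1 == 3 || p.2.unpair.1 == 4) then
      [(p.1, p.2.unpair.2.unpair.1), (p.1, p.2.unpair.2.unpair.2)] else []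
  let step : List ℕ × ℕ → List ℕ → ℕ := fun p v =>
    if p.2.unpair.1 = 0 then p.1.getD p.2.unpair.2 0
    else if p.2.unpair.1 = 2 then 1
    else if p.2.unpair.1 = 3 then v.getD 0 0 + v.getD 1 0
    else if p.2.unpair.1 = 4 then v.getD 0 0 * v.getD 1 0
    else 0
  have hstep : Primrec fun q : (List ℕ × ℕ) × List ℕ => step q.1 q.2 := by fun_prop
  refine Primrec.nat_omega_rec' _ (m := fun b => b.2) (l := deps)
    (g := fun b v => some (step b v)) (by fun_prop) (by fun_prop)
    (Primrec.option_some.comp hstep).to₂ ?_ ?_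
  · rintro ⟨l, c⟩ b' hb'
    by_cases h : c.unpair.1 = 3 ∨ c.unpair.1 = 4
    · have h' : (c.unpair.1 == 3 || c.unpair.1 == 4) = true := by simpa using h
      simp only [deps, h', cond_true, List.mem_cons, List.not_mem_nil, or_false] at hb'
      have ⟨t, ht⟩ : ∃ t, c.unpair.1 = t + 1 := by
        rcases h with h | h
        exacts [⟨_, h⟩, ⟨_, h⟩]
      rcases hb' with rfl | rfl
      exacts [unpair_snd_fst_lt ht, unpair_snd_snd_lt ht]
    · have h' : (c.unpair.1 == 3 || c.unpair.1 == 4) = false := by simpa using h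
      simp [deps, h'] at hb'
  · rintro ⟨l, c⟩
    rw [codeVal]
    by_cases h3 : c.unpair.1 = 3
    · simp [step, deps, h3]
    by_cases h4 : c.unpair.1 = 4
    · simp [step, deps, h4]
    simp [step, h3, h4]

@[fun_prop] theorem Primrec.codeVal_fun {α : Type*} [Primcodable α] {f : α → List ℕ} {g : α → ℕ}
    (hf : Primrec f) (hg : Primrec g) : Primrec fun a => codeVal (f a) (g a) :=
  primrec_codeVal.comp (hf.pair hg)

/-- One step of the truth definition for arithmetical formulas, in terms of codes: `S` is the truth
predicate for the components. -/
def TruthStep (V : ℕ → ℕ → Bool) (S : ℕ → List ℕ → Prop) (c : ℕ) (l : List ℕ) : Prop :=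
  if c.unpair.1 = 0 then codeVal l c.unpair.2.unpair.1 = codeVal l c.unpair.2.unpair.2
  else if c.unpair.1 = 1 then codeVal l c.unpair.2.unpair.1 < codeVal l c.unpair.2.unpair.2
  else if c.unpair.1 = 2 then V c.unpair.2.unpair.2 (codeVal l c.unpair.2.unpair.1) = true
  else if c.unpair.1 = 3 then ¬ S c.unpair.2 l
  else if c.unpair.1 = 4 then S c.unpair.2.unpair.1 l ∧ S c.unpair.2.unpair.2 l
  else if c.unpair.1 = 5 then S c.unpair.2.unpair.1 l ∨ S c.unpair.2.unpair.2 l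
  else if c.unpair.1 = 6 then S c.unpair.2.unpair.1 l → S c.unpair.2.unpair.2 l
  else if c.unpair.1 = 7 then ∃ n, S c.unpair.2 (n :: l)
  else if c.unpair.1 = 8 then ∀ n, S c.unpair.2 (n :: l)
  else False

/-- Only components are consulted, and none for tag `0`. This justifies the recursion for `CodeTrue`
and also yields the uniqueness of truth sets. -/
theorem truthStep_congr {V : ℕ → ℕ → Bool} {S S' : ℕ → List ℕ → Prop} {c : ℕ} {l : List ℕ}
    (h : ∀ c' < c, ∀ l, S c' l ↔ S' c' l) : TruthStep V S c l ↔ TruthStep V S' c l := by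
  unfold TruthStep
  rcases h0 : c.unpair.1 with _ | t
  · simp
  · rw [h _ (unpair_snd_fst_lt h0), h _ (unpair_snd_snd_lt h0)]
    simp only [h _ (unpair_snd_lt h0)]

/-- Truth of the arithmetical formula with code `c`. -/
def CodeTrue (V : ℕ → ℕ → Bool) (c : ℕ) (l : List ℕ) : Prop :=
  TruthStep V (fun c' l' => if _h : c' < c then CodeTrue V c' l' else False) c l
termination_by c

theorem codeTrue_iff (V : ℕ → ℕ → Bool) (c : ℕ) (l : List ℕ) :
    CodeTrue V c l ↔ TruthStep V (CodeTrue V) c l := by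
  rw [CodeTrue]
  refine truthStep_congr fun c' hc' l' => ?_
  simp [hc']

theorem codeTrue_code {k m : ℕ} {φ : SOFormula k m} (hφ : φ.Arithmetical) (v : Fin k → ℕ)
    {V : Fin m → ℕ → Bool} {V' : ℕ → ℕ → Bool} (hV : ∀ j : Fin m, V' j = V j) :
    CodeTrue V' φ.code (List.ofFn v) ↔ φ.Holds v V := by
  induction φ with
  | eq s t => rw [codeTrue_iff]; simp [TruthStep, SOFormula.code, SOFormula.Holds, codeVal_code]
  | lt s t => rw [codeTrue_iff]; simp [TruthStep, SOFormula.code, SOFormula.Holds, codeVal_code]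
  | mem t j =>
    rw [codeTrue_iff]
    simp [TruthStep, SOFormula.code, SOFormula.Holds, codeVal_code, hV]
  | neg φ ih => rw [codeTrue_iff]; simp [TruthStep, SOFormula.code, SOFormula.Holds, ih hφ v hV]
  | and φ ψ ih₁ ih₂ =>
    rw [codeTrue_iff]
    simp [TruthStep, SOFormula.code, SOFormula.Holds, ih₁ hφ.1 v hV, ih₂ hφ.2 v hV]
  | or φ ψ ih₁ ih₂ =>
    rw [codeTrue_iff]
    simp [TruthStep, SOFormula.code, SOFormula.Holds, ih₁ hφ.1 v hV, ih₂ hφ.2 v hV]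
  | imp φ ψ ih₁ ih₂ =>
    rw [codeTrue_iff]
    simp [TruthStep, SOFormula.code, SOFormula.Holds, ih₁ hφ.1 v hV, ih₂ hφ.2 v hV]
  | ex φ ih =>
    have h := fun n => ih hφ (Fin.cons n v) hV
    simp only [List.ofFn_succ, Fin.cons_zero, Fin.cons_succ] at h
    rw [codeTrue_iff]; simp [TruthStep, SOFormula.code, SOFormula.Holds, h]
  | all φ ih =>
    have h := fun n => ih hφ (Fin.cons n v) hV
    simp only [List.ofFn_succ, Fin.cons_zero, Fin.cons_succ] at h
    rw [codeTrue_iff]; simp [TruthStep, SOFormula.code, SOFormula.Holds, h]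
  | exSet φ => exact hφ.elim
  | allSet φ => exact hφ.elim

/-! ### Truth of arithmetical formulas as a `Π⁰₂` property of the truth set -/

/-- How to read a matrix and its set parameters from an infinite binary sequence: the digit
of the `j`-th set variable at `u` is at position `a * u + b` if `(a, b)` is the `j`-th entry of
`sets`, and similarly for the digits of a truth set. -/
structure Reading where
  /-- The places of the set variables. -/
  sets : List (ℕ × ℕ)
  /-- The place of the truth set. -/
  truth : ℕ × ℕ
  /-- Whether the matrix is negated. -/
  pos : Bool
  /-- The code of the matrix. -/
  matrix : ℕ

namespace Reading

/-- Readings as tuples. -/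
def equiv : Reading ≃ List (ℕ × ℕ) × (ℕ × ℕ) × Bool × ℕ where
  toFun e := (e.sets, e.truth, e.pos, e.matrix)
  invFun e := ⟨e.1, e.2.1, e.2.2.1, e.2.2.2⟩

instance : Primcodable Reading := Primcodable.ofEquiv _ equiv

section
variable {α : Type*} [Primcodable α] {f : α → Reading}

@[fun_prop] theorem primrec_equiv (hf : Primrec f) : Primrec fun a => equiv (f a) :=
  (Primrec.of_equiv (e := equiv)).comp hf

@[fun_prop] theorem primrec_sets (hf : Primrec f) : Primrec fun a => (f a).sets :=
  Primrec.fst_fun (primrec_equiv hf)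

@[fun_prop] theorem primrec_truth (hf : Primrec f) : Primrec fun a => (f a).truth :=
  Primrec.fst_fun (Primrec.snd_fun (primrec_equiv hf))

@[fun_prop] theorem primrec_pos (hf : Primrec f) : Primrec fun a => (f a).pos :=
  Primrec.fst_fun (Primrec.snd_fun (Primrec.snd_fun (primrec_equiv hf)))

@[fun_prop] theorem primrec_matrix (hf : Primrec f) : Primrec fun a => (f a).matrix :=
  Primrec.snd_fun (Primrec.snd_fun (Primrec.snd_fun (primrec_equiv hf)))

@[fun_prop] theorem primrec_mk {s : α → List (ℕ × ℕ)} {t : α → ℕ × ℕ} {p : α → Bool} {m : α → ℕ}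
    (hs : Primrec s) (ht : Primrec t) (hp : Primrec p) (hm : Primrec m) :
    Primrec fun a => Reading.mk (s a) (t a) (p a) (m a) :=
  (Primrec.of_equiv_symm (e := equiv)).comp (hs.pair (ht.pair (hp.pair hm)))

end

/-- The position of the digit of the truth set for the formula with code `c` under the
assignment `l`. -/
def truthPos (e : Reading) (c : ℕ) (l : List ℕ) : ℕ :=
  e.truth.1 * Encodable.encode (c, l) + e.truth.2

/-- The position of the digit of the `j`-th set variable at `u`. -/
def setPos (e : Reading) (j u : ℕ) : ℕ := (e.sets.getD j (0, 0)).1 * u + (e.sets.getD j (0, 0)).2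

/-- The position of the first digit that the truth of the formula with code `c` depends on. -/
def firstPos (e : Reading) (c : ℕ) (l : List ℕ) (n : ℕ) : ℕ :=
  if c.unpair.1 = 2 then e.setPos c.unpair.2.unpair.2 (codeVal l c.unpair.2.unpair.1)
  else if c.unpair.1 = 3 then e.truthPos c.unpair.2 l
  else bif decide (c.unpair.1 < 7) then e.truthPos c.unpair.2.unpair.1 l
  else e.truthPos c.unpair.2 (n :: l)

/-- The position of the second digit that the truth of the formula with code `c` depends on. -/
def secondPos (e : Reading) (c : ℕ) (l : List ℕ) (n : ℕ) : ℕ :=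
  bif decide (c.unpair.1 < 7) then e.truthPos c.unpair.2.unpair.2 l
  else e.truthPos c.unpair.2 (n :: l)

/-- The condition on the truth value `b` of a formula with outermost symbol `tag`, in terms of the
truth values `b₁` and `b₂` of instances of its components. In the case of a quantifier, `b₁` is
for an arbitrary instance and `b₂` for a suitable one. -/
def clause (tag : ℕ) (isEq isLt b b₁ b₂ : Bool) : Bool :=
  if tag = 0 then b == isEq
  else if tag = 1 then b == isLt
  else if tag = 2 then b == b₁
  else if tag = 3 then b == !b₁
  else if tag = 4 then b == (b₁ && b₂)
  else if tag = 5 then b == (b₁ || b₂)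
  else if tag = 6 then b == (!b₁ || b₂)
  else if tag = 7 then (!b₁ || b) && (!b || b₂)
  else if tag = 8 then (!b || b₁) && (!b₂ || b)
  else !b

/-- The condition `clause` for the formula with code `c` and the truth set given by `Z`. -/
def clauseAt (e : Reading) (Z : ℕ → Bool) (c : ℕ) (l : List ℕ) (n y : ℕ) : Bool :=
  clause c.unpair.1
    (codeVal l c.unpair.2.unpair.1 == codeVal l c.unpair.2.unpair.2)
    (decide (codeVal l c.unpair.2.unpair.1 < codeVal l c.unpair.2.unpair.2))
    (Z (e.truthPos c l)) (Z (e.firstPos c l n)) (Z (e.secondPos c l y))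

/-- The number `y` shows that `Z` satisfies the condition with number `x`. -/
def check (e : Reading) (Z : ℕ → Bool) (x y : ℕ) : Bool :=
  (decide (e.truthPos e.matrix [] < y) && (Z (e.truthPos e.matrix []) == !e.pos)) &&
  (decide (e.truthPos x.unpair.1 (Denumerable.ofNat (List ℕ) x.unpair.2.unpair.1) < y) &&
  (decide (e.firstPos x.unpair.1 (Denumerable.ofNat (List ℕ) x.unpair.2.unpair.1)
    x.unpair.2.unpair.2 < y) &&
  (decide (e.secondPos x.unpair.1 (Denumerable.ofNat (List ℕ) x.unpair.2.unpair.1)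
    y.unpair.1 < y) &&
  e.clauseAt Z x.unpair.1 (Denumerable.ofNat (List ℕ) x.unpair.2.unpair.1)
    x.unpair.2.unpair.2 y.unpair.1)))

/-- `check` explicitly demands that `y` exceed every position of `Z` that it reads. -/
theorem isLocal_check (e : Reading) (x : ℕ) : IsLocal fun Z y => e.check Z x y := by
  intro Z Z' y h
  simp only [check]
  rw [Bool.eq_iff_iff]
  simp only [Bool.and_eq_true, decide_eq_true_eq]
  refine and_congr (and_congr_right fun h1 => by rw [h _ h1]) (and_congr_right fun h2 =>
    and_congr_right fun h3 => and_congr_right fun h4 => ?_)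
  rw [clauseAt, clauseAt, h _ h2, h _ h3, h _ h4]

theorem primrec_check : Primrec fun p : Reading × List Bool × ℕ × ℕ =>
    check p.1 (pad p.2.1) p.2.2.1 p.2.2.2 := by
  have ht : ∀ {α : Type} [Primcodable α] {e : α → Reading} {c : α → ℕ} {l : α → List ℕ},
      Primrec e → Primrec c → Primrec l → Primrec fun a => (e a).truthPos (c a) (l a) := by
    intros; unfold truthPos; fun_prop
  have hs : ∀ {α : Type} [Primcodable α] {e : α → Reading} {j u : α → ℕ},
      Primrec e → Primrec j → Primrec u → Primrec fun a => (e a).setPos (j a) (u a) := by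
    intros; unfold setPos; fun_prop
  have hl : Primrec fun p : Reading × List Bool × ℕ × ℕ =>
      Denumerable.ofNat (List ℕ) p.2.2.1.unpair.2.unpair.1 :=
    (Primrec.ofNat _).comp (by fun_prop)
  have hm : Primrec fun p : Reading × List Bool × ℕ × ℕ => p.1.truthPos p.1.matrix [] :=
    ht (by fun_prop) (by fun_prop) (by fun_prop)
  have h0 : Primrec fun p : Reading × List Bool × ℕ × ℕ => p.1.truthPos p.2.2.1.unpair.1
      (Denumerable.ofNat (List ℕ) p.2.2.1.unpair.2.unpair.1) :=
    ht (by fun_prop) (by fun_prop) (by fun_prop)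
  have h1 : Primrec fun p : Reading × List Bool × ℕ × ℕ => p.1.firstPos p.2.2.1.unpair.1
      (Denumerable.ofNat (List ℕ) p.2.2.1.unpair.2.unpair.1) p.2.2.1.unpair.2.unpair.2 :=
    .ite_eq_fun (by fun_prop) (by fun_prop) (hs (by fun_prop) (by fun_prop) (by fun_prop))
      (.ite_eq_fun (by fun_prop) (by fun_prop) (ht (by fun_prop) (by fun_prop) (by fun_prop))
      (.bif_fun (by fun_prop) (ht (by fun_prop) (by fun_prop) (by fun_prop))
        (ht (by fun_prop) (by fun_prop) (by fun_prop))))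
  have h2 : Primrec fun p : Reading × List Bool × ℕ × ℕ => p.1.secondPos p.2.2.1.unpair.1
      (Denumerable.ofNat (List ℕ) p.2.2.1.unpair.2.unpair.1) p.2.2.2.unpair.1 :=
    .bif_fun (by fun_prop) (ht (by fun_prop) (by fun_prop) (by fun_prop))
        (ht (by fun_prop) (by fun_prop) (by fun_prop))
  unfold check clauseAt clause
  fun_prop

/-- Tarski's clause for a quantifier has one direction that speaks of all instances and one that
asks for a suitable instance. The two are independent, so together they have the form `∀ n, ∃ y`;
for the other symbols `n` and `y` are idle. -/
theorem forall_exists_clauseAt_iff (e : Reading) (Z : ℕ → Bool) (c : ℕ) (l : List ℕ) :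
    (∀ n, ∃ y, e.clauseAt Z c l n y = true) ↔ (Z (e.truthPos c l) = true ↔
      TruthStep (fun j u => Z (e.setPos j u)) (fun c l => Z (e.truthPos c l) = true) c l) := by
  simp only [clauseAt, clause, firstPos, secondPos, TruthStep]
  by_cases h9 : c.unpair.1 < 9
  · interval_cases h : c.unpair.1
    all_goals simp
    all_goals
      cases Z (e.truthPos c l) <;>
        first
        | simp; done
        | cases Z (e.truthPos c.unpair.2.unpair.1 l) <;> simp
  · have : ∀ m < 9, c.unpair.1 ≠ m := fun m hm => by omega
    simp [this]

/-- A set satisfying Tarski's clauses at every code is the truth set, by strong induction on the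
code. Here lies the reduction of arbitrary arithmetical matrices to `Π⁰₂`. -/
theorem exists_check_iff (e : Reading) (Z : ℕ → Bool) :
    (∀ x, ∃ y, e.check Z x y = true) ↔ Z (e.truthPos e.matrix []) = !e.pos ∧
      ∀ c l, (Z (e.truthPos c l) = true ↔ CodeTrue (fun j u => Z (e.setPos j u)) c l) := by
  have h1 : (∀ x, ∃ y, e.check Z x y = true) ↔ Z (e.truthPos e.matrix []) = !e.pos ∧
      ∀ c l n, ∃ y, e.clauseAt Z c l n y = true := by
    simp only [check, Bool.and_eq_true, decide_eq_true_eq, beq_iff_eq]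
    constructor
    · intro h
      -- The condition on the matrix is part of every instance, so any `x` would do.
      refine ⟨(h 0).choose_spec.1.2, fun c l n => ?_⟩
      obtain ⟨y, -, -, -, -, hy⟩ := h (Nat.pair c (Nat.pair (Encodable.encode l) n))
      simp only [Nat.unpair_pair, Denumerable.ofNat_encode] at hy
      exact ⟨_, hy⟩
    · rintro ⟨h0, h⟩ x
      obtain ⟨y, hy⟩ := h x.unpair.1 (Denumerable.ofNat (List ℕ) x.unpair.2.unpair.1)
        x.unpair.2.unpair.2
      set c := x.unpair.1
      set l := Denumerable.ofNat (List ℕ) x.unpair.2.unpair.1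
      set n := x.unpair.2.unpair.2
      -- The first component of the new number is the suitable instance; the second only lifts it
      -- above all positions that are read.
      have hle := Nat.right_le_pair y (e.truthPos e.matrix [] + e.truthPos c l +
        e.firstPos c l n + e.secondPos c l y + 1)
      refine ⟨Nat.pair y (e.truthPos e.matrix [] + e.truthPos c l +
        e.firstPos c l n + e.secondPos c l y + 1), ?_⟩
      simp only [Nat.unpair_pair]
      refine ⟨⟨?_, h0⟩, ?_, ?_, ?_, hy⟩ <;> omega
  rw [h1]
  refine and_congr_right fun _ => ?_
  simp only [forall_exists_clauseAt_iff]
  constructor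
  · intro h c
    induction c using Nat.strong_induction_on with
    | _ c ih => intro l; rw [h, codeTrue_iff]; exact truthStep_congr ih
  · intro h c l
    rw [h, codeTrue_iff]
    exact (truthStep_congr fun c' _ l' => h c' l').symm

end Reading

/-! ### Reading off the quantifier prefix -/

namespace SOFormula

/-- Formulas in prenex form: set quantifiers followed by an arithmetical formula. -/
def Prenex : {k m : ℕ} → SOFormula k m → Prop
  | _, _, .exSet φ => φ.Prenex
  | _, _, .allSet φ => φ.Prenex
  | _, _, φ => φ.Arithmetical

/-- The number of set quantifiers in the prefix that differ from the preceding one, where the first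
one is preceded by a universal quantifier if `b`, and by an existential one otherwise. -/
def switches : Bool → {k m : ℕ} → SOFormula k m → ℕ
  | b, _, _, .exSet φ => switches false φ + b.toNat
  | b, _, _, .allSet φ => switches true φ + (!b).toNat
  | _, _, _, _ => 0

theorem Arithmetical.prenex {k m : ℕ} {φ : SOFormula k m} (h : φ.Arithmetical) : φ.Prenex := by
  cases φ <;> first | exact h | exact h.elim

theorem Arithmetical.switches {k m : ℕ} {φ : SOFormula k m} (h : φ.Arithmetical) (b : Bool) :
    φ.switches b = 0 := by
  cases φ <;> first | rfl | exact h.elim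

theorem Prenex.isPi_and_isSigma {k m : ℕ} {φ : SOFormula k m} (h : φ.Prenex) :
    IsPi (φ.switches true + 1) φ ∧ IsSigma (φ.switches false + 1) φ := by
  induction φ with
  | exSet φ ih => exact ⟨.ofSigma (.exSet (ih h).2), .exSet (ih h).2⟩
  | allSet φ ih => exact ⟨.allSet (ih h).1, .ofPi (.allSet (ih h).1)⟩
  | _ => exact ⟨.arith h, .arith h⟩

-- For `n = 0` only arithmetical formulas qualify, and the truncated `n - 1` still gives the correct
-- bound `0`.
mutual
theorem IsPi.prenex_and_switches_le {k m n : ℕ} {φ : SOFormula k m} (h : IsPi n φ) :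
    φ.Prenex ∧ φ.switches true ≤ n - 1 ∧ φ.switches false ≤ n := by
  match h with
  | .arith h => exact ⟨h.prenex, by rw [h.switches]; omega, by rw [h.switches]; omega⟩
  | .ofSigma h =>
    obtain ⟨h1, h2, h3⟩ := h.prenex_and_switches_le
    exact ⟨h1, by omega, by omega⟩
  | .allSet h =>
    obtain ⟨h1, h2, h3⟩ := h.prenex_and_switches_le
    refine ⟨h1, ?_, ?_⟩ <;>
      simp only [SOFormula.switches, Bool.toNat, Bool.not_true, Bool.not_false, cond_true,
        cond_false] <;>
      omega

theorem IsSigma.prenex_and_switches_le {k m n : ℕ} {φ : SOFormula k m} (h : IsSigma n φ) :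
    φ.Prenex ∧ φ.switches false ≤ n - 1 ∧ φ.switches true ≤ n := by
  match h with
  | .arith h => exact ⟨h.prenex, by rw [h.switches]; omega, by rw [h.switches]; omega⟩
  | .ofPi h =>
    obtain ⟨h1, h2, h3⟩ := h.prenex_and_switches_le
    exact ⟨h1, by omega, by omega⟩
  | .exSet h =>
    obtain ⟨h1, h2, h3⟩ := h.prenex_and_switches_le
    refine ⟨h1, ?_, ?_⟩ <;>
      simp only [SOFormula.switches, Bool.toNat, cond_true, cond_false] <;> omega
end

/-- Positivity of `n` makes a purely arithmetical formula count as `Π¹₁`, in accordance with the one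
quantifier over truth sets that it costs. -/
theorem prenex_and_eq_of_isLeast {k m n : ℕ} {φ : SOFormula k m}
    (h : IsLeast {j : ℕ | 0 < j ∧ IsPi j φ} n) : φ.Prenex ∧ n = φ.switches true + 1 := by
  obtain ⟨⟨h0, hn⟩, hmin⟩ := h
  obtain ⟨h1, h2, -⟩ := hn.prenex_and_switches_le
  have := hmin ⟨Nat.succ_pos _, h1.isPi_and_isSigma.1⟩
  exact ⟨h1, by omega⟩

end SOFormula

namespace Reading

/-- Pass the next quantifier of the prefix. If it differs from the preceding one, a new level of
the tower is entered, so that the sequence read so far moves to the even places. -/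
def step (s : ℕ × Reading) : ℕ × Reading :=
  bif s.2.matrix.unpair.1 == 9 || s.2.matrix.unpair.1 == 10 then
    bif (s.2.matrix.unpair.1 == 10) == s.2.pos then
      (s.1, ⟨(2 * s.2.truth.1, s.2.truth.2) :: s.2.sets,
        (2 * s.2.truth.1, s.2.truth.1 + s.2.truth.2), s.2.pos, s.2.matrix.unpair.2⟩)
    else (s.1 + 1, ⟨(4, 1) :: s.2.sets.map fun a => (2 * a.1, 2 * a.2), (4, 3), !s.2.pos,
        s.2.matrix.unpair.2⟩)
  else s

/-- The number of switches in the prefix of the formula with code `c`, and the way to read its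
matrix. -/
def ofCode (c : ℕ) : ℕ × Reading := step^[c] (0, ⟨[(2, 0)], (2, 1), true, c⟩)

theorem primrec_step : Primrec step := by unfold step; fun_prop

theorem primrec_ofCode : Primrec ofCode :=
  Primrec.nat_iterate Primrec.id (by fun_prop) (primrec_step.comp Primrec.snd).to₂

/-- The state after the whole prefix of a formula. -/
def finish : {k m : ℕ} → SOFormula k m → ℕ × Reading → ℕ × Reading
  | _, _, .exSet φ, s => finish φ (step s)
  | _, _, .allSet φ, s => finish φ (step s)
  | _, _, _, s => s

theorem matrix_step_exSet {k m : ℕ} {φ : SOFormula k (m + 1)} {s : ℕ × Reading}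
    (h : s.2.matrix = φ.exSet.code) : (step s).2.matrix = φ.code := by
  cases hp : s.2.pos <;> simp [step, h, SOFormula.code, hp]

theorem matrix_step_allSet {k m : ℕ} {φ : SOFormula k (m + 1)} {s : ℕ × Reading}
    (h : s.2.matrix = φ.allSet.code) : (step s).2.matrix = φ.code := by
  cases hp : s.2.pos <;> simp [step, h, SOFormula.code, hp]

/-- A prefix has no more quantifiers than its Gödel number, and the step is idle once the matrix is
reached. So iterating as often as the number says surely consumes the prefix. -/
theorem iterate_step {k m : ℕ} (φ : SOFormula k m) {N : ℕ} {s : ℕ × Reading}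
    (h : s.2.matrix = φ.code) (hN : φ.code ≤ N) : step^[N] s = finish φ s := by
  induction φ generalizing N s with
  | exSet φ ih =>
    have hlt := Nat.add_le_pair 9 φ.code
    rw [SOFormula.code] at hN
    obtain ⟨N, rfl⟩ : ∃ N', N = N' + 1 := ⟨N - 1, by omega⟩
    rw [Function.iterate_succ_apply, ih (matrix_step_exSet h) (by omega), finish]
  | allSet φ ih =>
    have hlt := Nat.add_le_pair 10 φ.code
    rw [SOFormula.code] at hN
    obtain ⟨N, rfl⟩ : ∃ N', N = N' + 1 := ⟨N - 1, by omega⟩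
    rw [Function.iterate_succ_apply, ih (matrix_step_allSet h) (by omega), finish]
  | _ => exact Function.iterate_fixed (by simp [step, h, SOFormula.code]) N

theorem finish_fst {k m : ℕ} (φ : SOFormula k m) {s : ℕ × Reading}
    (h : s.2.matrix = φ.code) : (finish φ s).1 = s.1 + φ.switches s.2.pos := by
  induction φ generalizing s with
  | exSet φ ih =>
    rw [finish, ih (matrix_step_exSet h)]
    cases hp : s.2.pos <;> simp [step, h, SOFormula.code, hp, SOFormula.switches]; omega
  | allSet φ ih =>
    rw [finish, ih (matrix_step_allSet h)]
    cases hp : s.2.pos <;> simp [step, h, SOFormula.code, hp, SOFormula.switches]; omega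
  | _ => rfl

/-- The `Π⁰₂` property of `Z`: it consists of set parameters and of their truth set, and the matrix
is false (true, if it is negated). -/
def Refutes (e : Reading) (Z : ℕ → Bool) : Prop := ∀ x, ∃ y, e.check Z x y = true

/-- In all the sequences `K Y`, the values `V` of the set variables and the sequence `Y` can be
found at the places given by `e`. -/
def Fits (e : Reading) (V : ℕ → ℕ → Bool) (K : (ℕ → Bool) → ℕ → Bool) : Prop :=
  (∀ Y j u, K Y (e.setPos j u) = V j u) ∧ ∀ Y u, K Y (e.truth.1 * u + e.truth.2) = Y u

/-- For given values of the set variables there is exactly one truth set, so the quantifier over `Y`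
evaluates the matrix at that set. The value of `pos` decides whether a false or a true matrix counts
as a refutation. -/
theorem Fits.arithmetical {e : Reading} {V : ℕ → ℕ → Bool} {K : (ℕ → Bool) → ℕ → Bool}
    (hK : e.Fits V K) {k m : ℕ} {φ : SOFormula k m} (hφ : φ.Arithmetical) {v : Fin k → ℕ}
    (hv : List.ofFn v = []) {V' : Fin m → ℕ → Bool} (hV : ∀ j : Fin m, V j = V' j)
    (h : e.matrix = φ.code) :
    (φ.Holds v V' ↔ e.pos = true) ↔ ∀ Y, ¬ e.Refutes (K Y) := by
  have hset : ∀ Y, (fun j u => K Y (e.setPos j u)) = V := fun Y => by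
    funext j u; exact hK.1 Y j u
  have htruth : ∀ Y c l, K Y (e.truthPos c l) = Y (Encodable.encode (c, l)) := fun Y c l =>
    hK.2 Y _
  simp only [Refutes, exists_check_iff, hset, htruth, h]
  have hholds := codeTrue_code hφ v hV
  rw [hv] at hholds
  rw [← hholds]
  constructor
  · rintro h1 Y ⟨h2, h3⟩
    rw [← h3, h2] at h1
    simp at h1
  · intro h1
    classical
    let Y : ℕ → Bool := fun q => decide (CodeTrue V (Denumerable.ofNat (ℕ × List ℕ) q).1
      (Denumerable.ofNat (ℕ × List ℕ) q).2)
    have hY : ∀ c l, (Y (Encodable.encode (c, l)) = true ↔ CodeTrue V c l) := fun c l => by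
      simp only [Y, Denumerable.ofNat_encode, decide_eq_true_eq]
    have h2 : Y (Encodable.encode (φ.code, ([] : List ℕ))) ≠ !e.pos := fun h2 => h1 Y ⟨h2, hY⟩
    rw [← hY]
    generalize Y (Encodable.encode (φ.code, ([] : List ℕ))) = b at h2 ⊢
    generalize e.pos = p at h2 ⊢
    revert b p
    decide

/-- The sequence of the values of the set variables after that of a new variable is added. -/
def consSeq (R : ℕ → Bool) (V : ℕ → ℕ → Bool) : ℕ → ℕ → Bool
  | 0 => R
  | j + 1 => V j

theorem consSeq_eq_cons {R : ℕ → Bool} {V : ℕ → ℕ → Bool} {m : ℕ} {V' : Fin m → ℕ → Bool}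
    (hV : ∀ j : Fin m, V j = V' j) (j : Fin (m + 1)) :
    consSeq R V j = (Fin.cons R V' : Fin (m + 1) → ℕ → Bool) j := by
  refine Fin.cases rfl (fun j => ?_) j
  simpa [consSeq] using hV j

/-- A quantifier of the same kind splits the innermost sequence and takes its even half. If that
sequence is read at `a * u + b`, its halves are read at `2 * a * u + b` and `2 * a * u + (a + b)`.
-/
theorem Fits.push {s : ℕ × Reading} {V : ℕ → ℕ → Bool}
    {K : (ℕ → Bool) → ℕ → Bool} (hK : s.2.Fits V K) (R : ℕ → Bool)
    (h9 : s.2.matrix.unpair.1 = 9 ∨ s.2.matrix.unpair.1 = 10)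
    (h : (s.2.matrix.unpair.1 == 10) = s.2.pos) :
    (step s).2.Fits (consSeq R V) fun Y => K (join R Y) := by
  have h9' : (s.2.matrix.unpair.1 == 9 || s.2.matrix.unpair.1 == 10) = true := by simpa using h9
  have hs : (step s).2 = ⟨(2 * s.2.truth.1, s.2.truth.2) :: s.2.sets,
      (2 * s.2.truth.1, s.2.truth.1 + s.2.truth.2), s.2.pos, s.2.matrix.unpair.2⟩ := by
    rw [step, h9', h, beq_self_eq_true]; rfl
  rw [hs]
  refine ⟨fun Y j u => ?_, fun Y u => ?_⟩
  · rcases j with _ | j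
    · rw [consSeq, ← join_even R Y u, ← hK.2 (join R Y)]
      simp only [setPos, List.getD_cons_zero]
      congr 1; ring
    · exact hK.1 _ j u
  · rw [← join_odd R Y u, ← hK.2 (join R Y)]
    congr 1; ring

/-- A new level moves all earlier places to even positions, doubling them. The new odd half is split
at once into `4 * u + 1` for the new variable and `4 * u + 3` for what comes later. The remainder
`Y₀` of the previous level is abandoned. -/
theorem Fits.switch {s : ℕ × Reading} {V : ℕ → ℕ → Bool}
    {K : (ℕ → Bool) → ℕ → Bool} (hK : s.2.Fits V K) (R Y₀ : ℕ → Bool)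
    (h9 : s.2.matrix.unpair.1 = 9 ∨ s.2.matrix.unpair.1 = 10)
    (h : (s.2.matrix.unpair.1 == 10) ≠ s.2.pos) :
    (step s).2.Fits (consSeq R V) fun Y => join (K Y₀) (join R Y) := by
  have h9' : (s.2.matrix.unpair.1 == 9 || s.2.matrix.unpair.1 == 10) = true := by simpa using h9
  have hs : (step s).2 = ⟨(4, 1) :: s.2.sets.map fun a => (2 * a.1, 2 * a.2), (4, 3), !s.2.pos,
        s.2.matrix.unpair.2⟩ := by
    simp only [step, h9', beq_false_of_ne h, cond_true, cond_false]
  rw [hs]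
  refine ⟨fun Y j u => ?_, fun Y u => ?_⟩
  · rcases j with _ | j
    · rw [consSeq, ← join_even R Y u, ← join_odd (K Y₀) (join R Y)]
      simp only [setPos, List.getD_cons_zero]
      congr 1; ring
    · rw [consSeq, ← hK.1 Y₀ j u, ← join_even (K Y₀) (join R Y)]
      -- Indices beyond the list read the default place `(0, 0)`, which is fixed under doubling.
      have hd : (((0, 0) : ℕ × ℕ)) = (fun a : ℕ × ℕ => (2 * a.1, 2 * a.2)) (0, 0) := rfl
      simp only [setPos, List.getD_cons_succ]
      rw [hd, List.getD_map]
      congr 1; simp only; ring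
  · rw [← join_odd R Y u, ← join_odd (K Y₀) (join R Y)]
    congr 1; ring

theorem forall_join {P : (ℕ → Bool) → Prop} : (∀ R Y, P (join R Y)) ↔ ∀ Y, P Y :=
  ⟨fun h Y => by
    rw [eq_join (Z := Y) (X := fun i => Y (2 * i)) (Y := fun i => Y (2 * i + 1))
      (fun _ => rfl) fun _ => rfl]
    exact h _ _, fun h _ _ => h _⟩

/-- The statement is relative to a state in the middle of the prefix: `pos` is the kind of the
current block, and comparing truth with it negates the formula in existential blocks. The condition
on `v` says `k = 0` in a form that survives the induction. -/
theorem Fits.holds_iff {k m : ℕ} {φ : SOFormula k m} (hφ : φ.Prenex) {v : Fin k → ℕ}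
    (hv : List.ofFn v = []) {s : ℕ × Reading} (h : s.2.matrix = φ.code)
    {V : ℕ → ℕ → Bool} {K : (ℕ → Bool) → ℕ → Bool} (hK : s.2.Fits V K)
    {V' : Fin m → ℕ → Bool} (hV : ∀ j : Fin m, V j = V' j) :
    (φ.Holds v V' ↔ s.2.pos = true) ↔
      ∀ Y, ¬ Tower (finish φ s).2.Refutes (φ.switches s.2.pos) (K Y) := by
  induction φ generalizing s V K with
  | exSet φ ih =>
    have ht : s.2.matrix.unpair.1 = 9 := by simp [h, SOFormula.code]
    have ih' := fun R K hK => ih hφ hv (matrix_step_exSet h) (K := K) hK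
      (consSeq_eq_cons (R := R) hV)
    rw [finish]
    cases hp : s.2.pos with
    | false =>
      have hne : (s.2.matrix.unpair.1 == 10) = s.2.pos := by simp [ht, hp]
      have hpos : (step s).2.pos = false := by simp [step, ht, hp]
      have ih'' := fun R => ih' R _ (hK.push R (Or.inl ht) hne)
      simp only [hpos, Bool.false_eq_true, iff_false] at ih''
      simp only [SOFormula.Holds, SOFormula.switches, Bool.toNat_false, add_zero,
        Bool.false_eq_true, iff_false, not_exists, ih'']
      exact forall_join (P := fun Y => ¬ Tower (finish φ (step s)).2.Refutes _ (K Y))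
    | true =>
      have hne : (s.2.matrix.unpair.1 == 10) ≠ s.2.pos := by simp [ht, hp]
      have hpos : (step s).2.pos = false := by simp [step, ht, hp]
      have ih'' := fun Y₀ R => ih' R _ (hK.switch R Y₀ (Or.inl ht) hne)
      simp only [hpos, Bool.false_eq_true, iff_false] at ih''
      simp only [SOFormula.Holds, SOFormula.switches, Bool.toNat_true, iff_true, Tower]
      -- Truth does not depend on the abandoned remainder `Y₀`, so the quantifier over it is vacuous
      -- and any value can be inserted.
      have h3 : ∀ Y₀, (∃ R, φ.Holds v (Fin.cons R V')) ↔
          ¬ ∀ Y, ¬ Tower (finish φ (step s)).2.Refutes (φ.switches false) (join (K Y₀) Y) := by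
        intro Y₀
        rw [← forall_join (P := fun Y => ¬ Tower (finish φ (step s)).2.Refutes
          (φ.switches false) (join (K Y₀) Y))]
        simp only [← ih'' Y₀, not_forall, not_not]
      exact ⟨fun h Y => (h3 Y).1 h, fun h => (h3 fun _ => false).2 (h _)⟩
  | allSet φ ih =>
    have ht : s.2.matrix.unpair.1 = 10 := by simp [h, SOFormula.code]
    have ih' := fun R K hK => ih hφ hv (matrix_step_allSet h) (K := K) hK
      (consSeq_eq_cons (R := R) hV)
    rw [finish]
    cases hp : s.2.pos with
    | true =>
      have hne : (s.2.matrix.unpair.1 == 10) = s.2.pos := by simp [ht, hp]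
      have hpos : (step s).2.pos = true := by simp [step, ht, hp]
      have ih'' := fun R => ih' R _ (hK.push R (Or.inr ht) hne)
      simp only [hpos, iff_true] at ih''
      simp only [SOFormula.Holds, SOFormula.switches, Bool.not_true, Bool.toNat_false, add_zero,
        iff_true, ih'']
      exact forall_join (P := fun Y => ¬ Tower (finish φ (step s)).2.Refutes _ (K Y))
    | false =>
      have hne : (s.2.matrix.unpair.1 == 10) ≠ s.2.pos := by simp [ht, hp]
      have hpos : (step s).2.pos = true := by simp [step, ht, hp]
      have ih'' := fun Y₀ R => ih' R _ (hK.switch R Y₀ (Or.inr ht) hne)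
      simp only [hpos, iff_true] at ih''
      simp only [SOFormula.Holds, SOFormula.switches, Bool.not_false, Bool.toNat_true,
        Bool.false_eq_true, iff_false, Tower]
      have h3 : ∀ Y₀, (∀ R, φ.Holds v (Fin.cons R V')) ↔
          ∀ Y, ¬ Tower (finish φ (step s)).2.Refutes (φ.switches true) (join (K Y₀) Y) := by
        intro Y₀
        rw [← forall_join (P := fun Y => ¬ Tower (finish φ (step s)).2.Refutes
          (φ.switches true) (join (K Y₀) Y))]
        simp only [← ih'' Y₀]
      exact ⟨fun h Y => mt (h3 Y).2 h, fun h => mt (h3 fun _ => false).1 (h _)⟩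
  | _ => exact hK.arithmetical hφ hv hV h

end Reading

open BoxFormula in
theorem exists_recursiveFunctional_isWitness_iterImp :
    ∃ f : ℕ → (ℕ → Bool) → (ℕ → Bool), IsRecursiveFunctional f ∧
      ∀ (n : ℕ) (φ : SOFormula 0 1), IsLeast {j : ℕ | 0 < j ∧ SOFormula.IsPi j φ} n →
        ∀ X : ℕ → Bool, φ.Holds Fin.elim0 (fun _ => X) ↔
            IsWitness (f φ.code X) (iterImp n) Fin.elim0 := by
  refine ⟨fun c X => weave X (listed (Reading.ofCode c).2.check ((Reading.ofCode c).1 + 1) X),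
    ⟨fun p => bif decide (p.2.1 < p.2.2.length) then some (weave (pad p.2.2) (listed
      (Reading.ofCode p.1).2.check ((Reading.ofCode p.1).1 + 1) (pad p.2.2)) p.2.1) else none,
      ?_, fun c X i => ?_⟩, fun n φ hn X => ?_⟩
  · have h1 := Reading.primrec_ofCode
    have h2 : Primrec fun q : (ℕ × ℕ × List Bool) × ℕ =>
        listed (Reading.ofCode q.1.1).2.check ((Reading.ofCode q.1.1).1 + 1) (pad q.1.2.2) q.2 :=
      (primrec_listed Reading.primrec_check).comp
        (g := fun q : (ℕ × ℕ × List Bool) × ℕ => (((Reading.ofCode q.1.1).1 + 1,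
          (Reading.ofCode q.1.1).2), q.1.2.2, q.2)) (by fun_prop)
    exact (Primrec.bif_fun (by fun_prop) (Primrec.option_some.comp
      (Primrec.weave_fun (by fun_prop) h2 (by fun_prop))) (by fun_prop)).to_comp
  · have h : ∀ t, i < t → weave (pad (initSeg X t)) (listed
      (Reading.ofCode c).2.check ((Reading.ofCode c).1 + 1) (pad (initSeg X t))) i =
      weave X (listed (Reading.ofCode c).2.check ((Reading.ofCode c).1 + 1) X) i := fun t ht =>
      (isLocal_listed (Reading.isLocal_check _) _).weave fun j hj => pad_initSeg (by
        have := Nat.sqrt_le_self i; omega)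
    refine ⟨⟨i + 1, ?_⟩, fun t b hb => ?_⟩
    · simp [length_initSeg, h (i + 1)]
    · by_cases ht : i < t
      · simpa [length_initSeg, ht, h t ht] using hb.symm
      · simp [length_initSeg, ht] at hb
  · obtain ⟨hφ, rfl⟩ := SOFormula.prenex_and_eq_of_isLeast hn
    have hs : Reading.ofCode φ.code = _ := Reading.iterate_step φ rfl le_rfl
    have h1 := Reading.finish_fst φ (s := (0, ⟨[(2, 0)], (2, 1), true, φ.code⟩)) rfl
    have h2 := Reading.Fits.holds_iff hφ (v := Fin.elim0) (by simp)
      (s := (0, ⟨[(2, 0)], (2, 1), true, φ.code⟩)) rfl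
      -- Indices other than that of the only set variable read the default place, hence the digit `X
      -- 0`.
      (V := fun j u => X (bif j == 0 then u else 0)) (K := join X)
      ⟨fun Y j u => ?_, fun Y u => by simp [join_odd]⟩
      (V' := fun _ => X) (fun j => by simp)
    swap
    · rcases j with _ | j
      · simp [Reading.setPos, join_even]
      · simp [Reading.setPos, join]
    rw [← hs] at h1 h2
    simp only [zero_add] at h1
    change _ ↔ IsWitness (weave X (listed _ _ X)) _ _
    rw [h1, isWitness_weave_listed (Reading.isLocal_check _)]
    simp only [iff_true] at h2
    exact h2

-- Definability of witnesses in second order arithmetic.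

/-! ### Renaming of variables -/

/-- Renaming of the variables of a term. -/
def ArTerm.rename {k k' : ℕ} (σ : Fin k → Fin k') : ArTerm k → ArTerm k'
  | .var i => .var (σ i)
  | .zero => .zero
  | .one => .one
  | .add s t => .add (s.rename σ) (t.rename σ)
  | .mul s t => .mul (s.rename σ) (t.rename σ)

theorem ArTerm.val_rename {k k' : ℕ} (σ : Fin k → Fin k') (v : Fin k' → ℕ) (t : ArTerm k) :
    (t.rename σ).val v = t.val fun i => v (σ i) := by
  induction t <;> simp_all [ArTerm.rename, ArTerm.val]

theorem ArTerm.code_rename {k k' : ℕ} {σ : Fin k → Fin k'} (hσ : ∀ i, (σ i : ℕ) = i)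
    (t : ArTerm k) : (t.rename σ).code = t.code := by
  induction t <;> simp_all [ArTerm.rename, ArTerm.code]

/-- The renaming of the variables below a quantifier. -/
def liftVar {k k' : ℕ} (σ : Fin k → Fin k') : Fin (k + 1) → Fin (k' + 1) :=
  Fin.cases 0 fun i => (σ i).succ

theorem cons_liftVar {α : Type*} {k k' : ℕ} (σ : Fin k → Fin k') (a : α) (v : Fin k' → α) :
    (fun i => (Fin.cons a v : Fin (k' + 1) → α) (liftVar σ i)) =
      (Fin.cons a fun i => v (σ i) : Fin (k + 1) → α) := by
  funext i
  refine Fin.cases rfl (fun i => ?_) i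
  simp [liftVar]

theorem liftVar_val {k k' : ℕ} {σ : Fin k → Fin k'} (hσ : ∀ i, (σ i : ℕ) = i) (i : Fin (k + 1)) :
    (liftVar σ i : ℕ) = i := by
  refine Fin.cases rfl (fun i => ?_) i
  simp [liftVar, hσ]

namespace SOFormula

/-- Renaming of the free variables of a formula. -/
def rename : {k m k' m' : ℕ} → (Fin k → Fin k') → (Fin m → Fin m') → SOFormula k m →
    SOFormula k' m'
  | _, _, _, _, σ, _, .eq s t => .eq (s.rename σ) (t.rename σ)
  | _, _, _, _, σ, _, .lt s t => .lt (s.rename σ) (t.rename σ)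
  | _, _, _, _, σ, τ, .mem t j => .mem (t.rename σ) (τ j)
  | _, _, _, _, σ, τ, .neg φ => .neg (φ.rename σ τ)
  | _, _, _, _, σ, τ, .and φ ψ => .and (φ.rename σ τ) (ψ.rename σ τ)
  | _, _, _, _, σ, τ, .or φ ψ => .or (φ.rename σ τ) (ψ.rename σ τ)
  | _, _, _, _, σ, τ, .imp φ ψ => .imp (φ.rename σ τ) (ψ.rename σ τ)
  | _, _, _, _, σ, τ, .ex φ => .ex (φ.rename (liftVar σ) τ)
  | _, _, _, _, σ, τ, .all φ => .all (φ.rename (liftVar σ) τ)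
  | _, _, _, _, σ, τ, .exSet φ => .exSet (φ.rename σ (liftVar τ))
  | _, _, _, _, σ, τ, .allSet φ => .allSet (φ.rename σ (liftVar τ))

theorem holds_rename {k m k' m' : ℕ} (σ : Fin k → Fin k') (τ : Fin m → Fin m')
    (φ : SOFormula k m) (v : Fin k' → ℕ) (V : Fin m' → ℕ → Bool) :
    (φ.rename σ τ).Holds v V ↔ φ.Holds (fun i => v (σ i)) (fun j => V (τ j)) := by
  induction φ generalizing k' m' <;>
    simp_all [rename, Holds, ArTerm.val_rename, cons_liftVar]

theorem code_rename {k m k' m' : ℕ} {σ : Fin k → Fin k'} {τ : Fin m → Fin m'}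
    (hσ : ∀ i, (σ i : ℕ) = i) (hτ : ∀ i, (τ i : ℕ) = i) (φ : SOFormula k m) :
    (φ.rename σ τ).code = φ.code := by
  induction φ generalizing k' m' <;>
    simp_all [rename, code, ArTerm.code_rename, liftVar_val]

end SOFormula

/-! ### Definable relations -/

/-- The relation is definable by a formula of second order arithmetic. -/
def Definable {k m : ℕ} (P : (Fin k → ℕ) → (Fin m → ℕ → Bool) → Prop) : Prop :=
  ∃ φ : SOFormula k m, ∀ v V, φ.Holds v V ↔ P v V

namespace Definable

variable {k m : ℕ} {P Q : (Fin k → ℕ) → (Fin m → ℕ → Bool) → Prop}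

theorem of_iff (h : Definable P) (hPQ : ∀ v V, Q v V ↔ P v V) : Definable Q :=
  h.imp fun _ hφ v V => (hφ v V).trans (hPQ v V).symm

protected theorem not (h : Definable P) : Definable fun v V => ¬ P v V :=
  let ⟨φ, hφ⟩ := h; ⟨.neg φ, fun v V => not_congr (hφ v V)⟩

protected theorem and (h : Definable P) (h' : Definable Q) : Definable fun v V => P v V ∧ Q v V :=
  let ⟨φ, hφ⟩ := h; let ⟨ψ, hψ⟩ := h'; ⟨.and φ ψ, fun v V => and_congr (hφ v V) (hψ v V)⟩

protected theorem or (h : Definable P) (h' : Definable Q) : Definable fun v V => P v V ∨ Q v V :=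
  let ⟨φ, hφ⟩ := h; let ⟨ψ, hψ⟩ := h'; ⟨.or φ ψ, fun v V => or_congr (hφ v V) (hψ v V)⟩

protected theorem imp (h : Definable P) (h' : Definable Q) : Definable fun v V => P v V → Q v V :=
  let ⟨φ, hφ⟩ := h; let ⟨ψ, hψ⟩ := h'; ⟨.imp φ ψ, fun v V => imp_congr (hφ v V) (hψ v V)⟩

protected theorem iff (h : Definable P) (h' : Definable Q) :
    Definable fun v V => (P v V ↔ Q v V) :=
  ((h.imp h').and (h'.imp h)).of_iff fun _ _ => iff_iff_implies_and_implies

protected theorem ex {R : ℕ → (Fin k → ℕ) → (Fin m → ℕ → Bool) → Prop}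
    (h : Definable fun (w : Fin (k + 1) → ℕ) V => R (w 0) (Fin.tail w) V) :
    Definable fun v V => ∃ n, R n v V :=
  let ⟨φ, hφ⟩ := h
  ⟨.ex φ, fun _ _ => exists_congr fun _ => by simp only [hφ, Fin.cons_zero, Fin.tail_cons]⟩

protected theorem all {R : ℕ → (Fin k → ℕ) → (Fin m → ℕ → Bool) → Prop}
    (h : Definable fun (w : Fin (k + 1) → ℕ) V => R (w 0) (Fin.tail w) V) :
    Definable fun v V => ∀ n, R n v V :=
  let ⟨φ, hφ⟩ := h
  ⟨.all φ, fun _ _ => forall_congr' fun _ => by simp only [hφ, Fin.cons_zero, Fin.tail_cons]⟩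

protected theorem allSet {R : (ℕ → Bool) → (Fin k → ℕ) → (Fin m → ℕ → Bool) → Prop}
    (h : Definable fun v (W : Fin (m + 1) → ℕ → Bool) => R (W 0) v (Fin.tail W)) :
    Definable fun v V => ∀ X, R X v V :=
  let ⟨φ, hφ⟩ := h
  ⟨.allSet φ, fun _ _ => forall_congr' fun _ => by simp only [hφ, Fin.cons_zero, Fin.tail_cons]⟩

protected theorem rename {k' m' : ℕ} (h : Definable P) (σ : Fin k → Fin k') (τ : Fin m → Fin m') :
    Definable fun v V => P (fun i => v (σ i)) (fun j => V (τ j)) :=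
  let ⟨φ, hφ⟩ := h; ⟨φ.rename σ τ, fun v V => by rw [φ.holds_rename, hφ]⟩

end Definable

/-- The function is definable. -/
def DefFn {k m : ℕ} (f : (Fin k → ℕ) → (Fin m → ℕ → Bool) → ℕ) : Prop :=
  Definable fun (w : Fin (k + 1) → ℕ) V => w 0 = f (Fin.tail w) V

/-- The function selects one of the set variables. -/
def IsSetVar {m : ℕ} (S : (Fin m → ℕ → Bool) → ℕ → Bool) : Prop := ∃ j, ∀ V, S V = V j

namespace IsSetVar

variable {m : ℕ}

theorem var (j : Fin m) : IsSetVar fun V => V j := ⟨j, fun _ => rfl⟩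

theorem tail {S : (Fin m → ℕ → Bool) → ℕ → Bool} (h : IsSetVar S) :
    IsSetVar fun W : Fin (m + 1) → ℕ → Bool => S (Fin.tail W) :=
  let ⟨j, hj⟩ := h; ⟨j.succ, fun _ => hj _⟩

end IsSetVar

namespace DefFn

variable {k m : ℕ} {f g : (Fin k → ℕ) → (Fin m → ℕ → Bool) → ℕ}

theorem tail (h : DefFn f) : DefFn fun (w : Fin (k + 1) → ℕ) V => f (Fin.tail w) V := by
  refine (Definable.rename h (Fin.cases 0 fun i => i.succ.succ) id).of_iff fun w V => ?_
  exact Iff.rfl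

theorem tailSet (h : DefFn f) : DefFn fun v (W : Fin (m + 1) → ℕ → Bool) => f v (Fin.tail W) :=
  Definable.rename h id Fin.succ

theorem var (i : Fin k) : DefFn fun (v : Fin k → ℕ) (_ : Fin m → ℕ → Bool) => v i :=
  ⟨.eq (.var 0) (.var i.succ), fun _ _ => Iff.rfl⟩

theorem zero : DefFn fun (_ : Fin k → ℕ) (_ : Fin m → ℕ → Bool) => 0 :=
  ⟨.eq (.var 0) .zero, fun _ _ => Iff.rfl⟩

theorem one : DefFn fun (_ : Fin k → ℕ) (_ : Fin m → ℕ → Bool) => 1 :=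
  ⟨.eq (.var 0) .one, fun _ _ => Iff.rfl⟩

/-- Substitution of a definable function. -/
theorem subst {R : ℕ → (Fin k → ℕ) → (Fin m → ℕ → Bool) → Prop} (hf : DefFn f)
    (h : Definable fun (w : Fin (k + 1) → ℕ) V => R (w 0) (Fin.tail w) V) :
    Definable fun v V => R (f v V) v V :=
  (Definable.ex (R := fun n v V => n = f v V ∧ R n v V) (Definable.and hf h)).of_iff
    fun v V => by simp

/-- Substitution of two definable functions. -/
theorem subst₂ {R : ℕ → ℕ → (Fin m → ℕ → Bool) → Prop} (hf : DefFn f) (hg : DefFn g)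
    (h : Definable fun (w : Fin 2 → ℕ) V => R (w 0) (w 1) V) :
    Definable fun v V => R (f v V) (g v V) V :=
  hf.subst (R := fun a v V => R a (g v V) V) <|
    -- The second argument enters at index `0` and shifts the first to index `1`, hence the
    -- transposition.
    hg.tail.subst (R := fun b w V => R (w 0) b V) <| h.rename ![1, 0] id

theorem comp₂ {F : ℕ → ℕ → ℕ} (hf : DefFn f) (hg : DefFn g)
    (h : Definable fun (w : Fin 3 → ℕ) (_ : Fin m → ℕ → Bool) => w 0 = F (w 1) (w 2)) :
    DefFn fun v V => F (f v V) (g v V) :=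
  hf.tail.subst (R := fun a w V => w 0 = F a (g (Fin.tail w) V)) <|
    hg.tail.tail.subst (R := fun b w _ => w 1 = F (w 0) b) <| h.rename ![2, 1, 0] id

end DefFn

namespace Definable

variable {k m : ℕ} {f g : (Fin k → ℕ) → (Fin m → ℕ → Bool) → ℕ}

protected theorem eq (hf : DefFn f) (hg : DefFn g) : Definable fun v V => f v V = g v V :=
  hf.subst₂ hg (R := fun a b _ => a = b) ⟨.eq (.var 0) (.var 1), fun _ _ => Iff.rfl⟩

protected theorem lt (hf : DefFn f) (hg : DefFn g) : Definable fun v V => f v V < g v V :=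
  hf.subst₂ hg (R := fun a b _ => a < b) ⟨.lt (.var 0) (.var 1), fun _ _ => Iff.rfl⟩

protected theorem mem {S : (Fin m → ℕ → Bool) → ℕ → Bool} (hS : IsSetVar S) (hf : DefFn f) :
    Definable fun v V => S V (f v V) = true :=
  let ⟨j, hj⟩ := hS
  hf.subst (R := fun a _ V => S V a = true)
    ⟨.mem (.var 0) j, fun _ _ => by simp [SOFormula.Holds, ArTerm.val, hj]⟩

end Definable

namespace DefFn

variable {k m : ℕ} {f g : (Fin k → ℕ) → (Fin m → ℕ → Bool) → ℕ}

protected theorem add (hf : DefFn f) (hg : DefFn g) : DefFn fun v V => f v V + g v V :=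
  hf.comp₂ hg (F := (· + ·)) ⟨.eq (.var 0) (.add (.var 1) (.var 2)), fun _ _ => Iff.rfl⟩

protected theorem mul (hf : DefFn f) (hg : DefFn g) : DefFn fun v V => f v V * g v V :=
  hf.comp₂ hg (F := (· * ·)) ⟨.eq (.var 0) (.mul (.var 1) (.var 2)), fun _ _ => Iff.rfl⟩

theorem succ (hf : DefFn f) : DefFn fun v V => Nat.succ (f v V) := hf.add one

theorem double (hf : DefFn f) : DefFn fun v V => 2 * f v V :=
  (DefFn.mul (one.add one) hf)

protected theorem pair (hf : DefFn f) (hg : DefFn g) :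
    DefFn fun v V => Nat.pair (f v V) (g v V) := by
  refine hf.comp₂ hg (F := Nat.pair) ?_
  refine Definable.of_iff (P := fun w _ => (w 1 < w 2 ∧ w 0 = w 2 * w 2 + w 1) ∨
    (¬ w 1 < w 2 ∧ w 0 = w 1 * w 1 + w 1 + w 2)) ?_ fun w V => ?_
  · exact ((Definable.lt (var _) (var _)).and (.eq (var _) (((var _).mul (var _)).add (var _)))).or
      ((Definable.lt (var _) (var _)).not.and
        (.eq (var _) ((((var _).mul (var _)).add (var _)).add (var _))))
  · by_cases h : w 1 < w 2 <;> simp [Nat.pair, h]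

theorem toNat {S : (Fin m → ℕ → Bool) → ℕ → Bool} (hS : IsSetVar S) (hf : DefFn f) :
    DefFn fun v V => (S V (f v V)).toNat := by
  refine Definable.of_iff (P := fun w V => (S V (f (Fin.tail w) V) = true ∧ w 0 = 1) ∨
    (¬ S V (f (Fin.tail w) V) = true ∧ w 0 = 0)) ?_ fun w V => ?_
  · exact ((Definable.mem hS hf.tail).and (.eq (var _) one)).or
      ((Definable.mem hS hf.tail).not.and (.eq (var _) zero))
  · cases h : S V (f (Fin.tail w) V) <;> simp [h]

end DefFn

/-! ### Partial recursive functions are definable -/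

namespace Nat.Partrec.Code

/-- For fixed `a`, the graph is the least set that contains the initial values and is closed under
the recursion step. Quantifying over all such sets avoids any coding of finite computations. -/
theorem mem_eval_prec_iff (cf cg : Code) (a n y : ℕ) : y ∈ eval (prec cf cg) (Nat.pair a n) ↔
    ∀ Z : ℕ → Bool, (∀ i, i ∈ eval cf a → Z (Nat.pair 0 i) = true) →
      (∀ j i, Z (Nat.pair j i) = true → ∀ i', i' ∈ eval cg (Nat.pair a (Nat.pair j i)) →
        Z (Nat.pair (j + 1) i') = true) → Z (Nat.pair n y) = true := by
  constructor
  · intro h Z h0 h1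
    induction n generalizing y with
    | zero => rw [eval_prec_zero] at h; exact h0 y h
    | succ n ih =>
      rw [eval_prec_succ] at h
      obtain ⟨i, hi, hy⟩ := Part.mem_bind_iff.1 h
      exact h1 n i (ih i hi) y hy
  · intro h
    classical
    have := h (fun q => decide (q.unpair.2 ∈ eval (prec cf cg) (Nat.pair a q.unpair.1)))
      (fun i hi => by simpa [eval_prec_zero] using hi)
      (fun j i hj i' hi' => by
        simp only [Nat.unpair_pair, decide_eq_true_eq] at hj ⊢
        rw [eval_prec_succ]
        exact Part.mem_bind_iff.2 ⟨i, hj, hi'⟩)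
    simpa using this

/-- The search starts at `b` and returns the place where it stops, so the result is `b` plus the
number of unsuccessful trials. -/
theorem mem_eval_rfind'_iff (cf : Code) (a b y : ℕ) : y ∈ eval (rfind' cf) (Nat.pair a b) ↔
    ∃ n, y = n + b ∧ 0 ∈ eval cf (Nat.pair a y) ∧
      ∀ j, j < n → ∃ i, i + 1 ∈ eval cf (Nat.pair a (j + b)) := by
  simp only [eval, Nat.unpaired, Nat.unpair_pair, Part.mem_map_iff]
  constructor
  · rintro ⟨n, h, rfl⟩
    obtain ⟨h1, h2⟩ := Nat.mem_rfind.1 h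
    refine ⟨n, rfl, by simpa using h1, fun j hj => ?_⟩
    obtain ⟨i, hi, h⟩ := (Part.mem_map_iff _).1 (h2 hj)
    rcases i with _ | i
    · simp at h
    · exact ⟨i, hi⟩
  · rintro ⟨n, rfl, h1, h2⟩
    refine ⟨n, Nat.mem_rfind.2 ⟨by simpa using h1, fun {j} hj => ?_⟩, rfl⟩
    obtain ⟨i, hi⟩ := h2 j hj
    exact (Part.mem_map_iff _).2 ⟨i + 1, hi, by simp⟩

end Nat.Partrec.Code

open Nat.Partrec (Code) in
theorem Definable.eval (c : Code) {k m : ℕ} {f g : (Fin k → ℕ) → (Fin m → ℕ → Bool) → ℕ}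
    (hf : DefFn f) (hg : DefFn g) : Definable fun v V => g v V ∈ c.eval (f v V) := by
  induction c generalizing k m with
  | zero => exact (Definable.eq hg .zero).of_iff fun v V => by simp [Code.eval, pure, PFun.pure]
  | succ => exact (Definable.eq hg hf.succ).of_iff fun v V => by simp [Code.eval]
  | left =>
    refine (Definable.ex (R := fun b v V => f v V = Nat.pair (g v V) b)
      (.eq hf.tail (hg.tail.pair (.var _)))).of_iff fun v V => ?_
    simp only [Code.eval, PFun.coe_val, Part.mem_some_iff]
    exact ⟨fun h => ⟨(f v V).unpair.2, by rw [h, Nat.pair_unpair]⟩, fun ⟨b, h⟩ => by simp [h]⟩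
  | right =>
    refine (Definable.ex (R := fun b v V => f v V = Nat.pair b (g v V))
      (.eq hf.tail (.pair (.var _) hg.tail))).of_iff fun v V => ?_
    simp only [Code.eval, PFun.coe_val, Part.mem_some_iff]
    exact ⟨fun h => ⟨(f v V).unpair.1, by rw [h, Nat.pair_unpair]⟩, fun ⟨b, h⟩ => by simp [h]⟩
  | pair cf cg ihf ihg =>
    refine (Definable.ex (R := fun a v V => ∃ b, a ∈ cf.eval (f v V) ∧ b ∈ cg.eval (f v V) ∧
      g v V = Nat.pair a b) (.ex (.and (ihf hf.tail.tail (.var _)) (.and (ihg hf.tail.tail (.var _))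
      (.eq hg.tail.tail (.pair (.var _) (.var _))))))).of_iff fun v V => ?_
    simp only [Code.eval, Seq.seq, Part.map_eq_map, Part.mem_bind_iff, Part.mem_map_iff]
    constructor
    · rintro ⟨_, ⟨a, ha, rfl⟩, b, hb, h⟩
      exact ⟨a, b, ha, hb, h.symm⟩
    · rintro ⟨a, b, ha, hb, h⟩
      exact ⟨_, ⟨a, ha, rfl⟩, b, hb, h.symm⟩
  | comp cf cg ihf ihg =>
    refine (Definable.ex (R := fun a v V => a ∈ cg.eval (f v V) ∧ g v V ∈ cf.eval a)
      (.and (ihg hf.tail (.var _)) (ihf (.var _) hg.tail))).of_iff fun v V => ?_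
    exact Part.mem_bind_iff
  | prec cf cg ihf ihg =>
    refine (Definable.ex (R := fun a v V => ∃ n, f v V = Nat.pair a n ∧
      ∀ Z : ℕ → Bool, (∀ i, i ∈ cf.eval a → Z (Nat.pair 0 i) = true) →
      (∀ j i, Z (Nat.pair j i) = true → ∀ i', i' ∈ cg.eval (Nat.pair a (Nat.pair j i)) →
        Z (Nat.pair (j + 1) i') = true) → Z (Nat.pair n (g v V)) = true)
      (.ex (.and (.eq hf.tail.tail (.pair (.var _) (.var _))) (.allSet (.imp (.all (.imp
      (ihf (.var _) (.var _)) (.mem (.var _) (.pair .zero (.var _))))) (.imp (.all (.all (.imp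
      (.mem (.var _) (.pair (.var _) (.var _))) (.all (.imp (ihg (.pair (.var _) (.pair (.var _)
      (.var _))) (.var _)) (.mem (.var _) (.pair (.add (.var _) .one) (.var _))))))))
      (.mem (.var _) (.pair (.var _) hg.tail.tail.tailSet)))))))).of_iff fun v V => ?_
    simp only [← Code.mem_eval_prec_iff]
    exact ⟨fun h => ⟨_, _, (Nat.pair_unpair _).symm, by rwa [Nat.pair_unpair]⟩,
      fun ⟨a, n, h, h'⟩ => by rwa [h]⟩
  | rfind' cf ihf =>
    refine (Definable.ex (R := fun a v V => ∃ b, f v V = Nat.pair a b ∧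
      ∃ n, g v V = n + b ∧ 0 ∈ cf.eval (Nat.pair a (g v V)) ∧
      ∀ j, j < n → ∃ i, i + 1 ∈ cf.eval (Nat.pair a (j + b)))
      (.ex (.and (.eq hf.tail.tail (.pair (.var _) (.var _))) (.ex (.and (.eq hg.tail.tail.tail
      (.add (.var _) (.var _))) (.and (ihf (.pair (.var _) hg.tail.tail.tail) .zero)
      (.all (.imp (.lt (.var _) (.var _)) (.ex (ihf (.pair (.var _) (.add (.var _) (.var _)))
      (.add (.var _) .one))))))))))).of_iff fun v V => ?_
    simp only [← Code.mem_eval_rfind'_iff]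
    exact ⟨fun h => ⟨_, _, (Nat.pair_unpair _).symm, by rwa [Nat.pair_unpair]⟩,
      fun ⟨a, n, h, h'⟩ => by rwa [h]⟩

/-! ### Definability of the syntactic notions for witnesses -/

section
variable {k m : ℕ} {f g h : (Fin k → ℕ) → (Fin m → ℕ → Bool) → ℕ}
  {S T U : (Fin m → ℕ → Bool) → ℕ → Bool}

theorem Definable.eval_of_partrec {F : ℕ →. ℕ} (hF : Nat.Partrec F) (hf : DefFn f)
    (hg : DefFn g) : Definable fun v V => g v V ∈ F (f v V) := by
  obtain ⟨c, rfl⟩ := Nat.Partrec.Code.exists_code.1 hF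
  exact .eval c hf hg

theorem Definable.of_primrecPred {p : ℕ → Prop} (hp : PrimrecPred p) (hf : DefFn f) :
    Definable fun v V => p (f v V) := by
  obtain ⟨_, hp⟩ := hp
  have h1 : Nat.Partrec ((fun n => (decide (p n)).toNat : ℕ → ℕ) : ℕ →. ℕ) :=
    Nat.Partrec.of_primrec (Primrec.nat_iff.1 ((Primrec.dom_bool Bool.toNat).comp hp))
  refine (Definable.eval_of_partrec h1 hf .one).of_iff fun v V => ?_
  by_cases hpf : p (f v V) <;> simp [hpf]

/-- Here the code is a variable, so the universal partial recursive function is used instead of a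
separate formula for each code. -/
theorem Definable.isCodeOf (hf : DefFn f) (hS : IsSetVar S) :
    Definable fun v V => IsCodeOf (f v V) (S V) := by
  have h1 : Partrec fun q : ℕ =>
      (Denumerable.ofNat Nat.Partrec.Code q.unpair.1).eval q.unpair.2 :=
    Nat.Partrec.Code.eval_part.comp
      ((Primrec.ofNat _).comp (by fun_prop : Primrec fun q : ℕ => q.unpair.1)).to_comp
      (by fun_prop : Primrec fun q : ℕ => q.unpair.2).to_comp
  refine (Definable.all (R := fun n v V => (S V n).toNat ∈
    (Denumerable.ofNat Nat.Partrec.Code (Nat.pair (f v V) n).unpair.1).eval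
      (Nat.pair (f v V) n).unpair.2) (.eval_of_partrec (Partrec.nat_iff.1 h1)
      (.pair hf.tail (.var _)) (.toNat hS (.var _)))).of_iff fun v V => ?_
  simp only [Nat.unpair_pair, IsCodeOf]
  exact forall_congr' fun n => Part.eq_some_iff

/-- The code of the list of the `n` digits of `X` from position `a` on. -/
def segmentCode (X : ℕ → Bool) : ℕ → ℕ → ℕ
  | _, 0 => 0
  | a, n + 1 => (Nat.pair (X a).toNat (segmentCode X (a + 1) n)).succ

theorem segmentCode_eq (X : ℕ → Bool) (a n : ℕ) :
    segmentCode X a n = Encodable.encode ((List.range' a n).map X) := by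
  induction n generalizing a with
  | zero => rfl
  | succ n ih =>
    simp only [segmentCode, ih, List.range'_succ, List.map_cons, Encodable.encode_list_cons]
    cases X a <;> rfl

/-- The closure device again, run from the end of the segment backwards because list codes are built
up from the tail: `Nat.pair a s` records that `s` codes the digits from `a` up to `t`. -/
theorem eq_encode_initSeg_iff (X : ℕ → Bool) (t c : ℕ) : c = Encodable.encode (initSeg X t) ↔
    ∀ Z : ℕ → Bool, Z (Nat.pair t 0) = true → (∀ a s, Z (Nat.pair (a + 1) s) = true →
      Z (Nat.pair a (Nat.pair (X a).toNat s).succ) = true) → Z (Nat.pair 0 c) = true := by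
  have hseg : Encodable.encode (initSeg X t) = segmentCode X 0 t := by
    rw [segmentCode_eq, initSeg, List.range_eq_range']
  rw [hseg]
  constructor
  · rintro rfl Z h0 h1
    have key : ∀ n a, a + n = t → Z (Nat.pair a (segmentCode X a n)) = true := by
      intro n
      induction n with
      | zero => rintro a rfl; exact h0
      | succ n ih => intro a ha; exact h1 _ _ (ih (a + 1) (by omega))
    exact key t 0 (by omega)
  · intro hZ
    classical
    have := hZ (fun q => decide (∃ a n, a + n = t ∧ q = Nat.pair a (segmentCode X a n)))
      (by simp only [decide_eq_true_eq]; exact ⟨t, 0, rfl, rfl⟩) (by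
        simp only [decide_eq_true_eq]
        rintro a s ⟨a', n, hn, h⟩
        obtain ⟨rfl, rfl⟩ := Nat.pair_eq_pair.1 h
        exact ⟨a, n + 1, by omega, rfl⟩)
    simp only [decide_eq_true_eq] at this
    obtain ⟨a, n, hn, h⟩ := this
    obtain ⟨rfl, rfl⟩ := Nat.pair_eq_pair.1 h
    rw [← hn, zero_add]

theorem Definable.eq_encode_initSeg (hS : IsSetVar S) (hf : DefFn f) (hg : DefFn g) :
    Definable fun v V => g v V = Encodable.encode (initSeg (S V) (f v V)) := by
  refine Definable.of_iff ?_ fun v V => eq_encode_initSeg_iff _ _ _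
  exact .allSet (.imp (.mem (.var _) (.pair hf.tailSet .zero)) (.imp (.all (.all (.imp
    (.mem (.var _) (.pair (.add (.var _) .one) (.var _))) (.mem (.var _) (.pair (.var _)
    (.succ (.pair (.toNat hS.tail (.var _)) (.var _))))))))
    (.mem (.var _) (.pair .zero hg.tailSet))))

/-- The pair with code `p` is the one with code `q` with `n` added to the input. -/
def NumStep (n q p : ℕ) : Prop :=
  ∃ i o, q = Nat.pair i o ∧ p = Nat.pair (Nat.pair (2 * n) i).succ o

/-- The pair with code `p` is the one with code `q` with the string with code `s` added to the
input. -/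
def StrStep (s q p : ℕ) : Prop :=
  ∃ i o, q = Nat.pair i o ∧ p = Nat.pair (Nat.pair (2 * s + 1) i).succ o

/-- The pair with code `p` is the one with code `q` with `n` added to the output. -/
def OutStep (n q p : ℕ) : Prop :=
  ∃ i o, q = Nat.pair i o ∧ p = Nat.pair i (Nat.pair n o).succ

/-- The codes `p` and `q` are equal and are that of a pair with empty output. -/
def NoOutput (q p : ℕ) : Prop := q = p ∧ ∃ i, p = Nat.pair i 0

open Encodable

/-- Numbers and strings among the input items are told apart by the parity of their codes. -/
theorem numStep_encode {n q : ℕ} {p : IOPair} :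
    NumStep n q (encode p) ↔ ∃ r : IOPair, q = encode r ∧ p = (.inl n :: r.1, r.2) := by
  constructor
  · rintro ⟨i, o, rfl, h⟩
    obtain ⟨_ | ⟨a | a, i'⟩, o'⟩ := p
    · simp [encode_prod_val, Nat.pair_eq_pair] at h
    · simp only [encode_prod_val, encode_list_cons, Nat.pair_eq_pair, Nat.succ_inj,
        encode_inl, encode_nat] at h
      obtain ⟨⟨h1, rfl⟩, rfl⟩ := h
      exact ⟨(i', o'), rfl, by simp; omega⟩
    · simp only [encode_prod_val, encode_list_cons, Nat.pair_eq_pair, Nat.succ_inj,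
        encode_inr] at h
      omega
  · rintro ⟨r, rfl, rfl⟩
    exact ⟨_, _, rfl, by simp [encode_prod_val]⟩

theorem strStep_encode {s q : ℕ} {p : IOPair} : StrStep s q (encode p) ↔
    ∃ (l : List Bool) (r : IOPair), s = encode l ∧ q = encode r ∧ p = (.inr l :: r.1, r.2) := by
  constructor
  · rintro ⟨i, o, rfl, h⟩
    obtain ⟨_ | ⟨a | a, i'⟩, o'⟩ := p
    · simp [encode_prod_val, Nat.pair_eq_pair] at h
    · simp only [encode_prod_val, encode_list_cons, Nat.pair_eq_pair, Nat.succ_inj,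
        encode_inl, encode_nat] at h
      omega
    · simp only [encode_prod_val, encode_list_cons, Nat.pair_eq_pair, Nat.succ_inj,
        encode_inr] at h
      obtain ⟨⟨h1, rfl⟩, rfl⟩ := h
      exact ⟨a, (i', o'), by omega, rfl, rfl⟩
  · rintro ⟨l, r, rfl, rfl, rfl⟩
    exact ⟨_, _, rfl, by simp [encode_prod_val]⟩

theorem outStep_encode {n q : ℕ} {p : IOPair} :
    OutStep n q (encode p) ↔ ∃ r : IOPair, q = encode r ∧ p = (r.1, n :: r.2) := by
  constructor
  · rintro ⟨i, o, rfl, h⟩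
    obtain ⟨i', _ | ⟨a, o'⟩⟩ := p
    · simp [encode_prod_val, Nat.pair_eq_pair] at h
    · simp only [encode_prod_val, encode_list_cons, Nat.pair_eq_pair, Nat.succ_inj,
        encode_nat] at h
      obtain ⟨rfl, rfl, rfl⟩ := h
      exact ⟨(i', o'), rfl, rfl⟩
  · rintro ⟨r, rfl, rfl⟩
    exact ⟨_, _, rfl, by simp [encode_prod_val]⟩

theorem noOutput_encode {q : ℕ} {p : IOPair} :
    NoOutput q (encode p) ↔ q = encode p ∧ p.2 = [] := by
  refine and_congr_right fun _ => ⟨?_, fun h => ⟨encode p.1, by rw [encode_prod_val, h]; rfl⟩⟩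
  rintro ⟨i, h⟩
  obtain ⟨i', _ | ⟨a, o'⟩⟩ := p
  · rfl
  · simp [encode_prod_val, Nat.pair_eq_pair] at h

theorem Definable.numStep (hf : DefFn f) (hg : DefFn g) (hh : DefFn h) :
    Definable fun v V => NumStep (f v V) (g v V) (h v V) :=
  .ex (.ex (.and (.eq hg.tail.tail (.pair (.var _) (.var _))) (.eq hh.tail.tail (.pair (.succ
    (.pair (.double hf.tail.tail) (.var _))) (.var _)))))

theorem Definable.strStep (hf : DefFn f) (hg : DefFn g) (hh : DefFn h) :
    Definable fun v V => StrStep (f v V) (g v V) (h v V) :=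
  .ex (.ex (.and (.eq hg.tail.tail (.pair (.var _) (.var _))) (.eq hh.tail.tail (.pair (.succ
    (.pair (.add (.double hf.tail.tail) .one) (.var _))) (.var _)))))

theorem Definable.outStep (hf : DefFn f) (hg : DefFn g) (hh : DefFn h) :
    Definable fun v V => OutStep (f v V) (g v V) (h v V) :=
  .ex (.ex (.and (.eq hg.tail.tail (.pair (.var _) (.var _))) (.eq hh.tail.tail (.pair (.var _)
    (.succ (.pair hf.tail.tail (.var _)))))))

theorem Definable.noOutput (hf : DefFn f) (hg : DefFn g) :
    Definable fun v V => NoOutput (f v V) (g v V) :=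
  .and (.eq hf hg) (.ex (.eq hg.tail (.pair (.var _) .zero)))

/-! ### Sets of pairs as sets of codes -/

open Classical in
/-- The characteristic function of the set of codes of the elements of a set of pairs. -/
noncomputable def codeSet (P : Set IOPair) (c : ℕ) : Bool := decide (∃ p ∈ P, encode p = c)

theorem codeSet_eq_true {P : Set IOPair} {c : ℕ} :
    codeSet P c = true ↔ ∃ p ∈ P, encode p = c := by simp [codeSet]

theorem eq_codeSet_iff {X : ℕ → Bool} {P : Set IOPair} :
    X = codeSet P ↔ ∀ c, (X c = true ↔ ∃ p ∈ P, encode p = c) := by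
  simp only [← codeSet_eq_true, ← Bool.eq_iff_iff, funext_iff]

/-- The number `c` is the code of a pair listed by `X`. -/
def ListsCode (X : ℕ → Bool) (c : ℕ) : Prop :=
  c ∈ Set.range (encode : IOPair → ℕ) ∧ ∃ a, (a = 0 ∨ ∃ b, a = b + 1 ∧ ¬ X b = true) ∧
    (∀ j, j < c + 1 → X (a + j) = true) ∧ ¬ X (a + (c + 1)) = true

/-- The range condition is necessary since codes of binary strings do not exhaust `ℕ`, so a block of
ones may have a length that codes no pair. -/
theorem listsCode_iff {X : ℕ → Bool} {c : ℕ} :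
    ListsCode X c ↔ ∃ p ∈ pairsOf X, encode p = c := by
  have key : ∀ p : IOPair, ListsCode X (encode p) ↔ p ∈ pairsOf X := by
    intro p
    simp only [ListsCode, Set.mem_range, exists_apply_eq_apply, true_and, pairsOf]
    refine exists_congr fun a => ?_
    simp only [Bool.not_eq_true, Nat.lt_succ_iff]
    refine and_congr_left fun _ => or_congr_right' fun ha => ⟨?_, fun h => ?_⟩
    · rintro ⟨b, rfl, h⟩; exact h
    · exact ⟨a - 1, by omega, h⟩
  constructor
  · rintro h
    obtain ⟨p, rfl⟩ := h.1
    exact ⟨p, (key p).1 h, rfl⟩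
  · rintro ⟨p, hp, rfl⟩
    exact (key p).2 hp

theorem Definable.listsCode (hS : IsSetVar S) (hf : DefFn f) :
    Definable fun v V => ListsCode (S V) (f v V) :=
  .and (.of_primrecPred Primcodable.mem_range_encode hf) (.ex (.and (.or (.eq (.var _) .zero)
    (.ex (.and (.eq (.var _) (.add (.var _) .one)) (.not (.mem hS (.var _)))))) (.and
    (.all (.imp (.lt (.var _) (.add hf.tail.tail .one)) (.mem hS (.add (.var _) (.var _)))))
    (.not (.mem hS (.add (.var _) (.add hf.tail .one)))))))

theorem Definable.eq_codeSet_pairsOf (hS : IsSetVar S) (hT : IsSetVar T) :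
    Definable fun (_ : Fin k → ℕ) V => S V = codeSet (pairsOf (T V)) := by
  refine Definable.of_iff (P := fun _ V => ∀ c, S V c = true ↔ ListsCode (T V) c) ?_
    fun v V => by simp only [eq_codeSet_iff, listsCode_iff]
  exact .all (.iff (.mem hS (.var _)) (.listsCode hT (.var _)))

theorem Definable.mem_afterNum (hS : IsSetVar S) (hT : IsSetVar T) (hf : DefFn f) :
    Definable fun v V => ∀ q, (S V q = true ↔ ∃ p, T V p = true ∧ NumStep (f v V) q p) :=
  .all (.iff (.mem hS (.var _)) (.ex (.and (.mem hT (.var _))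
    (.numStep hf.tail.tail (.var _) (.var _)))))

theorem eq_codeSet_afterNum {X : ℕ → Bool} {P : Set IOPair} {n : ℕ} :
    (∀ q, (X q = true ↔ ∃ p, codeSet P p = true ∧ NumStep n q p)) ↔
      X = codeSet (afterNum P n) := by
  rw [eq_codeSet_iff]
  refine forall_congr' fun q => iff_congr Iff.rfl ?_
  simp only [codeSet_eq_true]
  constructor
  · rintro ⟨_, ⟨p, hp, rfl⟩, h⟩
    obtain ⟨r, rfl, rfl⟩ := numStep_encode.1 h
    exact ⟨r, hp, rfl⟩
  · rintro ⟨r, hr, rfl⟩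
    exact ⟨_, ⟨_, hr, rfl⟩, numStep_encode.2 ⟨r, rfl, rfl⟩⟩

theorem Definable.mem_afterOut (hS : IsSetVar S) (hT : IsSetVar T) (hf : DefFn f) :
    Definable fun v V => (∃ q, S V q = true) ∧
      ∀ q, (S V q = true ↔ ∃ p, T V p = true ∧ OutStep (f v V) q p) :=
  .and (.ex (.mem hS (.var _))) (.all (.iff (.mem hS (.var _)) (.ex (.and (.mem hT (.var _))
    (.outStep hf.tail.tail (.var _) (.var _))))))

theorem eq_codeSet_afterOut {X : ℕ → Bool} {P : Set IOPair} {n : ℕ} :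
    ((∃ q, X q = true) ∧ ∀ q, (X q = true ↔ ∃ p, codeSet P p = true ∧ OutStep n q p)) ↔
      (afterOut P n).Nonempty ∧ X = codeSet (afterOut P n) := by
  have : (∀ q, (X q = true ↔ ∃ p, codeSet P p = true ∧ OutStep n q p)) ↔
      X = codeSet (afterOut P n) := by
    rw [eq_codeSet_iff]
    refine forall_congr' fun q => iff_congr Iff.rfl ?_
    simp only [codeSet_eq_true]
    constructor
    · rintro ⟨_, ⟨p, hp, rfl⟩, h⟩
      obtain ⟨r, rfl, rfl⟩ := outStep_encode.1 h
      exact ⟨r, hp, rfl⟩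
    · rintro ⟨r, hr, rfl⟩
      exact ⟨_, ⟨_, hr, rfl⟩, outStep_encode.2 ⟨r, rfl, rfl⟩⟩
  rw [this]
  refine and_congr_left ?_
  rintro rfl
  simp only [codeSet_eq_true]
  exact ⟨fun ⟨_, p, hp, _⟩ => ⟨p, hp⟩, fun ⟨p, hp⟩ => ⟨_, p, hp, rfl⟩⟩

theorem Definable.mem_afterSeq (hS : IsSetVar S) (hT : IsSetVar T) (hU : IsSetVar U) :
    Definable fun (_ : Fin k → ℕ) V => ∀ q, (S V q = true ↔ ∃ p, T V p = true ∧ ∃ s, StrStep s q p ∧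
      ∃ t, s = encode (initSeg (U V) t)) :=
  .all (.iff (.mem hS (.var _)) (.ex (.and (.mem hT (.var _)) (.ex (.and
    (.strStep (.var _) (.var _) (.var _)) (.ex (.eq_encode_initSeg hU (.var _) (.var _))))))))

theorem eq_codeSet_afterSeq {X Y : ℕ → Bool} {P : Set IOPair} :
    (∀ q, (X q = true ↔ ∃ p, codeSet P p = true ∧ ∃ s, StrStep s q p ∧
      ∃ t, s = encode (initSeg Y t))) ↔ X = codeSet (afterSeq P Y) := by
  rw [eq_codeSet_iff]
  refine forall_congr' fun q => iff_congr Iff.rfl ?_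
  simp only [codeSet_eq_true]
  constructor
  · rintro ⟨_, ⟨p, hp, rfl⟩, s, h, t, ht⟩
    obtain ⟨l, r, rfl, rfl, rfl⟩ := strStep_encode.1 h
    obtain rfl := encode_injective ht
    exact ⟨r, ⟨t, hp⟩, rfl⟩
  · rintro ⟨r, ⟨t, hr⟩, rfl⟩
    exact ⟨_, ⟨_, hr, rfl⟩, _, strStep_encode.2 ⟨_, r, rfl, rfl, rfl⟩, t, rfl⟩

/-- The strings with codes `s` and `t` are comparable. -/
def Comparable (s t : ℕ) : Prop :=
  ∃ X : ℕ → Bool, (∃ n, s = encode (initSeg X n)) ∧ ∃ n, t = encode (initSeg X n)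

theorem initSeg_pad (l : List Bool) : initSeg (pad l) l.length = l := by
  refine List.ext_getElem (by simp [initSeg]) fun i h1 h2 => ?_
  simp [initSeg, pad, h2]

/-- Initial segments of one sequence are comparable; conversely the longer string, padded by zeros,
is a common sequence. -/
theorem comparable_encode {s t : List Bool} :
    Comparable (encode s) (encode t) ↔ s <+: t ∨ t <+: s := by
  have hpre : ∀ (X : ℕ → Bool) {n n' : ℕ}, n ≤ n' → initSeg X n <+: initSeg X n' := by
    intro X n n' h
    obtain ⟨d, rfl⟩ := Nat.exists_eq_add_of_le h
    rw [initSeg, initSeg, List.range_add, List.map_append]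
    exact List.prefix_append _ _
  have hinit : ∀ {s t : List Bool}, s <+: t → initSeg (pad t) s.length = s := by
    rintro s _ ⟨r, rfl⟩
    refine List.ext_getElem (by simp [initSeg]) fun i h1 h2 => ?_
    simp [initSeg, pad, List.getElem?_append_left h2, h2]
  constructor
  · rintro ⟨X, ⟨n, hn⟩, n', hn'⟩
    obtain rfl := encode_injective hn
    obtain rfl := encode_injective hn'
    exact (le_total n n').imp (hpre X) (hpre X)
  · rintro (h | h)
    · exact ⟨pad t, ⟨_, by rw [hinit h]⟩, _, by rw [initSeg_pad]⟩
    · exact ⟨pad s, ⟨_, by rw [initSeg_pad]⟩, _, by rw [hinit h]⟩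

theorem Definable.comparable (hf : DefFn f) (hg : DefFn g) :
    Definable fun v V => Comparable (f v V) (g v V) := by
  refine Definable.of_iff (P := fun v V => ¬ ∀ X : ℕ → Bool,
    ¬ ((∃ n, f v V = encode (initSeg X n)) ∧ ∃ n, g v V = encode (initSeg X n))) ?_
    fun v V => by simp only [Comparable, not_forall, not_not]
  exact .not (.allSet (.not (.and (.ex (.eq_encode_initSeg (.var _) (.var _) hf.tailSet.tail))
    (.ex (.eq_encode_initSeg (.var _) (.var _) hg.tailSet.tail)))))

end

/-! ### Translation into second order arithmetic -/

/-- A formula that defines a definable relation. -/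
noncomputable def Definable.formula {k m : ℕ} {P : (Fin k → ℕ) → (Fin m → ℕ → Bool) → Prop}
    (h : Definable P) : SOFormula k m := h.choose

theorem Definable.holds_formula {k m : ℕ} {P : (Fin k → ℕ) → (Fin m → ℕ → Bool) → Prop}
    (h : Definable P) (v : Fin k → ℕ) (V : Fin m → ℕ → Bool) : h.formula.Holds v V ↔ P v V :=
  h.choose_spec v V

namespace SOFormula

/-- A formula as a formula with more variables. -/
def widen {k m k' m' : ℕ} (φ : SOFormula k m) (hk : k ≤ k' := by omega)
    (hm : m ≤ m' := by omega) : SOFormula k' m' := φ.rename (Fin.castLE hk) (Fin.castLE hm)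

theorem holds_widen {k m k' m' : ℕ} {φ : SOFormula k m} {hk : k ≤ k'} {hm : m ≤ m'}
    {v : Fin k' → ℕ} {V : Fin m' → ℕ → Bool} : (φ.widen hk hm).Holds v V ↔
      φ.Holds (fun i => v (Fin.castLE hk i)) (fun j => V (Fin.castLE hm j)) :=
  holds_rename _ _ _ _ _

/-- `Fin.castLE` keeps de Bruijn indices, and Gödel numbers record nothing else about variables.
Templates bind the variables of a component at the lowest indices, so components are inserted with
their Gödel numbers unchanged. -/
theorem code_widen {k m k' m' : ℕ} {φ : SOFormula k m} {hk : k ≤ k'} {hm : m ≤ m'} :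
    (φ.widen hk hm).code = φ.code :=
  code_rename (σ := Fin.castLE hk) (τ := Fin.castLE hm) (fun _ => rfl) (fun _ => rfl) _

/-- `∃ q, T (q, p) ∧ φ q`, as a formula in `p`. -/
def exStep (T : SOFormula 2 0) (φ : SOFormula 1 0) : SOFormula 1 0 := .ex (.and T φ.widen)

/-- `∀ q' p', T (p', q', p, q) → φ (p', q')`, as a formula in `p` and `q`. -/
def allStep (T : SOFormula 4 0) (φ : SOFormula 2 0) : SOFormula 2 0 :=
  .all (.all (.imp T φ.widen))

/-- `∃ Q, T (Q, …) ∧ φ Q`. -/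
def bindSet {k m : ℕ} (T : SOFormula k (m + 1)) (φ : SOFormula k 1) : SOFormula k m :=
  .exSet (.and T φ.widen)

theorem holds_widen_cons {k m : ℕ} {φ : SOFormula k 1} {v : Fin k → ℕ} {Q : ℕ → Bool}
    {V : Fin m → ℕ → Bool} :
    (φ.widen : SOFormula k (m + 1)).Holds v (Fin.cons Q V) ↔ φ.Holds v fun _ => Q := by
  rw [holds_widen, iff_iff_eq]
  congr 1
  funext j
  obtain rfl := Subsingleton.elim j 0
  rfl

/-- The template pins `Q` to a single set, so the set quantifier acts as a substitution. -/
theorem holds_bindSet {k m : ℕ} {T : SOFormula k (m + 1)} {φ : SOFormula k 1} {v : Fin k → ℕ}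
    {V : Fin m → ℕ → Bool} {c : Prop} {S : ℕ → Bool}
    (hT : ∀ Q, T.Holds v (Fin.cons Q V) ↔ c ∧ Q = S) :
    (bindSet T φ).Holds v V ↔ c ∧ φ.Holds v fun _ => S := by
  simp only [bindSet, Holds, holds_widen_cons, hT]
  constructor
  · rintro ⟨Q, ⟨hc, rfl⟩, h⟩
    exact ⟨hc, h⟩
  · rintro ⟨hc, h⟩
    exact ⟨S, ⟨hc, rfl⟩, h⟩

theorem holds_bindSet_of_eq {k m : ℕ} {T : SOFormula k (m + 1)} {φ : SOFormula k 1}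
    {v : Fin k → ℕ} {V : Fin m → ℕ → Bool} {S : ℕ → Bool}
    (hT : ∀ Q, T.Holds v (Fin.cons Q V) ↔ Q = S) :
    (bindSet T φ).Holds v V ↔ φ.Holds v fun _ => S := by
  simpa using holds_bindSet (c := True) (φ := φ) (S := S) (by simpa using hT)

end SOFormula

namespace BoxFormula

open SOFormula Encodable

/-! #### Formulas for the elementary steps -/

/-- `p` is the empty pair. -/
noncomputable def emptyPair : SOFormula 1 0 :=
  (Definable.eq (.var 0) .zero : Definable fun (v : Fin 1 → ℕ) (_ : Fin 0 → ℕ → Bool) =>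
    v 0 = 0).formula

/-- `p` has no input and at most one number of output. -/
noncomputable def boxPair : SOFormula 1 0 :=
  (.or (.eq (.var 0) .zero) (.ex (.outStep (.var _) .zero (.var _))) :
    Definable fun (v : Fin 1 → ℕ) (_ : Fin 0 → ℕ → Bool) =>
      v 0 = 0 ∨ ∃ n, OutStep n 0 (v 0)).formula

/-- `p` is `q` with the number `n` added to the input. -/
noncomputable def numPair (n : Bool) : SOFormula 2 0 :=
  (by cases n; exacts [.numStep .zero (.var _) (.var _), .numStep .one (.var _) (.var _)] :
    Definable fun (v : Fin 2 → ℕ) (_ : Fin 0 → ℕ → Bool) =>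
      NumStep n.toNat (v 0) (v 1)).formula

/-- `p` is `q` with some number added to the input. -/
noncomputable def anyNumPair : SOFormula 2 0 :=
  (.ex (.numStep (.var _) (.var _) (.var _)) :
    Definable fun (v : Fin 2 → ℕ) (_ : Fin 0 → ℕ → Bool) =>
      ∃ n, NumStep n (v 0) (v 1)).formula

/-- `p` is `q` with some string added to the input. -/
noncomputable def anyStrPair : SOFormula 2 0 :=
  (.ex (.strStep (.var _) (.var _) (.var _)) :
    Definable fun (v : Fin 2 → ℕ) (_ : Fin 0 → ℕ → Bool) =>
      ∃ n, StrStep n (v 0) (v 1)).formula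

/-- `p` is `q` with the number `n` added to the output, or both are equal and have no output. -/
noncomputable def outPair (n : Bool) : SOFormula 2 0 :=
  (by cases n; exacts [.or (.noOutput (.var _) (.var _)) (.outStep .zero (.var _) (.var _)),
      .or (.noOutput (.var _) (.var _)) (.outStep .one (.var _) (.var _))] :
    Definable fun (v : Fin 2 → ℕ) (_ : Fin 0 → ℕ → Bool) =>
      NoOutput (v 0) (v 1) ∨ OutStep n.toNat (v 0) (v 1)).formula

/-- `p` is `q` with some number added to the output, or both are equal and have no output. -/
noncomputable def anyOutPair : SOFormula 2 0 :=
  (.or (.noOutput (.var _) (.var _)) (.ex (.outStep (.var _) (.var _) (.var _))) :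
    Definable fun (v : Fin 2 → ℕ) (_ : Fin 0 → ℕ → Bool) =>
      NoOutput (v 0) (v 1) ∨ ∃ n, OutStep n (v 0) (v 1)).formula

/-- Always true. -/
noncomputable def truePairs : SOFormula 2 0 :=
  (.eq .zero .zero : Definable fun (_ : Fin 2 → ℕ) (_ : Fin 0 → ℕ → Bool) => 0 = 0).formula

/-- The first numbers of output of `p` and `q`, if any, are equal. -/
noncomputable def agreePairs : SOFormula 2 0 :=
  (.all (.all (.all (.all (.imp (.outStep (.var 3) (.var 1) (.var 4)) (.imp
    (.outStep (.var 2) (.var 0) (.var 5)) (.eq (.var 3) (.var 2))))))) :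
    Definable fun (v : Fin 2 → ℕ) (_ : Fin 0 → ℕ → Bool) =>
      ∀ n n' p' q', OutStep n p' (v 0) → OutStep n' q' (v 1) → n = n').formula

/-- `p` and `q` are `p'` and `q'` with the number `n` added to the input. -/
noncomputable def numPairs (n : Bool) : SOFormula 4 0 :=
  (by cases n; exacts [.and (.numStep .zero (.var _) (.var _)) (.numStep .zero (.var _) (.var _)),
      .and (.numStep .one (.var _) (.var _)) (.numStep .one (.var _) (.var _))] :
    Definable fun (v : Fin 4 → ℕ) (_ : Fin 0 → ℕ → Bool) =>
      NumStep n.toNat (v 0) (v 2) ∧ NumStep n.toNat (v 1) (v 3)).formula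

/-- `p` and `q` are `p'` and `q'` with the same number added to the input. -/
noncomputable def anyNumPairs : SOFormula 4 0 :=
  (.ex (.and (.numStep (.var _) (.var _) (.var _)) (.numStep (.var _) (.var _) (.var _))) :
    Definable fun (v : Fin 4 → ℕ) (_ : Fin 0 → ℕ → Bool) =>
      ∃ n, NumStep n (v 0) (v 2) ∧ NumStep n (v 1) (v 3)).formula

/-- `p` and `q` are `p'` and `q'` with comparable strings added to the input. -/
noncomputable def anyStrPairs : SOFormula 4 0 :=
  (.ex (.ex (.and (.strStep (.var _) (.var _) (.var _)) (.and
    (.strStep (.var _) (.var _) (.var _)) (.comparable (.var _) (.var _))))) :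
    Definable fun (v : Fin 4 → ℕ) (_ : Fin 0 → ℕ → Bool) =>
      ∃ s t, StrStep s (v 0) (v 2) ∧ StrStep t (v 1) (v 3) ∧ Comparable s t).formula

/-- `p` and `q` are `p'` and `q'` with the number `n` added to the output. -/
noncomputable def outPairs (n : Bool) : SOFormula 4 0 :=
  (by cases n; exacts [.and (.outStep .zero (.var _) (.var _)) (.outStep .zero (.var _) (.var _)),
      .and (.outStep .one (.var _) (.var _)) (.outStep .one (.var _) (.var _))] :
    Definable fun (v : Fin 4 → ℕ) (_ : Fin 0 → ℕ → Bool) =>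
      OutStep n.toNat (v 0) (v 2) ∧ OutStep n.toNat (v 1) (v 3)).formula

/-- `p` and `q` are `p'` and `q'` with the same number added to the output. -/
noncomputable def anyOutPairs : SOFormula 4 0 :=
  (.ex (.and (.outStep (.var _) (.var _) (.var _)) (.outStep (.var _) (.var _) (.var _))) :
    Definable fun (v : Fin 4 → ℕ) (_ : Fin 0 → ℕ → Bool) =>
      ∃ n, OutStep n (v 0) (v 2) ∧ OutStep n (v 1) (v 3)).formula

/-- `p` is listed by `X`. -/
noncomputable def listedPair : SOFormula 1 1 :=
  (.listsCode (.var _) (.var _) : Definable fun (v : Fin 1 → ℕ) (V : Fin 1 → ℕ → Bool) =>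
    ListsCode (V 0) (v 0)).formula

/-- `p` and `q` are listed by `X`. -/
noncomputable def listedPairs : SOFormula 2 1 :=
  (.and (.listsCode (.var _) (.var _)) (.listsCode (.var _) (.var _)) :
    Definable fun (v : Fin 2 → ℕ) (V : Fin 1 → ℕ → Bool) =>
      ListsCode (V 0) (v 0) ∧ ListsCode (V 0) (v 1)).formula

/-- `Q` is the set of pairs listed by `X`. -/
noncomputable def listedSet : SOFormula 0 2 :=
  (.eq_codeSet_pairsOf (.var 0) (.var 1) : Definable fun (_ : Fin 0 → ℕ) (V : Fin 2 → ℕ → Bool) =>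
    V 0 = codeSet (pairsOf (V 1))).formula

/-- `Q` consists of the pairs in `P` after input `n`. -/
noncomputable def numSet (n : Bool) : SOFormula 0 2 :=
  (by cases n; exacts [.mem_afterNum (.var 0) (.var 1) .zero,
      .mem_afterNum (.var 0) (.var 1) .one] :
    Definable fun (_ : Fin 0 → ℕ) (V : Fin 2 → ℕ → Bool) =>
      ∀ q, (V 0 q = true ↔ ∃ p, V 1 p = true ∧ NumStep n.toNat q p)).formula

/-- `Q` consists of the pairs in `P` after input `x`. -/
noncomputable def anyNumSet : SOFormula 1 2 :=
  (.mem_afterNum (.var 0) (.var 1) (.var 0) :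
    Definable fun (v : Fin 1 → ℕ) (V : Fin 2 → ℕ → Bool) =>
      ∀ q, (V 0 q = true ↔ ∃ p, V 1 p = true ∧ NumStep (v 0) q p)).formula

/-- `Q` consists of the pairs in `P` after output `n` and is not empty. -/
noncomputable def outSet (n : Bool) : SOFormula 0 2 :=
  (by cases n; exacts [.mem_afterOut (.var 0) (.var 1) .zero,
      .mem_afterOut (.var 0) (.var 1) .one] :
    Definable fun (_ : Fin 0 → ℕ) (V : Fin 2 → ℕ → Bool) => (∃ q, V 0 q = true) ∧
      ∀ q, (V 0 q = true ↔ ∃ p, V 1 p = true ∧ OutStep n.toNat q p)).formula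

/-- `Q` consists of the pairs in `P` after output `x` and is not empty. -/
noncomputable def anyOutSet : SOFormula 1 2 :=
  (.mem_afterOut (.var 0) (.var 1) (.var 0) :
    Definable fun (v : Fin 1 → ℕ) (V : Fin 2 → ℕ → Bool) => (∃ q, V 0 q = true) ∧
      ∀ q, (V 0 q = true ↔ ∃ p, V 1 p = true ∧ OutStep (v 0) q p)).formula

/-- `Q` consists of the pairs in `P` after an initial segment of `X`. -/
noncomputable def seqSet : SOFormula 0 3 :=
  (.mem_afterSeq (.var 0) (.var 2) (.var 1) :
    Definable fun (_ : Fin 0 → ℕ) (V : Fin 3 → ℕ → Bool) =>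
      ∀ q, (V 0 q = true ↔ ∃ p, V 2 p = true ∧ ∃ s, StrStep s q p ∧
        ∃ t, s = encode (initSeg (V 1) t))).formula

/-- Some code of `X` is the output of some pair in `P`. -/
noncomputable def codeOutput : SOFormula 0 2 :=
  (.ex (.and (.ex (.ex (.and (.mem (.var _) (.var 0)) (.outStep (.var _) (.var 1) (.var 0)))))
    (.isCodeOf (.var _) (.var _))) :
    Definable fun (_ : Fin 0 → ℕ) (V : Fin 2 → ℕ → Bool) =>
      ∃ e, (∃ q p, V 1 p = true ∧ OutStep e q p) ∧ IsCodeOf e (V 0)).formula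

/-- There is a code of `X`. -/
noncomputable def hasCode : SOFormula 0 1 :=
  (.ex (.isCodeOf (.var _) (.var _)) :
    Definable fun (_ : Fin 0 → ℕ) (V : Fin 1 → ℕ → Bool) => ∃ e, IsCodeOf e (V 0)).formula

/-! #### The translation -/

/-- The formula that defines the syntactic form of the pairs of a witness. -/
noncomputable def shapeFormula : {k : ℕ} → BoxFormula k → SOFormula 1 0
  | _, .eq _ _ => emptyPair
  | _, .lt _ _ => emptyPair
  | _, .neg _ => emptyPair
  | _, .and A B => .or emptyPair (.or (exStep (numPair false) A.shapeFormula)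
      (exStep (numPair true) B.shapeFormula))
  | _, .or A B => .or (exStep (outPair false) A.shapeFormula)
      (exStep (outPair true) B.shapeFormula)
  | _, .imp _ B => .or emptyPair (exStep anyStrPair B.shapeFormula)
  | _, .ex A => exStep anyOutPair A.shapeFormula
  | _, .all A => .or emptyPair (exStep anyNumPair A.shapeFormula)
  | _, .box _ => boxPair

/-- The formula that defines the compatibility of the pairs of a witness. -/
noncomputable def compatFormula : {k : ℕ} → BoxFormula k → SOFormula 2 0
  | _, .eq _ _ => truePairs
  | _, .lt _ _ => truePairs
  | _, .neg _ => truePairs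
  | _, .and A B => .and (allStep (numPairs false) A.compatFormula)
      (allStep (numPairs true) B.compatFormula)
  | _, .or A B => .and agreePairs (.and (allStep (outPairs false) A.compatFormula)
      (allStep (outPairs true) B.compatFormula))
  | _, .imp _ B => allStep anyStrPairs B.compatFormula
  | _, .ex A => .and agreePairs (allStep anyOutPairs A.compatFormula)
  | _, .all A => allStep anyNumPairs A.compatFormula
  | _, .box _ => agreePairs

/-- The formula that defines the well-formed candidate witnesses. -/
noncomputable def wellFormedFormula {k : ℕ} (A : BoxFormula k) : SOFormula 0 1 :=
  .and (.all (.imp listedPair A.shapeFormula.widen))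
    (.all (.all (.imp listedPairs A.compatFormula.widen)))

/-- The formula that defines the witnesses, for a given one that defines the semantic
requirements. -/
noncomputable def witnessFormula {k : ℕ} (A : BoxFormula k) (φ : SOFormula k 1) : SOFormula k 1 :=
  .and A.wellFormedFormula.widen (bindSet listedSet.widen φ)

/-- The formulas that define classical truth and the semantic requirements on a witness. -/
noncomputable def truthFormulas : {k : ℕ} → BoxFormula k → SOFormula k 0 × SOFormula k 1
  | _, .eq s t => (.eq s t, .eq s t)
  | _, .lt s t => (.lt s t, .lt s t)
  | _, .neg A => (.neg A.truthFormulas.1, .neg A.truthFormulas.1.widen)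
  | _, .and A B => (.and A.truthFormulas.1 B.truthFormulas.1,
      .and (bindSet (numSet false).widen A.truthFormulas.2)
        (bindSet (numSet true).widen B.truthFormulas.2))
  | _, .or A B => (.or A.truthFormulas.1 B.truthFormulas.1,
      .or (bindSet (outSet false).widen A.truthFormulas.2)
        (bindSet (outSet true).widen B.truthFormulas.2))
  | _, .imp A B => (.imp A.truthFormulas.1 B.truthFormulas.1,
      .allSet (.imp (A.witnessFormula A.truthFormulas.2).widen
        (bindSet seqSet.widen B.truthFormulas.2)))
  | _, .ex A => (.ex A.truthFormulas.1, .ex (bindSet anyOutSet.widen A.truthFormulas.2))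
  | _, .all A => (.all A.truthFormulas.1, .all (bindSet anyNumSet.widen A.truthFormulas.2))
  | _, .box A => (.exSet (.and hasCode.widen (A.witnessFormula A.truthFormulas.2)),
      .exSet (.and codeOutput.widen (A.witnessFormula A.truthFormulas.2).widen))

/-! #### Correctness of the translation -/

theorem encode_emptyPair : encode (([], []) : IOPair) = 0 := rfl

theorem encode_eq_zero {p : IOPair} : encode p = 0 ↔ p = ([], []) := by
  rw [← encode_emptyPair, encode_inj]

theorem holds_exStep {T : SOFormula 2 0} {φ : SOFormula 1 0} {p : IOPair} {V : Fin 0 → ℕ → Bool}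
    {R : IOPair → Prop} (hT : ∀ q, T.Holds ![q, encode p] V ↔ ∃ r, q = encode r ∧ R r) :
    (exStep T φ).Holds (fun _ => encode p) V ↔ ∃ r, R r ∧ φ.Holds (fun _ => encode r) V := by
  have h1 : ∀ q : ℕ, (Fin.cons q fun _ => encode p : Fin 2 → ℕ) = ![q, encode p] := fun q => by
    funext i
    fin_cases i <;> rfl
  have h2 : ∀ q : ℕ, (fun i : Fin 1 => (![q, encode p] : Fin 2 → ℕ) (Fin.castLE (by omega) i)) =
      fun _ => q := fun q => by
    funext i
    obtain rfl := Subsingleton.elim i 0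
    rfl
  simp only [exStep, SOFormula.Holds, holds_widen, h1, hT, h2, Fin.castLE_refl]
  constructor
  · rintro ⟨q, ⟨r, rfl, hr⟩, h⟩
    exact ⟨r, hr, h⟩
  · rintro ⟨r, hr, h⟩
    exact ⟨_, ⟨r, rfl, hr⟩, h⟩

theorem holds_allStep {T : SOFormula 4 0} {φ : SOFormula 2 0} {p q : IOPair}
    {V : Fin 0 → ℕ → Bool} {R : IOPair → IOPair → Prop}
    (hT : ∀ p' q', T.Holds ![p', q', encode p, encode q] V ↔
      ∃ r s, p' = encode r ∧ q' = encode s ∧ R r s) :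
    (allStep T φ).Holds ![encode p, encode q] V ↔
      ∀ r s, R r s → φ.Holds ![encode r, encode s] V := by
  have h1 : ∀ p' q' : ℕ, (Fin.cons p' (Fin.cons q' ![encode p, encode q] : Fin 3 → ℕ) :
      Fin 4 → ℕ) = ![p', q', encode p, encode q] := fun _ _ => rfl
  have h2 : ∀ p' q' : ℕ, (fun i : Fin 2 => (![p', q', encode p, encode q] : Fin 4 → ℕ)
      (Fin.castLE (by omega) i)) = ![p', q'] := fun p' q' => by
    funext i
    fin_cases i <;> rfl
  simp only [allStep, SOFormula.Holds, holds_widen, h1, hT, h2, Fin.castLE_refl]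
  constructor
  · exact fun h r s hrs => h _ _ ⟨r, s, rfl, rfl, hrs⟩
  · rintro h _ _ ⟨r, s, rfl, rfl, hrs⟩
    exact h r s hrs

section
variable {V : Fin 0 → ℕ → Bool} {φ : SOFormula 1 0} {ψ : SOFormula 2 0} {p q : IOPair}

theorem holds_emptyPair :
    emptyPair.Holds (fun _ => encode p) V ↔ p.1 = [] ∧ p.2 = [] := by
  rw [emptyPair, Definable.holds_formula, encode_eq_zero, Prod.ext_iff]

theorem holds_boxPair :
    boxPair.Holds (fun _ => encode p) V ↔ p.1 = [] ∧ p.2.length ≤ 1 := by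
  rw [boxPair, Definable.holds_formula]
  simp only [outStep_encode, ← encode_emptyPair, encode_inj]
  obtain ⟨i, _ | ⟨n, _ | ⟨n', o⟩⟩⟩ := p <;> simp

theorem holds_exStep_numPair (n : Bool) : (exStep (numPair n) φ).Holds (fun _ => encode p) V ↔
    ∃ r : IOPair, p = (.inl n.toNat :: r.1, r.2) ∧ φ.Holds (fun _ => encode r) V := by
  refine holds_exStep fun _ => ?_
  exact (Definable.holds_formula _ _ _).trans numStep_encode

theorem holds_exStep_anyNumPair : (exStep anyNumPair φ).Holds (fun _ => encode p) V ↔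
    ∃ r : IOPair, (∃ n, p = (.inl n :: r.1, r.2)) ∧ φ.Holds (fun _ => encode r) V := by
  refine holds_exStep fun _ => (Definable.holds_formula _ _ _).trans ?_
  simp only [numStep_encode, Matrix.cons_val_zero, Matrix.cons_val_one]
  grind

theorem holds_exStep_anyStrPair : (exStep anyStrPair φ).Holds (fun _ => encode p) V ↔
    ∃ r : IOPair, (∃ l, p = (.inr l :: r.1, r.2)) ∧ φ.Holds (fun _ => encode r) V := by
  refine holds_exStep fun _ => (Definable.holds_formula _ _ _).trans ?_
  simp only [strStep_encode, Matrix.cons_val_zero, Matrix.cons_val_one]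
  grind

theorem holds_exStep_outPair (n : Bool) : (exStep (outPair n) φ).Holds (fun _ => encode p) V ↔
    ∃ r : IOPair, (r = p ∧ p.2 = [] ∨ p = (r.1, n.toNat :: r.2)) ∧
      φ.Holds (fun _ => encode r) V := by
  refine holds_exStep fun _ => (Definable.holds_formula _ _ _).trans ?_
  simp only [outStep_encode, noOutput_encode, Matrix.cons_val_zero, Matrix.cons_val_one]
  grind

theorem holds_exStep_anyOutPair : (exStep anyOutPair φ).Holds (fun _ => encode p) V ↔
    ∃ r : IOPair, (r = p ∧ p.2 = [] ∨ ∃ n, p = (r.1, n :: r.2)) ∧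
      φ.Holds (fun _ => encode r) V := by
  refine holds_exStep fun _ => (Definable.holds_formula _ _ _).trans ?_
  simp only [outStep_encode, noOutput_encode, Matrix.cons_val_zero, Matrix.cons_val_one]
  constructor
  · rintro (⟨rfl, h⟩ | ⟨n, r, rfl, h⟩)
    exacts [⟨p, rfl, Or.inl ⟨rfl, h⟩⟩, ⟨r, rfl, Or.inr ⟨n, h⟩⟩]
  · rintro ⟨r, rfl, ⟨rfl, h⟩ | ⟨n, h⟩⟩
    exacts [Or.inl ⟨rfl, h⟩, Or.inr ⟨n, r, rfl, h⟩]

theorem holds_agreePairs : agreePairs.Holds ![encode p, encode q] V ↔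
    ∀ n n' o o', p.2 = n :: o → q.2 = n' :: o' → n = n' := by
  rw [agreePairs, Definable.holds_formula]
  simp only [outStep_encode, Matrix.cons_val_zero, Matrix.cons_val_one]
  constructor
  · exact fun h n n' o o' ho ho' => h n n' _ _ ⟨(p.1, o), rfl, Prod.ext rfl ho⟩
      ⟨(q.1, o'), rfl, Prod.ext rfl ho'⟩
  · rintro h n n' _ _ ⟨r, rfl, rfl⟩ ⟨r', rfl, rfl⟩
    exact h _ _ _ _ rfl rfl

theorem holds_allStep_numPairs (n : Bool) :
    (allStep (numPairs n) ψ).Holds ![encode p, encode q] V ↔ ∀ r s : IOPair,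
      p = (.inl n.toNat :: r.1, r.2) ∧ q = (.inl n.toNat :: s.1, s.2) →
        ψ.Holds ![encode r, encode s] V := by
  refine holds_allStep fun _ _ => (Definable.holds_formula _ _ _).trans ?_
  simp only [numStep_encode, Matrix.cons_val]
  grind

theorem holds_allStep_anyNumPairs :
    (allStep anyNumPairs ψ).Holds ![encode p, encode q] V ↔ ∀ r s : IOPair,
      (∃ n, p = (.inl n :: r.1, r.2) ∧ q = (.inl n :: s.1, s.2)) →
        ψ.Holds ![encode r, encode s] V := by
  refine holds_allStep fun _ _ => (Definable.holds_formula _ _ _).trans ?_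
  simp only [numStep_encode, Matrix.cons_val]
  grind

theorem holds_allStep_anyStrPairs :
    (allStep anyStrPairs ψ).Holds ![encode p, encode q] V ↔ ∀ r s : IOPair,
      (∃ l l' : List Bool, (l <+: l' ∨ l' <+: l) ∧ p = (.inr l :: r.1, r.2) ∧
        q = (.inr l' :: s.1, s.2)) → ψ.Holds ![encode r, encode s] V := by
  refine holds_allStep fun p' q' => (Definable.holds_formula _ _ _).trans ?_
  simp only [strStep_encode, Matrix.cons_val]
  constructor
  · rintro ⟨_, _, ⟨l, r, rfl, h1, h2⟩, ⟨l', s, rfl, h3, h4⟩, h⟩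
    exact ⟨r, s, h1, h3, l, l', comparable_encode.1 h, h2, h4⟩
  · rintro ⟨r, s, h1, h3, l, l', h, h2, h4⟩
    exact ⟨_, _, ⟨l, r, rfl, h1, h2⟩, ⟨l', s, rfl, h3, h4⟩, comparable_encode.2 h⟩

theorem holds_allStep_outPairs (n : Bool) :
    (allStep (outPairs n) ψ).Holds ![encode p, encode q] V ↔ ∀ r s : IOPair,
      p = (r.1, n.toNat :: r.2) ∧ q = (s.1, n.toNat :: s.2) →
        ψ.Holds ![encode r, encode s] V := by
  refine holds_allStep fun _ _ => (Definable.holds_formula _ _ _).trans ?_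
  simp only [outStep_encode, Matrix.cons_val]
  grind

theorem holds_allStep_anyOutPairs :
    (allStep anyOutPairs ψ).Holds ![encode p, encode q] V ↔ ∀ r s : IOPair,
      (∃ n, p = (r.1, n :: r.2) ∧ q = (s.1, n :: s.2)) → ψ.Holds ![encode r, encode s] V := by
  refine holds_allStep fun _ _ => (Definable.holds_formula _ _ _).trans ?_
  simp only [outStep_encode, Matrix.cons_val]
  constructor
  · rintro ⟨n, ⟨r, rfl, h⟩, s, rfl, h'⟩
    exact ⟨r, s, rfl, rfl, n, h, h'⟩
  · rintro ⟨r, s, rfl, rfl, n, h, h'⟩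
    exact ⟨n, ⟨r, rfl, h⟩, s, rfl, h'⟩

end

/-- The case distinctions in `Shape` become the existence of a pair one elementary step away. A pair
without output passes an existential quantifier or a disjunction unchanged, which is what `NoOutput`
provides for. -/
theorem holds_shapeFormula {k : ℕ} (A : BoxFormula k) (p : IOPair) (V : Fin 0 → ℕ → Bool) :
    A.shapeFormula.Holds (fun _ => encode p) V ↔ A.Shape p.1 p.2 := by
  induction A generalizing p with
  | eq s t => exact holds_emptyPair
  | lt s t => exact holds_emptyPair
  | neg A => exact holds_emptyPair
  | and A B ihA ihB =>
    simp only [shapeFormula, SOFormula.Holds, holds_emptyPair, holds_exStep_numPair, ihA, ihB]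
    obtain ⟨_ | ⟨(_ | _ | n) | l, i⟩, o⟩ := p <;> simp [Shape]
  | or A B ihA ihB =>
    simp only [shapeFormula, SOFormula.Holds, holds_exStep_outPair, ihA, ihB]
    obtain ⟨i, _ | ⟨_ | _ | n, o⟩⟩ := p <;> simp [Shape]
  | imp A B ihA ihB =>
    simp only [shapeFormula, SOFormula.Holds, holds_emptyPair, holds_exStep_anyStrPair, ihB]
    obtain ⟨_ | ⟨n | l, i⟩, o⟩ := p <;> simp [Shape]
  | ex A ih =>
    simp only [shapeFormula, holds_exStep_anyOutPair, ih]
    obtain ⟨i, _ | ⟨n, o⟩⟩ := p <;> simp [Shape]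
  | all A ih =>
    simp only [shapeFormula, SOFormula.Holds, holds_emptyPair, holds_exStep_anyNumPair, ih]
    obtain ⟨_ | ⟨n | l, i⟩, o⟩ := p <;> simp [Shape]
  | box A => exact holds_boxPair

/-- Where `Compatible` defaults to truth, no elementary step matches both pairs and the universal
template holds vacuously. Equality of the first outputs is added separately by `agreePairs`. -/
theorem holds_compatFormula {k : ℕ} (A : BoxFormula k) (p q : IOPair) (V : Fin 0 → ℕ → Bool) :
    A.compatFormula.Holds ![encode p, encode q] V ↔ A.Compatible p.1 p.2 q.1 q.2 := by
  have htrue : ∀ p q : IOPair, truePairs.Holds ![encode p, encode q] V := fun p q =>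
    (Definable.holds_formula _ _ _).2 rfl
  induction A generalizing p q with
  | eq s t => exact iff_of_true (htrue p q) trivial
  | lt s t => exact iff_of_true (htrue p q) trivial
  | neg A => exact iff_of_true (htrue p q) trivial
  | and A B ihA ihB =>
    simp only [compatFormula, SOFormula.Holds, holds_allStep_numPairs, ihA, ihB]
    obtain ⟨_ | ⟨(_ | _ | n) | l, i⟩, o⟩ := p <;>
      obtain ⟨_ | ⟨(_ | _ | n') | l', i'⟩, o'⟩ := q <;> simp [Compatible] <;> grind
  | or A B ihA ihB =>
    simp only [compatFormula, SOFormula.Holds, holds_agreePairs, holds_allStep_outPairs, ihA, ihB]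
    obtain ⟨i, _ | ⟨n, o⟩⟩ := p <;> obtain ⟨i', _ | ⟨n', o'⟩⟩ := q <;> simp [Compatible]
    grind
  | imp A B ihA ihB =>
    simp only [compatFormula, holds_allStep_anyStrPairs, ihB]
    obtain ⟨_ | ⟨n | l, i⟩, o⟩ := p <;> obtain ⟨_ | ⟨n' | l', i'⟩, o'⟩ := q <;>
      simp [Compatible]
    grind
  | ex A ih =>
    simp only [compatFormula, SOFormula.Holds, holds_agreePairs, holds_allStep_anyOutPairs, ih]
    obtain ⟨i, _ | ⟨n, o⟩⟩ := p <;> obtain ⟨i', _ | ⟨n', o'⟩⟩ := q <;> simp [Compatible]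
    grind
  | all A ih =>
    simp only [compatFormula, holds_allStep_anyNumPairs, ih]
    obtain ⟨_ | ⟨n | l, i⟩, o⟩ := p <;> obtain ⟨_ | ⟨n' | l', i'⟩, o'⟩ := q <;>
      simp [Compatible]
    grind
  | box A =>
    refine holds_agreePairs.trans ?_
    obtain ⟨i, _ | ⟨n, o⟩⟩ := p <;> obtain ⟨i', _ | ⟨n', o'⟩⟩ := q <;> simp [Compatible]
    grind

theorem holds_wellFormedFormula {k : ℕ} (A : BoxFormula k) (v : Fin 0 → ℕ) (X : ℕ → Bool) :
    A.wellFormedFormula.Holds v (fun _ => X) ↔ A.WellFormed (pairsOf X) := by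
  have h1 : ∀ c, listedPair.Holds (fun _ => c) (fun _ => X) ↔ ListsCode X c := fun c =>
    Definable.holds_formula _ _ _
  have h2 : ∀ c d, listedPairs.Holds ![c, d] (fun _ => X) ↔ ListsCode X c ∧ ListsCode X d :=
    fun c d => Definable.holds_formula _ _ _
  have e1 : ∀ c : ℕ, (Fin.cons c v : Fin 1 → ℕ) = fun _ => c := fun c => by
    funext i
    fin_cases i
    rfl
  have e2 : ∀ c d : ℕ, (Fin.cons c (fun _ => d : Fin 1 → ℕ) : Fin 2 → ℕ) = ![c, d] :=
    fun c d => by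
      funext i
      fin_cases i <;> rfl
  simp only [wellFormedFormula, SOFormula.Holds, holds_widen, Fin.castLE_refl, e1, e2, h1, h2,
    listsCode_iff]
  constructor
  · exact fun h => ⟨fun p hp => (A.holds_shapeFormula p _).1 (h.1 _ ⟨p, hp, rfl⟩),
      fun p hp q hq => (A.holds_compatFormula p q _).1 (h.2 _ _ ⟨⟨p, hp, rfl⟩, q, hq, rfl⟩)⟩
  · refine fun h => ⟨?_, ?_⟩
    · rintro _ ⟨p, hp, rfl⟩
      exact (A.holds_shapeFormula p _).2 (h.1 p hp)
    · rintro _ _ ⟨⟨p, hp, rfl⟩, q, hq, rfl⟩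
      exact (A.holds_compatFormula p q _).2 (h.2 p hp q hq)

theorem holds_witnessFormula {k : ℕ} (A : BoxFormula k) {φ : SOFormula k 1} {v : Fin k → ℕ}
    (hφ : ∀ P, φ.Holds v (fun _ => codeSet P) ↔ A.Meets v P) (X : ℕ → Bool) :
    (A.witnessFormula φ).Holds v (fun _ => X) ↔ A.IsWitness X v := by
  have h : (bindSet (m := 1) listedSet.widen φ).Holds v (fun _ => X) ↔
      φ.Holds v fun _ => codeSet (pairsOf X) :=
    holds_bindSet_of_eq fun Q => holds_widen.trans (Definable.holds_formula _ _ _)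
  rw [witnessFormula, SOFormula.Holds, holds_widen, h, hφ, IsWitness]
  exact and_congr_left fun _ => A.holds_wellFormedFormula _ X

/-- The claims need each other at negation and at `box`. The second is needed only for sets of the
form `codeSet P`, because the templates pin every set of pairs to one of these. -/
theorem holds_truthFormulas {k : ℕ} (A : BoxFormula k) (v : Fin k → ℕ) :
    (∀ V, A.truthFormulas.1.Holds v V ↔ A.Holds v) ∧
      ∀ P, A.truthFormulas.2.Holds v (fun _ => codeSet P) ↔ A.Meets v P := by
  have hnum : ∀ {k : ℕ} {v : Fin k → ℕ} {P : Set IOPair} (n : Bool) (φ : SOFormula k 1),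
      (bindSet (m := 1) (numSet n).widen φ).Holds v (fun _ => codeSet P) ↔
        φ.Holds v fun _ => codeSet (afterNum P n.toNat) := fun n φ =>
    holds_bindSet_of_eq fun Q => holds_widen.trans <|
      (Definable.holds_formula _ _ _).trans eq_codeSet_afterNum
  have hout : ∀ {k : ℕ} {v : Fin k → ℕ} {P : Set IOPair} (n : Bool) (φ : SOFormula k 1),
      (bindSet (m := 1) (outSet n).widen φ).Holds v (fun _ => codeSet P) ↔
        (afterOut P n.toNat).Nonempty ∧ φ.Holds v fun _ => codeSet (afterOut P n.toNat) :=
    fun n φ => holds_bindSet fun Q => holds_widen.trans <|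
      (Definable.holds_formula _ _ _).trans eq_codeSet_afterOut
  induction A with
  | eq s t => exact ⟨fun _ => Iff.rfl, fun _ => Iff.rfl⟩
  | lt s t => exact ⟨fun _ => Iff.rfl, fun _ => Iff.rfl⟩
  | neg A ih =>
    exact ⟨fun V => not_congr ((ih v).1 V), fun P => not_congr (holds_widen.trans ((ih v).1 _))⟩
  | and A B ihA ihB =>
    exact ⟨fun V => and_congr ((ihA v).1 V) ((ihB v).1 V), fun P =>
      and_congr ((hnum false _).trans ((ihA v).2 _)) ((hnum true _).trans ((ihB v).2 _))⟩
  | or A B ihA ihB =>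
    exact ⟨fun V => or_congr ((ihA v).1 V) ((ihB v).1 V), fun P =>
      or_congr ((hout false _).trans (and_congr_right' ((ihA v).2 _)))
        ((hout true _).trans (and_congr_right' ((ihB v).2 _)))⟩
  | imp A B ihA ihB =>
    refine ⟨fun V => imp_congr ((ihA v).1 V) ((ihB v).1 V), fun P => ?_⟩
    simp only [truthFormulas, SOFormula.Holds, holds_widen_cons,
      A.holds_witnessFormula (ihA v).2, IsWitness, Meets, and_imp]
    refine forall_congr' fun X => imp_congr Iff.rfl (imp_congr Iff.rfl ?_)
    exact (holds_bindSet_of_eq fun Q => holds_widen.trans <|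
      (Definable.holds_formula _ _ _).trans eq_codeSet_afterSeq).trans ((ihB v).2 _)
  | ex A ih =>
    refine ⟨fun V => exists_congr fun n => (ih _).1 V, fun P => exists_congr fun n => ?_⟩
    refine (holds_bindSet fun Q => holds_widen.trans <|
      (Definable.holds_formula _ _ _).trans eq_codeSet_afterOut).trans ?_
    exact and_congr_right' ((ih _).2 _)
  | all A ih =>
    refine ⟨fun V => forall_congr' fun n => (ih _).1 V, fun P => forall_congr' fun n => ?_⟩
    exact (holds_bindSet_of_eq fun Q => holds_widen.trans <|
      (Definable.holds_formula _ _ _).trans eq_codeSet_afterNum).trans ((ih _).2 _)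
  | box A ih =>
    have hw := fun X => A.holds_witnessFormula (ih v).2 X
    have h1 : ∀ X (V : Fin 0 → ℕ → Bool), (hasCode.widen : SOFormula _ 1).Holds v (Fin.cons X V) ↔
        ∃ e, IsCodeOf e X := fun X V => holds_widen.trans (Definable.holds_formula _ _ _)
    have h2 : ∀ X P, (codeOutput.widen : SOFormula _ 2).Holds v
        (Fin.cons X fun _ => codeSet P) ↔ ∃ e, (afterOut P e).Nonempty ∧ IsCodeOf e X := by
      refine fun X P => holds_widen.trans ((Definable.holds_formula _ _ _).trans ?_)
      refine exists_congr fun e => and_congr ?_ Iff.rfl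
      change (∃ q p, codeSet P p = true ∧ OutStep e q p) ↔ _
      simp only [codeSet_eq_true]
      constructor
      · rintro ⟨q, _, ⟨p, hp, rfl⟩, h⟩
        obtain ⟨r, rfl, rfl⟩ := outStep_encode.1 h
        exact ⟨r, hp⟩
      · rintro ⟨r, hr⟩
        exact ⟨_, _, ⟨_, hr, rfl⟩, outStep_encode.2 ⟨r, rfl, rfl⟩⟩
    refine ⟨fun V => ?_, fun P => ?_⟩
    · have h3 : ∀ X, (A.witnessFormula A.truthFormulas.2).Holds v (Fin.cons X V) ↔
          A.IsWitness X v := fun X => by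
        rw [← hw, iff_iff_eq]
        congr 1
        funext j
        fin_cases j
        rfl
      simp only [truthFormulas, SOFormula.Holds, h1, h3, Holds, IsWitness]
      grind
    · simp only [truthFormulas, SOFormula.Holds, holds_widen_cons, h2, hw, Meets, IsWitness]
      grind

end BoxFormula

/-! ### The translation on Gödel numbers -/

namespace BoxFormula

open SOFormula

/-- The code of `exStep T φ`, given those of `T` and `φ`. -/
def codeExStep (t c : ℕ) : ℕ := Nat.pair 7 (Nat.pair 4 (Nat.pair t c))

/-- The code of `allStep T φ`, given those of `T` and `φ`. -/
def codeAllStep (t c : ℕ) : ℕ := Nat.pair 8 (Nat.pair 8 (Nat.pair 6 (Nat.pair t c)))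

/-- The code of `bindSet T φ`, given those of `T` and `φ`. -/
def codeBindSet (t c : ℕ) : ℕ := Nat.pair 9 (Nat.pair 4 (Nat.pair t c))

theorem code_exStep (T : SOFormula 2 0) (φ : SOFormula 1 0) :
    (exStep T φ).code = codeExStep T.code φ.code := by
  simp only [exStep, SOFormula.code, code_widen, codeExStep]

theorem code_allStep (T : SOFormula 4 0) (φ : SOFormula 2 0) :
    (allStep T φ).code = codeAllStep T.code φ.code := by
  simp only [allStep, SOFormula.code, code_widen, codeAllStep]

theorem code_bindSet {k m : ℕ} (T : SOFormula k (m + 1)) (φ : SOFormula k 1) :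
    (bindSet T φ).code = codeBindSet T.code φ.code := by
  simp only [bindSet, SOFormula.code, code_widen, codeBindSet]

/-- The code of `A.witnessFormula φ`, given those of `A.shapeFormula`, `A.compatFormula` and `φ`. -/
noncomputable def codeWitness (s c m : ℕ) : ℕ :=
  Nat.pair 4 (Nat.pair (Nat.pair 4 (Nat.pair (Nat.pair 8 (Nat.pair 6 (Nat.pair listedPair.code s)))
    (Nat.pair 8 (Nat.pair 8 (Nat.pair 6 (Nat.pair listedPairs.code c))))))
    (codeBindSet listedSet.code m))

theorem code_witnessFormula {k : ℕ} (A : BoxFormula k) (φ : SOFormula k 1) :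
    (A.witnessFormula φ).code =
      codeWitness A.shapeFormula.code A.compatFormula.code φ.code := by
  simp only [witnessFormula, wellFormedFormula, SOFormula.code, code_widen, code_bindSet,
    codeWitness]

/-- The codes of the translations of a compound formula, for given codes of the translations of its
components: `x` of a single component, `a` and `b` of two components. -/
noncomputable def codeStep (tag : ℕ) (x a b : ℕ × ℕ × ℕ × ℕ) : ℕ × ℕ × ℕ × ℕ :=
  if tag = 2 then (emptyPair.code, truePairs.code, Nat.pair 3 x.2.2.1, Nat.pair 3 x.2.2.1)
  else if tag = 3 then
    (Nat.pair 5 (Nat.pair emptyPair.code (Nat.pair 5 (Nat.pair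
      (codeExStep (numPair false).code a.1) (codeExStep (numPair true).code b.1)))),
    Nat.pair 4 (Nat.pair (codeAllStep (numPairs false).code a.2.1)
      (codeAllStep (numPairs true).code b.2.1)),
    Nat.pair 4 (Nat.pair a.2.2.1 b.2.2.1),
    Nat.pair 4 (Nat.pair (codeBindSet (numSet false).code a.2.2.2)
      (codeBindSet (numSet true).code b.2.2.2)))
  else if tag = 4 then
    (Nat.pair 5 (Nat.pair (codeExStep (outPair false).code a.1)
      (codeExStep (outPair true).code b.1)),
    Nat.pair 4 (Nat.pair agreePairs.code (Nat.pair 4 (Nat.pair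
      (codeAllStep (outPairs false).code a.2.1) (codeAllStep (outPairs true).code b.2.1)))),
    Nat.pair 5 (Nat.pair a.2.2.1 b.2.2.1),
    Nat.pair 5 (Nat.pair (codeBindSet (outSet false).code a.2.2.2)
      (codeBindSet (outSet true).code b.2.2.2)))
  else if tag = 5 then
    (Nat.pair 5 (Nat.pair emptyPair.code (codeExStep anyStrPair.code b.1)),
    codeAllStep anyStrPairs.code b.2.1,
    Nat.pair 6 (Nat.pair a.2.2.1 b.2.2.1),
    Nat.pair 10 (Nat.pair 6 (Nat.pair (codeWitness a.1 a.2.1 a.2.2.2)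
      (codeBindSet seqSet.code b.2.2.2))))
  else if tag = 6 then
    (codeExStep anyOutPair.code x.1,
    Nat.pair 4 (Nat.pair agreePairs.code (codeAllStep anyOutPairs.code x.2.1)),
    Nat.pair 7 x.2.2.1,
    Nat.pair 7 (codeBindSet anyOutSet.code x.2.2.2))
  else if tag = 7 then
    (Nat.pair 5 (Nat.pair emptyPair.code (codeExStep anyNumPair.code x.1)),
    codeAllStep anyNumPairs.code x.2.1,
    Nat.pair 8 x.2.2.1,
    Nat.pair 8 (codeBindSet anyNumSet.code x.2.2.2))
  else
    (boxPair.code, agreePairs.code,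
    Nat.pair 9 (Nat.pair 4 (Nat.pair hasCode.code (codeWitness x.1 x.2.1 x.2.2.2))),
    Nat.pair 9 (Nat.pair 4 (Nat.pair codeOutput.code (codeWitness x.1 x.2.1 x.2.2.2))))

/-- The codes of the translations of the formula with code `n`. -/
noncomputable def codeTranslations (n : ℕ) : ℕ × ℕ × ℕ × ℕ :=
  if _h : 2 ≤ n.unpair.1 then
    codeStep n.unpair.1 (codeTranslations n.unpair.2) (codeTranslations n.unpair.2.unpair.1)
      (codeTranslations n.unpair.2.unpair.2)
  else (emptyPair.code, truePairs.code, n, n)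
termination_by n
decreasing_by
  all_goals
    have h' : n.unpair.1 = (n.unpair.1 - 1) + 1 := by omega
    first | exact unpair_snd_lt h' | exact unpair_snd_fst_lt h' | exact unpair_snd_snd_lt h'

/-- Atomic formulas have the same Gödel numbers in both languages, so there the number itself serves
as its translation. -/
theorem codeTranslations_code {k : ℕ} (A : BoxFormula k) : codeTranslations A.code =
    (A.shapeFormula.code, A.compatFormula.code, A.truthFormulas.1.code,
      A.truthFormulas.2.code) := by
  induction A <;> rw [codeTranslations] <;>
    simp_all [BoxFormula.code, codeStep, shapeFormula, compatFormula, truthFormulas,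
      SOFormula.code, code_exStep, code_allStep, code_bindSet, code_witnessFormula, code_widen]

/-- The codes of the templates enter only as constants, so their choice by mere existence does not
matter. -/
theorem primrec_codeTranslations : Primrec codeTranslations := by
  have hstep : Primrec fun q : ℕ × (ℕ × ℕ × ℕ × ℕ) × (ℕ × ℕ × ℕ × ℕ) × (ℕ × ℕ × ℕ × ℕ) =>
      codeStep q.1 q.2.1 q.2.2.1 q.2.2.2 := by
    unfold codeStep codeWitness codeExStep codeAllStep codeBindSet
    fun_prop
  -- All three conceivable components are evaluated whatever the tag; each is a smaller number even
  -- if it codes nothing.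
  let deps : ℕ → List ℕ := fun n => bif decide (2 ≤ n.unpair.1) then
    [n.unpair.2, n.unpair.2.unpair.1, n.unpair.2.unpair.2] else []
  let step : ℕ → List (ℕ × ℕ × ℕ × ℕ) → ℕ × ℕ × ℕ × ℕ := fun n r =>
    bif decide (2 ≤ n.unpair.1) then
      codeStep n.unpair.1 (r.getD 0 (0, 0, 0, 0)) (r.getD 1 (0, 0, 0, 0)) (r.getD 2 (0, 0, 0, 0))
    else (emptyPair.code, truePairs.code, n, n)
  have hcode : Primrec fun p : ℕ × List (ℕ × ℕ × ℕ × ℕ) => codeStep p.1.unpair.1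
      (p.2.getD 0 (0, 0, 0, 0)) (p.2.getD 1 (0, 0, 0, 0)) (p.2.getD 2 (0, 0, 0, 0)) :=
    hstep.comp (g := fun p : ℕ × List (ℕ × ℕ × ℕ × ℕ) => (p.1.unpair.1, p.2.getD 0 (0, 0, 0, 0),
      p.2.getD 1 (0, 0, 0, 0), p.2.getD 2 (0, 0, 0, 0))) (by fun_prop)
  have h : Primrec fun p : ℕ × List (ℕ × ℕ × ℕ × ℕ) => step p.1 p.2 := by
    unfold step
    fun_prop
  refine Primrec.nat_omega_rec' _ (m := id) (l := deps) (g := fun n r => some (step n r))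
    Primrec.id (by unfold deps; fun_prop) (Primrec.option_some.comp h).to₂
    (fun n n' hn' => ?_) fun n => ?_
  · by_cases h : 2 ≤ n.unpair.1
    · have h' : n.unpair.1 = (n.unpair.1 - 1) + 1 := by omega
      simp only [deps, h, decide_true, cond_true, List.mem_cons, List.not_mem_nil, or_false] at hn'
      rcases hn' with rfl | rfl | rfl
      exacts [unpair_snd_lt h', unpair_snd_fst_lt h', unpair_snd_snd_lt h']
    · simp [deps, h] at hn'
  · rw [codeTranslations]
    by_cases h : 2 ≤ n.unpair.1 <;> simp [deps, step, h]

end BoxFormula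

theorem proposition6 :
    (∃ t : ℕ → ℕ, Computable t ∧
      ∀ (k : ℕ) (A : BoxFormula k), ∃ ψ : SOFormula k 1, t A.code = ψ.code ∧
        ∀ (v : Fin k → ℕ) (W : ℕ → Bool),
          BoxFormula.IsWitness W A v ↔ ψ.Holds v (fun _ => W)) ∧
    (∃ f : ℕ → (ℕ → Bool) → (ℕ → Bool), IsRecursiveFunctional f ∧
      ∀ (n : ℕ) (φ : SOFormula 0 1), IsLeast {j : ℕ | 0 < j ∧ SOFormula.IsPi j φ} n →
        ∀ X : ℕ → Bool,
          φ.Holds Fin.elim0 (fun _ => X) ↔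
            BoxFormula.IsWitness (f φ.code X) (BoxFormula.iterImp n) Fin.elim0) := by
  refine ⟨⟨fun n => BoxFormula.codeWitness (BoxFormula.codeTranslations n).1
    (BoxFormula.codeTranslations n).2.1 (BoxFormula.codeTranslations n).2.2.2, ?_, fun k A =>
    ⟨A.witnessFormula A.truthFormulas.2, ?_, fun v W =>
      (A.holds_witnessFormula (A.holds_truthFormulas v).2 W).symm⟩⟩,
    exists_recursiveFunctional_isWitness_iterImp⟩
  · have h := BoxFormula.primrec_codeTranslations
    unfold BoxFormula.codeWitness BoxFormula.codeBindSet
    exact Primrec.to_comp (by fun_prop)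
  · simp only [BoxFormula.codeTranslations_code, BoxFormula.code_witnessFormula]
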